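/- Let $k\ge 2$, let $\mu_k$ be the characteristic function of the $k$-free numbers (the positive integers divisible by no $d^k$ with an integer $d>1$). For real $X\ge 1$, a positive integer $q$ and an integer $a$ coprime to $q$, define $E(X,q,a)$ by $$\sum_{\substack{1\le n\le X\\ n\equiv a\ (\mathrm{mod}\ q)}}\mu_k(n)=\frac{A_q}{\varphi(q)}X+E(X,q,a),\qquad A_q=\frac{\varphi(q)}{q}\prod_{p\nmid q}\left(1-\frac1{p^k}\right),$$ where $p$ runs over primes, and for a positive integer $\ell$ put $$\mathcal M(X,q,\ell)=\sum_{\substack{a\ (\mathrm{mod}\ q)\\ (a,q)=1}}E(X,q,a)^{\ell}.$$ Then for every $\varepsilon>0$ and all integers $k\ge2$ and $\ell\ge3$, the following two estimates hold, with implied constants depending only on $\varepsilon,k,\ell$. For every real $X\ge1$ and every positive integer $q\le X$, $$\mathcal M(X,q,\ell)\ll_{\varepsilon,k,\ell} X^{\varepsilon}\left(q\left(\frac Xq\right)^{\frac{\ell}{2k}}+X^{\frac2{k+1}}\left(\frac Xq\right)^{\ell-1}\right).$$ In particular, with $c_k=\frac{2k(k-1)}{(k+1)(2k-1)}$, for every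 real $X\ge1$ and every positive integer $q$ with $X^{1-\frac{c_k}{\ell}}\le q\le X$, $$\mathcal M(X,q,\ell)\ll_{\varepsilon,k,\ell}\varphi(q)\left(\frac Xq\right)^{\frac{\ell}{2k}+\varepsilon}.$$ -/

import Mathlib

/-- `n` is `k`-free: it is not divisible by the `k`-th power of any integer `d > 1`. -/
def KFree (k n : ℕ) : Prop :=
  ∀ d : ℕ, 1 < d → ¬ d ^ k ∣ n

open Classical in
/-- The characteristic function `μ_k` of the `k`-free numbers. -/
noncomputable def muK (k n : ℕ) : ℝ :=
  if KFree k n then 1 else 0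

/-- The density `A_q = (φ(q)/q) ∏_{p ∤ q} (1 - 1/p^k)` of the `k`-free numbers coprime to `q`;
the product is over the primes not dividing `q`. -/
noncomputable def densityA (k q : ℕ) : ℝ :=
  (Nat.totient q : ℝ) / (q : ℝ) *
    ∏' p : {p : ℕ // p.Prime ∧ ¬ p ∣ q}, (1 - 1 / ((p : ℕ) : ℝ) ^ k)

/-- The error term
`E(X,q,a) = ∑_{1 ≤ n ≤ X, n ≡ a (mod q)} μ_k(n) - (A_q / φ(q)) X`. -/
noncomputable def errE (k : ℕ) (X : ℝ) (q : ℕ) (a : ℤ) : ℝ :=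
  (∑ n ∈ (Finset.Icc 1 ⌊X⌋₊).filter (fun n : ℕ => (n : ℤ) ≡ a [ZMOD (q : ℤ)]), muK k n)
    - densityA k q / (Nat.totient q : ℝ) * X

/-- The `ℓ`-th moment of `E(X,q,a)`, summed over the residue classes `a` modulo `q` that are
coprime to `q`. The residue classes are represented by `0, 1, …, q - 1`. -/
noncomputable def momentM (k : ℕ) (X : ℝ) (q l : ℕ) : ℝ :=
  ∑ a ∈ (Finset.range q).filter (fun a : ℕ => Nat.Coprime a q), errE k X q (a : ℤ) ^ l

/-- The constant `c_k = 2k(k-1) / ((k+1)(2k-1))`. -/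
noncomputable def cConst (k : ℕ) : ℝ :=
  2 * (k : ℝ) * ((k : ℝ) - 1) / (((k : ℝ) + 1) * (2 * (k : ℝ) - 1))

/-! Put h = X / q. For n ≤ X coprime to q, being k-free is a finite sieve condition: no p ^ k
divides n, for the primes p ≤ X not dividing q (`muK_eq_sieveInd`). The moment is compared with a
model in which this sieve is translated by an integer x, uniform modulo the product of the p ^ k.
The model gives the diagonal term h ^ (l / (2k) + ε) per class, the comparison gives the term X ^ (2
/ (k + 1) + ε) h ^ (l - 1).

Model. Since q is coprime to the sieving primes, a translated residue class behaves like a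
translated interval of about h integers, and `exists_sieveMoment_le` bounds the 2r-th moment of the
discrepancy on length H by H ^ (r / k + ε), uniformly in the set of primes. The primes are added one
at a time. By the Chinese remainder theorem the residue modulo p ^ k is independent of the older
sieve, and the new discrepancy is (1 - p ^ (-k)) times the old one plus a fluctuation whose mean
over that residue is zero. The linear term of the Taylor expansion therefore vanishes, and the old
moment is multiplied only by a factor close to 1. If p ^ k ≤ H, the moments of the fluctuation are
those of the old sieve on length about H / p ^ k, and induction on H applies; if p ^ k > H, the
fluctuation is bounded by 1 and has second moment O(H / p ^ k). The factors multiply to a bounded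
constant. A finite set of primes is left out to close the induction and then restored at the cost of
a constant.

Comparison. After a binomial expansion, the i-th powers of the class sums, summed over the classes,
become correlations of the sieve along O(h ^ (i - 1)) shift vectors (`sum_classSet_pow`). Each has
the expected mean value up to X ^ (2 / (k + 1) + ε), uniformly in the shifts
(`exists_correlation_le`), and the model has the same mean values. The correlation bound is a Möbius
sum cut at d = y ^ 2 with y ^ (k + 1) = X. Beyond the cut, the product of the primes whose k-th
powers hit n has either a divisor in (y, y ^ 2] or a prime factor above y, and both are rare.

For q in the shorter range, the second term is smaller than the first by a power of X, up to a
factor h ^ ε (`error_le_of_le`). This saving absorbs both the X ^ η of the general bound and q /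
φ(q). -/

namespace KFreeMoments
open Finset
open scoped ArithmeticFunction.Moebius

/-! ### Averages over residues, and progressions inside intervals. -/

/-- The mean of `g` over the residues `0, …, Q - 1`. -/
noncomputable def cyclicAvg (Q : ℕ) (g : ℤ → ℝ) : ℝ :=
  (∑ n ∈ range Q, g n) / Q

/-- The indicator of the integers divisible by no `p ^ k` with `p ∈ S`. -/
noncomputable def sieveInd (k : ℕ) (S : Finset ℕ) (n : ℤ) : ℝ :=
  ∏ p ∈ S, (1 - if (p : ℤ) ^ k ∣ n then 1 else 0)

/-- A period of `sieveInd k S`. -/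
def sieveMod (k : ℕ) (S : Finset ℕ) : ℕ := ∏ p ∈ S, p ^ k

/-- The mean value of `sieveInd k S`. -/
noncomputable def sieveDens (k : ℕ) (S : Finset ℕ) : ℝ :=
  ∏ p ∈ S, (1 - 1 / (p : ℝ) ^ k)

/-- The deviation from its mean of the sum of `sieveInd k S` over `x, …, x + H - 1`. -/
noncomputable def sieveErr (k : ℕ) (S : Finset ℕ) (H : ℕ) (x : ℤ) : ℝ :=
  ∑ t ∈ range H, sieveInd k S (x + t) - sieveDens k S * H

/-- The `L`-th moment of `sieveErr k S H` over a period. -/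
noncomputable def sieveMoment (k : ℕ) (S : Finset ℕ) (L H : ℕ) : ℝ :=
  cyclicAvg (sieveMod k S) fun x => sieveErr k S H x ^ L

lemma cyclicAvg_add (Q : ℕ) (f g : ℤ → ℝ) :
    cyclicAvg Q (fun x => f x + g x) = cyclicAvg Q f + cyclicAvg Q g := by
  simp [cyclicAvg, sum_add_distrib, add_div]

lemma cyclicAvg_sub (Q : ℕ) (f g : ℤ → ℝ) :
    cyclicAvg Q (fun x => f x - g x) = cyclicAvg Q f - cyclicAvg Q g := by
  simp [cyclicAvg, sum_sub_distrib, sub_div]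

lemma cyclicAvg_const_mul (Q : ℕ) (c : ℝ) (f : ℤ → ℝ) :
    cyclicAvg Q (fun x => c * f x) = c * cyclicAvg Q f := by
  simp [cyclicAvg, ← mul_sum, mul_div_assoc]

lemma cyclicAvg_sum {ι : Type*} (Q : ℕ) (s : Finset ι) (f : ι → ℤ → ℝ) :
    cyclicAvg Q (fun x => ∑ i ∈ s, f i x) = ∑ i ∈ s, cyclicAvg Q (f i) := by
  simp only [cyclicAvg]
  rw [sum_comm, sum_div]

lemma cyclicAvg_const {Q : ℕ} (hQ : 0 < Q) (c : ℝ) : cyclicAvg Q (fun _ => c) = c := by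
  have : (Q : ℝ) ≠ 0 := by positivity
  simp [cyclicAvg]
  field_simp

lemma cyclicAvg_mono (Q : ℕ) {f g : ℤ → ℝ} (h : ∀ x, f x ≤ g x) :
    cyclicAvg Q f ≤ cyclicAvg Q g := by
  unfold cyclicAvg
  gcongr
  exact h _

lemma cyclicAvg_nonneg (Q : ℕ) {f : ℤ → ℝ} (h : ∀ x, 0 ≤ f x) : 0 ≤ cyclicAvg Q f :=
  div_nonneg (sum_nonneg fun _ _ => h _) (Nat.cast_nonneg _)

lemma abs_cyclicAvg_le (Q : ℕ) (f : ℤ → ℝ) :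
    |cyclicAvg Q f| ≤ cyclicAvg Q (fun x => |f x|) := by
  unfold cyclicAvg
  rw [abs_div, Nat.abs_cast]
  gcongr
  exact abs_sum_le_sum_abs _ _

lemma cyclicAvg_pow_le {Q : ℕ} (hQ : 0 < Q) {L : ℕ} (hL : Even L) (f : ℤ → ℝ) :
    cyclicAvg Q f ^ L ≤ cyclicAvg Q (fun x => f x ^ L) := by
  have hQ' : (Q : ℝ) ≠ 0 := by positivity
  have := Real.pow_arith_mean_le_arith_mean_pow_of_even (range Q) (fun _ => (1 / Q : ℝ))
    (fun n => f n) (fun _ _ => by positivity) (by simp; field_simp) hL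
  simpa [cyclicAvg, ← mul_sum, div_eq_inv_mul] using this

lemma periodic_emod {g : ℤ → ℝ} {Q : ℕ} (hg : Function.Periodic g (Q : ℤ)) (x : ℤ) :
    g (x % Q) = g x := by
  conv_rhs => rw [← Int.emod_add_mul_ediv x Q]
  rw [mul_comm]
  have := (hg.int_mul (x / Q)) (x % Q)
  simpa using this.symm

lemma cyclicAvg_affine {Q : ℕ} {c : ℤ} (hc : IsCoprime c (Q : ℤ)) (b : ℤ)
    {g : ℤ → ℝ} (hg : Function.Periodic g (Q : ℤ)) :
    cyclicAvg Q (fun x => g (c * x + b)) = cyclicAvg Q g := by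
  rcases Nat.eq_zero_or_pos Q with rfl | hQ
  · simp [cyclicAvg]
  have hQ' : (0 : ℤ) < Q := by exact_mod_cast hQ
  unfold cyclicAvg
  congr 1
  have key : ∀ n : ℕ, (((c * n + b) % Q).toNat : ℤ) = (c * n + b) % Q := fun n =>
    Int.toNat_of_nonneg (Int.emod_nonneg _ hQ'.ne')
  have hmaps : ∀ n ∈ range Q, ((c * n + b) % Q).toNat ∈ range Q := fun n _ => by
    rw [mem_range]
    have := Int.emod_lt_of_pos (c * n + b) hQ'
    have := key n
    omega
  have hinj : Set.InjOn (fun n : ℕ => ((c * n + b) % Q).toNat) (range Q : Set ℕ) := by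
    intro m hm n hn hmn
    simp only at hmn
    have h1 : (c * m + b) % Q = (c * n + b) % Q :=
      (key m).symm.trans ((congrArg Nat.cast hmn).trans (key n))
    have h2 : (Q : ℤ) ∣ c * (n - m) := by
      have := (Int.ModEq.dvd (n := Q) h1)
      convert this using 1
      ring
    have h3 := hc.symm.dvd_of_dvd_mul_left h2
    have h4 : (m : ℤ) ≡ n [ZMOD Q] := (Int.modEq_iff_dvd).2 h3
    have h5 : m ≡ n [MOD Q] := (Int.natCast_modEq_iff).1 h4
    simp only [coe_range, Set.mem_Iio] at hm hn
    exact Nat.ModEq.eq_of_lt_of_lt h5 hm hn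
  refine sum_nbij (fun n : ℕ => ((c * n + b) % Q).toNat) hmaps hinj
    (surjOn_of_injOn_of_card_le _ hmaps hinj le_rfl) fun n _ => ?_
  rw [key, periodic_emod hg]

lemma cyclicAvg_shift {Q : ℕ} (b : ℤ) {g : ℤ → ℝ} (hg : Function.Periodic g (Q : ℤ)) :
    cyclicAvg Q (fun x => g (x + b)) = cyclicAvg Q g := by
  simpa using cyclicAvg_affine (c := 1) isCoprime_one_left b hg

/-- The source of all independence below: residues modulo coprime m and n are jointly uniform, so
the two arguments of g, tied together on the left, become free on the right. -/
lemma cyclicAvg_crt {m n : ℕ} (co : m.Coprime n) (g : ℤ → ℤ → ℝ)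
    (h1 : ∀ y, Function.Periodic (fun x => g x y) (m : ℤ))
    (h2 : ∀ x, Function.Periodic (g x) (n : ℤ)) :
    cyclicAvg (m * n) (fun x => g x x) = cyclicAvg m fun x => cyclicAvg n (g x) := by
  rcases Nat.eq_zero_or_pos m with rfl | hm
  · simp [cyclicAvg]
  rcases Nat.eq_zero_or_pos n with rfl | hn
  · simp [cyclicAvg]
  have : ∑ x ∈ range (m * n), g x x = ∑ x ∈ range m, ∑ y ∈ range n, g x y := by
    rw [← sum_product']
    refine sum_nbij' (fun x : ℕ => (x % m, x % n))
      (fun p : ℕ × ℕ => (Nat.chineseRemainder co p.1 p.2 : ℕ)) ?_ ?_ ?_ ?_ ?_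
    · intro x _
      simp [Nat.mod_lt _ hm, Nat.mod_lt _ hn]
    · intro p _
      exact mem_range.2 (Nat.chineseRemainder_lt_mul co _ _ hm.ne' hn.ne')
    · intro x hx
      have e := (Nat.chineseRemainder co (x % m) (x % n)).2
      have e2 : (Nat.chineseRemainder co (x % m) (x % n) : ℕ) ≡ x [MOD m * n] :=
        (Nat.modEq_and_modEq_iff_modEq_mul co).1
          ⟨e.1.trans (Nat.mod_modEq _ _), e.2.trans (Nat.mod_modEq _ _)⟩
      exact Nat.ModEq.eq_of_lt_of_lt e2 (Nat.chineseRemainder_lt_mul co _ _ hm.ne' hn.ne')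
        (mem_range.1 hx)
    · rintro ⟨a, b⟩ hp
      simp only [mem_product, mem_range] at hp
      have e := (Nat.chineseRemainder co a b).2
      ext
      · exact Eq.trans (show _ % m = a % m from e.1) (Nat.mod_eq_of_lt hp.1)
      · exact Eq.trans (show _ % n = b % n from e.2) (Nat.mod_eq_of_lt hp.2)
    · intro x _
      have a1 := periodic_emod (h1 ((x : ℤ) % n)) x
      have a2 := periodic_emod (h2 x) x
      simp only at a1 ⊢
      push_cast
      rw [a1, a2]
  unfold cyclicAvg
  rw [this, sum_div, sum_div]
  refine sum_congr rfl fun x _ => ?_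
  push_cast
  rw [div_div, mul_comm]

lemma cyclicAvg_mul_period {Q R : ℕ} (hR : 0 < R) {g : ℤ → ℝ}
    (hg : Function.Periodic g (Q : ℤ)) : cyclicAvg (Q * R) g = cyclicAvg Q g := by
  have : ∑ n ∈ range (Q * R), g n = R * ∑ n ∈ range Q, g n := by
    clear hR
    induction R with
    | zero => simp
    | succ R ih =>
      rw [mul_add, mul_one, sum_range_add, ih]
      push_cast
      rw [add_mul, one_mul]
      congr 1
      refine sum_congr rfl fun n _ => ?_
      have := (hg.nat_mul R) n
      rw [← this]
      congr 1
      ring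
  have hR' : (R : ℝ) ≠ 0 := by positivity
  unfold cyclicAvg
  rw [this]
  push_cast
  rw [mul_comm (Q : ℝ), mul_div_mul_left _ _ hR']

lemma exists_progression {P : ℕ} (hP : 0 < P) (y : ℤ) (H : ℕ) :
    ∃ h₀ T : ℕ, |(T : ℝ) - (H : ℝ) / P| ≤ 1 ∧ ∀ g : ℕ → ℝ,
      ∑ t ∈ range H, (if (P : ℤ) ∣ y + t then g t else 0) = ∑ s ∈ range T, g (h₀ + P * s) := by
  have hP' : (0 : ℤ) < P := by exact_mod_cast hP
  obtain ⟨h₀, hh₀, hlt⟩ : ∃ h₀ : ℕ, (P : ℤ) ∣ y + h₀ ∧ h₀ < P := by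
    refine ⟨((-y) % P).toNat, ?_, ?_⟩
    · rw [Int.toNat_of_nonneg (Int.emod_nonneg _ hP'.ne')]
      have := Int.emod_add_mul_ediv (-y) P
      exact ⟨-(-y / P), by linarith⟩
    · have := Int.emod_lt_of_pos (-y) hP'
      have := Int.emod_nonneg (-y) hP'.ne'
      omega
  have hdvd : ∀ t : ℕ, (P : ℤ) ∣ y + t ↔ (P : ℤ) ∣ t - h₀ := fun t => by
    rw [show (y + t : ℤ) = (t - h₀) + (y + h₀) by ring]
    exact dvd_add_left hh₀
  -- The count is the ceiling of (H - h₀) / P. Adding P - 1 first keeps the truncated subtraction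
  -- exact, because h₀ ≤ P - 1.
  refine ⟨h₀, (H + (P - 1) - h₀) / P, ?_, fun g => ?_⟩
  · set T := (H + (P - 1) - h₀) / P with hT
    have e1 : T * P ≤ H + (P - 1) - h₀ := Nat.div_mul_le_self _ _
    have e2 : H + (P - 1) - h₀ < (T + 1) * P := by
      have := Nat.lt_mul_div_succ (H + (P - 1) - h₀) hP
      rw [← hT] at this
      linarith
    have e3 : T * P ≤ H + P := by omega
    have e4 : H ≤ (T + 1) * P := by omega
    have e3' : (T : ℝ) * P ≤ H + P := by exact_mod_cast e3
    have e4' : (H : ℝ) ≤ (T + 1) * P := by exact_mod_cast e4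
    have hPr : (0 : ℝ) < P := by positivity
    rw [abs_le]
    constructor
    · rw [neg_le_sub_iff_le_add, div_le_iff₀ hPr]
      exact e4'
    · rw [sub_le_iff_le_add, ← sub_le_iff_le_add', le_div_iff₀ hPr]
      linarith
  · rw [← sum_filter]
    refine (sum_nbij' (fun s => h₀ + P * s) (fun t => (t - h₀) / P) ?_ ?_ ?_ ?_ ?_).symm
    · intro s hs
      rw [mem_range] at hs
      rw [mem_filter, mem_range, hdvd]
      refine ⟨?_, ⟨s, by push_cast; ring⟩⟩
      have h1 : (s + 1) * P ≤ H + (P - 1) - h₀ := (Nat.le_div_iff_mul_le hP).1 hs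
      have h2 : (s + 1) * P = P * s + P := by ring
      omega
    · intro t ht
      rw [mem_filter, mem_range, hdvd] at ht
      obtain ⟨ht, s, hs⟩ := ht
      have hs0 : 0 ≤ s := by
        by_contra hneg
        have : (P : ℤ) * s ≤ P * (-1) := by
          apply mul_le_mul_of_nonneg_left _ hP'.le
          omega
        omega
      lift s to ℕ using hs0
      have hs' : t = h₀ + P * s := by
        have : (t : ℤ) = ((h₀ + P * s : ℕ) : ℤ) := by push_cast; linarith
        exact_mod_cast this
      subst hs'
      rw [mem_range, add_tsub_cancel_left, Nat.mul_div_cancel_left _ hP, ← Nat.succ_le_iff,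
        Nat.le_div_iff_mul_le hP]
      have h2 : s.succ * P = P * s + P := by rw [Nat.succ_eq_add_one]; ring
      omega
    · intro s _
      simp [Nat.mul_div_cancel_left _ hP]
    · intro t ht
      rw [mem_filter, mem_range, hdvd] at ht
      obtain ⟨ht, s, hs⟩ := ht
      have hs0 : 0 ≤ s := by
        by_contra hneg
        have : (P : ℤ) * s ≤ P * (-1) := by
          apply mul_le_mul_of_nonneg_left _ hP'.le
          omega
        omega
      lift s to ℕ using hs0
      have hs' : t = h₀ + P * s := by
        have : (t : ℤ) = ((h₀ + P * s : ℕ) : ℤ) := by push_cast; linarith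
        exact_mod_cast this
      subst hs'
      simp [Nat.mul_div_cancel_left _ hP]
    · intro s _
      rfl

/-! ### The sieve by k-th powers: density and periodicity. -/

lemma sieveInd_nonneg (k : ℕ) (S : Finset ℕ) (n : ℤ) : 0 ≤ sieveInd k S n :=
  prod_nonneg fun p _ => by split_ifs <;> norm_num

lemma sieveInd_le_one (k : ℕ) (S : Finset ℕ) (n : ℤ) : sieveInd k S n ≤ 1 :=
  prod_le_one (fun p _ => by split_ifs <;> norm_num) fun p _ => by split_ifs <;> norm_num

lemma sieveInd_insert (k : ℕ) {S : Finset ℕ} {p : ℕ} (hp : p ∉ S) (n : ℤ) :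
    sieveInd k (insert p S) n =
      sieveInd k S n - if (p : ℤ) ^ k ∣ n then sieveInd k S n else 0 := by
  rw [sieveInd, prod_insert hp, ← sieveInd]
  split_ifs <;> ring

lemma sieveDens_insert (k : ℕ) {S : Finset ℕ} {p : ℕ} (hp : p ∉ S) :
    sieveDens k (insert p S) = (1 - 1 / (p : ℝ) ^ k) * sieveDens k S := by
  rw [sieveDens, prod_insert hp, ← sieveDens]

lemma sieveMod_insert (k : ℕ) {S : Finset ℕ} {p : ℕ} (hp : p ∉ S) :
    sieveMod k (insert p S) = sieveMod k S * p ^ k := by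
  rw [sieveMod, prod_insert hp, ← sieveMod, mul_comm]

lemma sieveMod_pos (k : ℕ) {S : Finset ℕ} (hS : ∀ p ∈ S, p.Prime) : 0 < sieveMod k S :=
  prod_pos fun p hp => pow_pos (hS p hp).pos k

lemma one_sub_inv_pow_mem {p : ℕ} (hp : p.Prime) (k : ℕ) :
    0 ≤ 1 - 1 / (p : ℝ) ^ k ∧ 1 - 1 / (p : ℝ) ^ k ≤ 1 := by
  have h1 : (1 : ℝ) ≤ p := by exact_mod_cast hp.one_lt.le
  have h2 : (1 : ℝ) ≤ (p : ℝ) ^ k := one_le_pow₀ h1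
  have h3 : 1 / (p : ℝ) ^ k ≤ 1 := by
    rw [div_le_one (by positivity)]
    exact h2
  have : 0 ≤ 1 / (p : ℝ) ^ k := by positivity
  constructor <;> linarith

lemma sieveDens_nonneg (k : ℕ) {S : Finset ℕ} (hS : ∀ p ∈ S, p.Prime) : 0 ≤ sieveDens k S :=
  prod_nonneg fun p hp => (one_sub_inv_pow_mem (hS p hp) k).1

lemma sieveDens_le_one (k : ℕ) {S : Finset ℕ} (hS : ∀ p ∈ S, p.Prime) : sieveDens k S ≤ 1 :=
  prod_le_one (fun p hp => (one_sub_inv_pow_mem (hS p hp) k).1)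
    fun p hp => (one_sub_inv_pow_mem (hS p hp) k).2

lemma sieveInd_periodic (k : ℕ) (S : Finset ℕ) :
    Function.Periodic (sieveInd k S) (sieveMod k S : ℤ) := by
  intro n
  refine prod_congr rfl fun p hp => ?_
  have : (p : ℤ) ^ k ∣ (sieveMod k S : ℤ) := by
    have := dvd_prod_of_mem (fun p : ℕ => p ^ k) hp
    exact_mod_cast this
  simp only [dvd_add_left this]

lemma sieveInd_mul_left (k : ℕ) {S : Finset ℕ} {c : ℤ} (hc : ∀ p ∈ S, IsCoprime c (p : ℤ))
    (n : ℤ) : sieveInd k S (c * n) = sieveInd k S n := by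
  refine prod_congr rfl fun p hp => ?_
  have h : IsCoprime ((p : ℤ) ^ k) c := ((hc p hp).symm).pow_left
  have e : (p : ℤ) ^ k ∣ c * n ↔ (p : ℤ) ^ k ∣ n :=
    ⟨fun hd => h.dvd_of_dvd_mul_left hd, fun hd => hd.mul_left c⟩
  simp only [e]

lemma isCoprime_sieveMod (k : ℕ) {S : Finset ℕ} {c : ℤ} (hc : ∀ p ∈ S, IsCoprime c (p : ℤ)) :
    IsCoprime c (sieveMod k S : ℤ) := by
  rw [sieveMod, Nat.cast_prod]
  refine IsCoprime.prod_right fun p hp => ?_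
  push_cast
  exact (hc p hp).pow_right

lemma sieveErr_periodic (k : ℕ) (S : Finset ℕ) (H : ℕ) :
    Function.Periodic (sieveErr k S H) (sieveMod k S : ℤ) := by
  intro n
  unfold sieveErr
  congr 1
  refine sum_congr rfl fun t _ => ?_
  rw [show n + (sieveMod k S : ℤ) + t = (n + t) + sieveMod k S by ring, sieveInd_periodic]

/-- The values of `sieveInd` along a progression with a difference coprime to the sieving primes
are distributed as those along an interval. -/
lemma cyclicAvg_progression (k : ℕ) {S : Finset ℕ} {c : ℤ}
    (hc : ∀ p ∈ S, IsCoprime c (p : ℤ)) (b : ℤ) (G : (ℤ → ℝ) → ℝ) :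
    cyclicAvg (sieveMod k S) (fun x => G fun s => sieveInd k S (x + (b + c * s))) =
      cyclicAvg (sieveMod k S) fun x => G fun s => sieveInd k S (x + s) := by
  have hper : Function.Periodic (fun x => G fun s => sieveInd k S (x + c * s))
      (sieveMod k S : ℤ) := by
    intro x
    simp only
    congr 1
    ext s
    rw [add_right_comm, sieveInd_periodic]
  have h1 := cyclicAvg_shift b hper
  -- The substitution x ↦ c x preserves the average, and c (x + s) is sieved exactly as x + s is, c
  -- being a unit modulo each p.
  have h2 := cyclicAvg_affine (isCoprime_sieveMod k hc) 0 hper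
  simp only [add_assoc] at h1
  rw [h1, ← h2]
  congr 1
  ext x
  congr 1
  ext s
  rw [add_zero, ← mul_add, sieveInd_mul_left k hc]

/-! ### The effect of one more prime, with separate variables for the sieve and for the residue
class. -/

/-- The sum of `sieveInd` over the terms of an interval in a residue class. -/
noncomputable def classSum (k : ℕ) (S : Finset ℕ) (H P : ℕ) (x y : ℤ) : ℝ :=
  ∑ t ∈ range H, if (P : ℤ) ∣ y + t then sieveInd k S (x + t) else 0

lemma classSum_nonneg (k : ℕ) (S : Finset ℕ) (H P : ℕ) (x y : ℤ) :
    0 ≤ classSum k S H P x y :=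
  sum_nonneg fun t _ => by
    split_ifs
    exacts [sieveInd_nonneg _ _ _, le_rfl]

lemma classSum_periodic_left (k : ℕ) (S : Finset ℕ) (H P : ℕ) (y : ℤ) :
    Function.Periodic (fun x => classSum k S H P x y) (sieveMod k S : ℤ) := by
  intro x
  refine sum_congr rfl fun t _ => ?_
  rw [add_right_comm, sieveInd_periodic]

lemma classSum_periodic_right (k : ℕ) (S : Finset ℕ) (H P : ℕ) (x : ℤ) :
    Function.Periodic (classSum k S H P x) (P : ℤ) := by
  intro y
  refine sum_congr rfl fun t _ => ?_
  have e : (P : ℤ) ∣ y + P + t ↔ (P : ℤ) ∣ y + t := by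
    rw [add_right_comm, dvd_add_left (dvd_refl _)]
  simp only [e]

lemma cyclicAvg_dvd {P : ℕ} (hP : 0 < P) (t : ℤ) (a : ℝ) :
    cyclicAvg P (fun y => if (P : ℤ) ∣ y + t then a else 0) = a / P := by
  have hper : Function.Periodic (fun y : ℤ => if (P : ℤ) ∣ y then a else 0) (P : ℤ) := by
    intro y
    simp only [dvd_add_left (dvd_refl (P : ℤ))]
  rw [cyclicAvg_shift t hper, cyclicAvg]
  congr 1
  rw [sum_eq_single_of_mem 0 (mem_range.2 hP)]
  · simp
  · intro n hn h0
    rw [if_neg]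
    intro h
    exact h0 (Nat.eq_zero_of_dvd_of_lt (Int.natCast_dvd_natCast.1 h) (mem_range.1 hn))

lemma cyclicAvg_classSum (k : ℕ) (S : Finset ℕ) (H : ℕ) {P : ℕ} (hP : 0 < P) (x : ℤ) :
    cyclicAvg P (classSum k S H P x) = (∑ t ∈ range H, sieveInd k S (x + t)) / P := by
  unfold classSum
  rw [cyclicAvg_sum, sum_div]
  exact sum_congr rfl fun t _ => cyclicAvg_dvd hP t _

/-- The new prime removes the surviving terms divisible by p ^ k. This form, centred at the density,
suits the crude bound `sieveMoment_insert_le`. -/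
lemma sieveErr_insert (k : ℕ) {S : Finset ℕ} {p : ℕ} (hp : p ∉ S) (H : ℕ) (x : ℤ) :
    sieveErr k (insert p S) H x = sieveErr k S H x -
      (classSum k S H (p ^ k) x x - sieveDens k S * (H / (p ^ k : ℕ))) := by
  simp only [sieveErr, classSum, sieveInd_insert k hp, sieveDens_insert k hp, sum_sub_distrib]
  push_cast
  ring

lemma sieveMoment_nonneg (k : ℕ) (S : Finset ℕ) {L : ℕ} (hL : Even L) (H : ℕ) :
    0 ≤ sieveMoment k S L H :=
  cyclicAvg_nonneg _ fun _ => hL.pow_nonneg _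

lemma even_add_pow_le {L : ℕ} (hL : Even L) (a b : ℝ) :
    (a + b) ^ L ≤ 2 ^ L * (a ^ L + b ^ L) := by
  refine hL.add_pow_le.trans ?_
  have := hL.pow_nonneg a
  have := hL.pow_nonneg b
  gcongr
  · norm_num
  · omega

lemma even_sub_pow_le {L : ℕ} (hL : Even L) (a b : ℝ) :
    (a - b) ^ L ≤ 2 ^ L * (a ^ L + b ^ L) := by
  have := even_add_pow_le hL a (-b)
  rwa [hL.neg_pow, ← sub_eq_add_neg] at this

/-- The moments of the sums over a residue class are controlled by those over the intervals of
the corresponding length. -/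
lemma classSum_moment_le (k : ℕ) {S : Finset ℕ} (hS : ∀ p ∈ S, p.Prime) {P : ℕ} (hP : 0 < P)
    (hc : ∀ p ∈ S, IsCoprime (P : ℤ) (p : ℤ)) {L : ℕ} (hL : Even L) (H : ℕ) (y : ℤ) {B : ℝ}
    (hB : ∀ T : ℕ, |(T : ℝ) - (H : ℝ) / P| ≤ 1 → sieveMoment k S L T ≤ B) :
    cyclicAvg (sieveMod k S)
      (fun x => (classSum k S H P x y - sieveDens k S * (H / P)) ^ L) ≤ 2 ^ L * (B + 1) := by
  obtain ⟨h₀, T, hT, hsum⟩ := exists_progression hP y H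
  have h1 : ∀ x, classSum k S H P x y = ∑ s ∈ range T, sieveInd k S (x + (h₀ + P * (s : ℤ))) := by
    intro x
    rw [classSum, hsum fun t => sieveInd k S (x + t)]
    push_cast
    rfl
  have h2 : cyclicAvg (sieveMod k S)
      (fun x => (classSum k S H P x y - sieveDens k S * T) ^ L) = sieveMoment k S L T := by
    simp only [h1]
    exact cyclicAvg_progression k hc h₀
      fun g => (∑ s ∈ range T, g (s : ℤ) - sieveDens k S * T) ^ L
  -- Centring at T instead of H / P moves the value by at most 1, which is the extra 1 next to B.
  have h3 : (sieveDens k S * (T - H / P)) ^ L ≤ 1 := by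
    rw [← hL.pow_abs]
    apply pow_le_one₀ (abs_nonneg _)
    rw [abs_mul, abs_of_nonneg (sieveDens_nonneg k hS)]
    exact mul_le_one₀ (sieveDens_le_one k hS) (abs_nonneg _) hT
  calc _ ≤ cyclicAvg (sieveMod k S) (fun x =>
        2 ^ L * ((classSum k S H P x y - sieveDens k S * T) ^ L + 1)) := by
        refine cyclicAvg_mono _ fun x => ?_
        rw [show classSum k S H P x y - sieveDens k S * (H / P) =
          (classSum k S H P x y - sieveDens k S * T) + sieveDens k S * (T - H / P) by ring]
        refine (even_add_pow_le hL _ _).trans ?_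
        gcongr
    _ = 2 ^ L * (sieveMoment k S L T + 1) := by
        rw [cyclicAvg_const_mul, cyclicAvg_add, h2, cyclicAvg_const (sieveMod_pos k hS)]
    _ ≤ _ := by
        gcongr
        exact hB T hT

lemma isCoprime_pow_of_notMem {S : Finset ℕ} (hS : ∀ p ∈ S, p.Prime) {p : ℕ} (hp : p.Prime)
    (hpS : p ∉ S) (k : ℕ) : ∀ r ∈ S, IsCoprime ((p ^ k : ℕ) : ℤ) (r : ℤ) := by
  intro r hr
  rw [Nat.isCoprime_iff_coprime]
  refine Nat.Coprime.pow_left _ ((Nat.coprime_primes hp (hS r hr)).2 ?_)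
  rintro rfl
  exact hpS hr

lemma sieveMod_coprime {S : Finset ℕ} (hS : ∀ p ∈ S, p.Prime) {p : ℕ} (hp : p.Prime)
    (hpS : p ∉ S) (k : ℕ) : (sieveMod k S).Coprime (p ^ k) := by
  have := isCoprime_sieveMod k (isCoprime_pow_of_notMem hS hp hpS k)
  exact (Nat.isCoprime_iff_coprime.1 this).symm

lemma cyclicAvg_comm (m n : ℕ) (g : ℤ → ℤ → ℝ) :
    cyclicAvg m (fun x => cyclicAvg n fun y => g x y) =
      cyclicAvg n fun y => cyclicAvg m fun x => g x y := by
  simp only [cyclicAvg, ← sum_div]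
  rw [sum_comm, div_right_comm]

/-- Averaging over a period of the sieve by `insert p S` splits as a double average. -/
lemma cyclicAvg_insert (k : ℕ) {S : Finset ℕ} (hS : ∀ p ∈ S, p.Prime) {p : ℕ} (hp : p.Prime)
    (hpS : p ∉ S) (g : ℤ → ℤ → ℝ)
    (h1 : ∀ y, Function.Periodic (fun x => g x y) (sieveMod k S : ℤ))
    (h2 : ∀ x, Function.Periodic (g x) ((p ^ k : ℕ) : ℤ)) :
    cyclicAvg (sieveMod k (insert p S)) (fun x => g x x) =
      cyclicAvg (sieveMod k S) fun x => cyclicAvg (p ^ k) (g x) := by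
  rw [sieveMod_insert k hpS]
  exact cyclicAvg_crt (sieveMod_coprime hS hp hpS k) g h1 h2

/-- A crude step that loses the factor 2 ^ L on the old moment. It can be afforded only a bounded
number of times, for the exceptional primes in `exists_sieveMoment_le`. -/
lemma sieveMoment_insert_le (k : ℕ) {S : Finset ℕ} (hS : ∀ p ∈ S, p.Prime) {p : ℕ}
    (hp : p.Prime) (hpS : p ∉ S) {L : ℕ} (hL : Even L) (H : ℕ) {B : ℝ}
    (hB : ∀ T : ℕ, |(T : ℝ) - (H : ℝ) / (p ^ k : ℕ)| ≤ 1 → sieveMoment k S L T ≤ B) :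
    sieveMoment k (insert p S) L H ≤ 2 ^ L * (sieveMoment k S L H + 2 ^ L * (B + 1)) := by
  have hP : 0 < p ^ k := pow_pos hp.pos k
  set c₀ := sieveDens k S * (H / (p ^ k : ℕ)) with hc₀
  have e : sieveMoment k (insert p S) L H = cyclicAvg (sieveMod k S) fun x =>
      cyclicAvg (p ^ k) fun y =>
        (sieveErr k S H x - (classSum k S H (p ^ k) x y - c₀)) ^ L := by
    rw [← cyclicAvg_insert k hS hp hpS]
    · simp only [sieveMoment, sieveErr_insert k hpS, hc₀]
    · intro y x
      simp only [sieveErr_periodic k S H x, classSum_periodic_left k S H (p ^ k) y x]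
    · intro x y
      simp only [classSum_periodic_right k S H (p ^ k) x y]
  rw [e]
  calc _ ≤ cyclicAvg (sieveMod k S) (fun x => cyclicAvg (p ^ k) fun y =>
        2 ^ L * (sieveErr k S H x ^ L + (classSum k S H (p ^ k) x y - c₀) ^ L)) :=
        cyclicAvg_mono _ fun x => cyclicAvg_mono _ fun y => even_sub_pow_le hL _ _
    _ = 2 ^ L * (sieveMoment k S L H + cyclicAvg (p ^ k) fun y => cyclicAvg (sieveMod k S)
          fun x => (classSum k S H (p ^ k) x y - c₀) ^ L) := by
        simp only [cyclicAvg_const_mul, cyclicAvg_add, cyclicAvg_const hP]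
        rw [cyclicAvg_comm, sieveMoment]
    _ ≤ _ := by
        gcongr
        refine (cyclicAvg_mono _ fun y => classSum_moment_le k hS hP
          (isCoprime_pow_of_notMem hS hp hpS k) hL H y hB).trans_eq ?_
        exact cyclicAvg_const hP _

/-- The linear term is kept exactly because it will average to zero. Every later binomial term is
dominated by one of the two extreme ones, according to which of |s| and |d| is larger. -/
lemma add_pow_le_taylor {r : ℕ} (hr : 1 ≤ r) (s d : ℝ) :
    (s + d) ^ (2 * r) ≤ s ^ (2 * r) + 2 * r * s ^ (2 * r - 1) * d +
      2 ^ (2 * r) * (s ^ (2 * (r - 1)) * d ^ 2 + d ^ (2 * r)) := by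
  obtain ⟨i, rfl⟩ : ∃ i, r = i + 1 := ⟨r - 1, by omega⟩
  set B := s ^ (2 * i) * d ^ 2 + d ^ (2 * (i + 1)) with hB
  have hs0 : 0 ≤ s ^ (2 * i) := (even_two_mul i).pow_nonneg s
  have hd0 : 0 ≤ d ^ (2 * (i + 1)) := (even_two_mul _).pow_nonneg d
  have hB0 : 0 ≤ B := by positivity
  have hterm : ∀ m ∈ range (2 * i + 1), s ^ m * d ^ (2 * i + 2 - m) ≤ B := by
    intro m hm
    rw [mem_range] at hm
    refine (le_abs_self _).trans ?_
    rw [abs_mul, abs_pow, abs_pow]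
    rcases le_total |s| |d| with h | h
    · calc |s| ^ m * |d| ^ (2 * i + 2 - m) ≤ |d| ^ m * |d| ^ (2 * i + 2 - m) := by gcongr
        _ = d ^ (2 * (i + 1)) := by
          rw [← pow_add, ← (even_two_mul (i + 1)).pow_abs]
          congr 1
          omega
        _ ≤ B := le_add_of_nonneg_left (by positivity)
    · calc |s| ^ m * |d| ^ (2 * i + 2 - m) = |s| ^ m * |d| ^ (2 * i - m) * |d| ^ 2 := by
            rw [mul_assoc, ← pow_add]
            congr 2
            omega
        _ ≤ |s| ^ m * |s| ^ (2 * i - m) * |d| ^ 2 := by gcongr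
        _ = s ^ (2 * i) * d ^ 2 := by
          rw [← pow_add, ← (even_two_mul i).pow_abs, sq_abs]
          congr 3
          omega
        _ ≤ B := le_add_of_nonneg_right hd0
  have hsum : ∑ m ∈ range (2 * i + 1), s ^ m * d ^ (2 * i + 2 - m) * ((2 * i + 2).choose m : ℝ) ≤
      2 ^ (2 * i + 2) * B := by
    calc _ ≤ ∑ m ∈ range (2 * i + 1), B * ((2 * i + 2).choose m : ℝ) := by
          refine sum_le_sum fun m hm => ?_
          gcongr
          exact hterm m hm
      _ = B * ∑ m ∈ range (2 * i + 1), ((2 * i + 2).choose m : ℝ) := by rw [mul_sum]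
      _ ≤ B * ∑ m ∈ range (2 * i + 2 + 1), ((2 * i + 2).choose m : ℝ) := by
          gcongr
          omega
      _ = _ := by
          have := Nat.sum_range_choose (2 * i + 2)
          rw [mul_comm]
          congr 1
          exact_mod_cast this
  have e1 : 2 * (i + 1) = 2 * i + 2 := by ring
  have e2 : 2 * (i + 1) - 1 = 2 * i + 1 := by omega
  rw [e2, e1, add_pow, sum_range_succ, sum_range_succ]
  simp only [Nat.choose_self, Nat.cast_one, mul_one, add_tsub_cancel_right, Nat.sub_self, pow_zero]
  have e3 : 2 * i + 2 - (2 * i + 1) = 1 := by omega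
  have e4 : (2 * i + 2).choose (2 * i + 1) = 2 * i + 2 := Nat.choose_succ_self_right _
  rw [e3, pow_one, e4]
  rw [hB, e1] at hsum
  push_cast
  linarith

/-- Either d ^ 2 ≤ δ s ^ 2 or s ^ 2 ≤ δ⁻¹ d ^ 2, and one summand on the right suffices in each case.
The free δ decides how much of the old moment is spent. -/
lemma young_pow {r : ℕ} (hr : 1 ≤ r) (s d : ℝ) {δ : ℝ} (hδ : 0 < δ) :
    s ^ (2 * (r - 1)) * d ^ 2 ≤ δ * s ^ (2 * r) + δ⁻¹ ^ (r - 1) * d ^ (2 * r) := by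
  obtain ⟨i, rfl⟩ : ∃ i, r = i + 1 := ⟨r - 1, by omega⟩
  simp only [add_tsub_cancel_right, pow_mul]
  rcases le_total (d ^ 2) (δ * s ^ 2) with h | h
  · calc (s ^ 2) ^ i * d ^ 2 ≤ (s ^ 2) ^ i * (δ * s ^ 2) := by gcongr
      _ = δ * (s ^ 2) ^ (i + 1) := by ring
      _ ≤ _ := le_add_of_nonneg_right (by positivity)
  · have h' : s ^ 2 ≤ δ⁻¹ * d ^ 2 := by
      rw [inv_mul_eq_div, le_div_iff₀ hδ]
      linarith
    calc (s ^ 2) ^ i * d ^ 2 ≤ (δ⁻¹ * d ^ 2) ^ i * d ^ 2 := by gcongr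
      _ = δ⁻¹ ^ i * (d ^ 2) ^ (i + 1) := by rw [mul_pow]; ring
      _ ≤ _ := le_add_of_nonneg_left (by positivity)

/-- The deviation of `classSum` from its mean over the residue classes. -/
noncomputable def classDev (k : ℕ) (S : Finset ℕ) (H P : ℕ) (x y : ℤ) : ℝ :=
  (∑ t ∈ range H, sieveInd k S (x + t)) / P - classSum k S H P x y

/-- Centring the class sum at its mean over the classes, rather than at the density, leaves a
coefficient in [0, 1] on the old error and a fluctuation of mean zero for each fixed x. -/
lemma sieveErr_insert_eq_classDev (k : ℕ) {S : Finset ℕ} {p : ℕ} (hp : p ∉ S) (H : ℕ) (x : ℤ) :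
    sieveErr k (insert p S) H x =
      (1 - 1 / ((p ^ k : ℕ) : ℝ)) * sieveErr k S H x + classDev k S H (p ^ k) x x := by
  rw [sieveErr_insert k hp, classDev, sieveErr]
  ring

lemma cyclicAvg_classDev (k : ℕ) (S : Finset ℕ) (H : ℕ) {P : ℕ} (hP : 0 < P) (x : ℤ) :
    cyclicAvg P (classDev k S H P x) = 0 := by
  unfold classDev
  rw [cyclicAvg_sub, cyclicAvg_const hP, cyclicAvg_classSum k S H hP, sub_self]

/-- By the Chinese remainder theorem x and y are averaged independently, and `classDev` has mean
zero over y. The linear Taylor term disappears, so the old moment keeps the coefficient 1. -/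
lemma sieveMoment_insert_le_taylor (k : ℕ) {S : Finset ℕ} (hS : ∀ p ∈ S, p.Prime) {p : ℕ}
    (hp : p.Prime) (hpS : p ∉ S) {r : ℕ} (hr : 1 ≤ r) (H : ℕ) :
    sieveMoment k (insert p S) (2 * r) H ≤ sieveMoment k S (2 * r) H +
      2 ^ (2 * r) * cyclicAvg (sieveMod k S) (fun x => cyclicAvg (p ^ k) fun y =>
        sieveErr k S H x ^ (2 * (r - 1)) * classDev k S H (p ^ k) x y ^ 2 +
          classDev k S H (p ^ k) x y ^ (2 * r)) := by
  have hP : 0 < p ^ k := pow_pos hp.pos k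
  set c : ℝ := 1 - 1 / ((p ^ k : ℕ) : ℝ) with hc
  have hc01 : 0 ≤ c ∧ c ≤ 1 := by
    have := one_sub_inv_pow_mem hp k
    rw [hc]
    push_cast
    exact this
  have e : sieveMoment k (insert p S) (2 * r) H = cyclicAvg (sieveMod k S) fun x =>
      cyclicAvg (p ^ k) fun y =>
        (c * sieveErr k S H x + classDev k S H (p ^ k) x y) ^ (2 * r) := by
    rw [← cyclicAvg_insert k hS hp hpS]
    · simp only [sieveMoment, sieveErr_insert_eq_classDev k hpS, hc]
    · intro y x
      have h1 : ∑ t ∈ range H, sieveInd k S (x + sieveMod k S + t) =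
          ∑ t ∈ range H, sieveInd k S (x + t) :=
        sum_congr rfl fun t _ => by rw [add_right_comm, sieveInd_periodic]
      simp only [sieveErr_periodic k S H x, classDev, h1,
        classSum_periodic_left k S H (p ^ k) y x]
    · intro x y
      simp only [classDev, classSum_periodic_right k S H (p ^ k) x y]
  rw [e]
  have hpow : ∀ (s : ℝ) (i : ℕ), (c * s) ^ (2 * i) ≤ s ^ (2 * i) := fun s i => by
    rw [mul_pow]
    exact mul_le_of_le_one_left ((even_two_mul i).pow_nonneg s) (pow_le_one₀ hc01.1 hc01.2)
  calc _ ≤ cyclicAvg (sieveMod k S) (fun x => cyclicAvg (p ^ k) fun y =>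
        sieveErr k S H x ^ (2 * r) +
          2 * r * (c * sieveErr k S H x) ^ (2 * r - 1) * classDev k S H (p ^ k) x y +
          2 ^ (2 * r) * (sieveErr k S H x ^ (2 * (r - 1)) * classDev k S H (p ^ k) x y ^ 2 +
            classDev k S H (p ^ k) x y ^ (2 * r))) := by
        refine cyclicAvg_mono _ fun x => cyclicAvg_mono _ fun y => ?_
        refine (add_pow_le_taylor hr _ _).trans ?_
        exact add_le_add (add_le_add (hpow _ _) le_rfl) (mul_le_mul_of_nonneg_left (add_le_add
          (mul_le_mul_of_nonneg_right (hpow _ _) (sq_nonneg _)) le_rfl) (by positivity))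
    _ = _ := by
        simp only [cyclicAvg_add _ (fun y => _ + _ * _), cyclicAvg_add _ (fun _ => _ ^ (2 * r)),
          cyclicAvg_const_mul, cyclicAvg_classDev k S H hP, cyclicAvg_const hP, mul_zero, add_zero]
        rfl

/-- The effect on the moments of sieving by one more prime. -/
lemma sieveMoment_insert_le_of_dev (k : ℕ) {S : Finset ℕ} (hS : ∀ p ∈ S, p.Prime) {p : ℕ}
    (hp : p.Prime) (hpS : p ∉ S) {r : ℕ} (hr : 1 ≤ r) (H : ℕ) {B δ : ℝ} (hδ : 0 < δ)
    (hB : ∀ T : ℕ, |(T : ℝ) - (H : ℝ) / (p ^ k : ℕ)| ≤ 1 → sieveMoment k S (2 * r) T ≤ B) :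
    sieveMoment k (insert p S) (2 * r) H ≤ (1 + 2 ^ (2 * r) * δ) * sieveMoment k S (2 * r) H +
      2 ^ (2 * r) * ((1 + δ⁻¹ ^ (r - 1)) * (2 ^ (4 * r + 1) * (B + 1))) := by
  have hP : 0 < p ^ k := pow_pos hp.pos k
  have hL : Even (2 * r) := even_two_mul r
  set c₀ := sieveDens k S * (H / (p ^ k : ℕ)) with hc₀
  set W := fun x y => classSum k S H (p ^ k) x y - c₀ with hW
  have hD : cyclicAvg (sieveMod k S) (fun x => cyclicAvg (p ^ k) fun y =>
      classDev k S H (p ^ k) x y ^ (2 * r)) ≤ 2 ^ (4 * r + 1) * (B + 1) := by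
    -- The constant c₀ cancels in this difference, so the fluctuation may be bounded, through the
    -- power mean inequality, by moments of the class sum centred at c₀.
    have hDW : ∀ x y, classDev k S H (p ^ k) x y = cyclicAvg (p ^ k) (W x) - W x y := by
      intro x y
      simp only [hW]
      rw [cyclicAvg_sub, cyclicAvg_const hP, cyclicAvg_classSum k S H hP, classDev]
      ring
    calc _ ≤ cyclicAvg (sieveMod k S) (fun x => cyclicAvg (p ^ k) fun y =>
          2 ^ (2 * r) * (cyclicAvg (p ^ k) (fun z => W x z ^ (2 * r)) + W x y ^ (2 * r))) := by
          refine cyclicAvg_mono _ fun x => cyclicAvg_mono _ fun y => ?_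
          rw [hDW]
          refine (even_sub_pow_le hL _ _).trans ?_
          gcongr
          exact cyclicAvg_pow_le hP hL _
      _ = 2 ^ (2 * r) * (2 * cyclicAvg (p ^ k) fun y => cyclicAvg (sieveMod k S)
            fun x => W x y ^ (2 * r)) := by
          simp only [cyclicAvg_const_mul, cyclicAvg_add, cyclicAvg_const hP]
          rw [cyclicAvg_comm]
          ring
      _ ≤ 2 ^ (2 * r) * (2 * (2 ^ (2 * r) * (B + 1))) := by
          gcongr
          refine (cyclicAvg_mono _ fun y => classSum_moment_le k hS hP
            (isCoprime_pow_of_notMem hS hp hpS k) hL H y hB).trans_eq ?_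
          exact cyclicAvg_const hP _
      _ = _ := by ring
  refine (sieveMoment_insert_le_taylor k hS hp hpS hr H).trans ?_
  have h2 : cyclicAvg (sieveMod k S) (fun x => cyclicAvg (p ^ k) fun y =>
        sieveErr k S H x ^ (2 * (r - 1)) * classDev k S H (p ^ k) x y ^ 2 +
          classDev k S H (p ^ k) x y ^ (2 * r)) ≤
      δ * sieveMoment k S (2 * r) H + (1 + δ⁻¹ ^ (r - 1)) * (2 ^ (4 * r + 1) * (B + 1)) := by
    calc _ ≤ cyclicAvg (sieveMod k S) (fun x => cyclicAvg (p ^ k) fun y =>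
          δ * sieveErr k S H x ^ (2 * r) +
            (1 + δ⁻¹ ^ (r - 1)) * classDev k S H (p ^ k) x y ^ (2 * r)) := by
          refine cyclicAvg_mono _ fun x => cyclicAvg_mono _ fun y => ?_
          have := young_pow hr (sieveErr k S H x) (classDev k S H (p ^ k) x y) hδ
          linarith
      _ = δ * sieveMoment k S (2 * r) H + (1 + δ⁻¹ ^ (r - 1)) * cyclicAvg (sieveMod k S)
            (fun x => cyclicAvg (p ^ k) fun y => classDev k S H (p ^ k) x y ^ (2 * r)) := by
          simp only [cyclicAvg_const_mul, cyclicAvg_add, cyclicAvg_const hP]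
          rw [sieveMoment]
      _ ≤ _ := by gcongr
  calc _ ≤ sieveMoment k S (2 * r) H + 2 ^ (2 * r) * (δ * sieveMoment k S (2 * r) H +
        (1 + δ⁻¹ ^ (r - 1)) * (2 ^ (4 * r + 1) * (B + 1))) := by gcongr
    _ = _ := by ring

/-- The effect on the moments of sieving by one more prime, whose `k`-th power exceeds the
length of the interval. -/
lemma sieveMoment_insert_le_of_lt (k : ℕ) {S : Finset ℕ} (hS : ∀ p ∈ S, p.Prime) {p : ℕ}
    (hp : p.Prime) (hpS : p ∉ S) {r : ℕ} (hr : 1 ≤ r) {H : ℕ} (hH : H < p ^ k) {δ : ℝ}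
    (hδ : 0 < δ) :
    sieveMoment k (insert p S) (2 * r) H ≤
      (1 + 2 ^ (2 * r) * (2 * (H / (p ^ k : ℕ))) * δ) * sieveMoment k S (2 * r) H +
      2 ^ (2 * r) * (2 * (H / (p ^ k : ℕ))) * (1 + δ⁻¹ ^ (r - 1)) := by
  have hP : 0 < p ^ k := pow_pos hp.pos k
  have hPr : (0 : ℝ) < (p ^ k : ℕ) := by exact_mod_cast hP
  have hHP : (H : ℝ) / (p ^ k : ℕ) < 1 := by
    rw [div_lt_one hPr]
    exact_mod_cast hH
  have ha : ∀ x : ℤ, 0 ≤ (∑ t ∈ range H, sieveInd k S (x + t)) / (p ^ k : ℕ) ∧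
      (∑ t ∈ range H, sieveInd k S (x + t)) / (p ^ k : ℕ) ≤ H / (p ^ k : ℕ) := fun x => by
    constructor
    · exact div_nonneg (sum_nonneg fun _ _ => sieveInd_nonneg _ _ _) hPr.le
    · gcongr
      calc _ ≤ ∑ t ∈ range H, (1 : ℝ) := sum_le_sum fun _ _ => sieveInd_le_one _ _ _
        _ = H := by simp
  -- An interval shorter than p ^ k meets a class modulo p ^ k at most once.
  have hW : ∀ x y, classSum k S H (p ^ k) x y ≤ 1 := fun x y => by
    obtain ⟨h₀, T, hT, hsum⟩ := exists_progression hP y H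
    rw [classSum, hsum fun t => sieveInd k S (x + t)]
    have hT1 : T ≤ 1 := by
      have h2 : (T : ℝ) < 2 := by linarith [(abs_le.1 hT).2]
      have h3 : T < 2 := by exact_mod_cast h2
      omega
    calc _ ≤ ∑ s ∈ range T, (1 : ℝ) := sum_le_sum fun _ _ => sieveInd_le_one _ _ _
      _ ≤ 1 := by simpa using hT1
  -- The fluctuation is a - w with a and w in [0, 1], so its square is at most a + w, and both have
  -- mean at most H / p ^ k.
  have hD2 : ∀ x, cyclicAvg (p ^ k) (fun y => classDev k S H (p ^ k) x y ^ 2) ≤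
      2 * (H / (p ^ k : ℕ)) := fun x => by
    calc _ ≤ cyclicAvg (p ^ k) (fun y => (∑ t ∈ range H, sieveInd k S (x + t)) / (p ^ k : ℕ) +
          classSum k S H (p ^ k) x y) := by
          refine cyclicAvg_mono _ fun y => ?_
          have h1 := ha x
          have h2 := hW x y
          have h3 := classSum_nonneg k S H (p ^ k) x y
          rw [classDev]
          nlinarith
      _ = 2 * ((∑ t ∈ range H, sieveInd k S (x + t)) / (p ^ k : ℕ)) := by
          rw [cyclicAvg_add, cyclicAvg_const hP, cyclicAvg_classSum k S H hP]
          ring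
      _ ≤ _ := mul_le_mul_of_nonneg_left (ha x).2 zero_le_two
  refine (sieveMoment_insert_le_taylor k hS hp hpS hr H).trans ?_
  have h2 : cyclicAvg (sieveMod k S) (fun x => cyclicAvg (p ^ k) fun y =>
        sieveErr k S H x ^ (2 * (r - 1)) * classDev k S H (p ^ k) x y ^ 2 +
          classDev k S H (p ^ k) x y ^ (2 * r)) ≤
      2 * (H / (p ^ k : ℕ)) * (δ * sieveMoment k S (2 * r) H + (1 + δ⁻¹ ^ (r - 1))) := by
    calc _ ≤ cyclicAvg (sieveMod k S) (fun x => cyclicAvg (p ^ k) fun y =>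
          (δ * sieveErr k S H x ^ (2 * r) + (1 + δ⁻¹ ^ (r - 1))) *
            classDev k S H (p ^ k) x y ^ 2) := by
          refine cyclicAvg_mono _ fun x => cyclicAvg_mono _ fun y => ?_
          have e1 := young_pow hr (sieveErr k S H x) 1 hδ
          simp only [one_pow, mul_one] at e1
          -- As the fluctuation is at most 1 in absolute value, its higher moments are no larger
          -- than the second.
          have e2 : classDev k S H (p ^ k) x y ^ (2 * r) ≤ classDev k S H (p ^ k) x y ^ 2 := by
            rw [pow_mul]
            apply pow_le_of_le_one (sq_nonneg _) _ (by omega)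
            have h1 := ha x
            have h2 := hW x y
            have h3 := classSum_nonneg k S H (p ^ k) x y
            rw [sq_le_one_iff_abs_le_one, abs_le, classDev]
            constructor <;> linarith
          nlinarith [sq_nonneg (classDev k S H (p ^ k) x y)]
      _ ≤ cyclicAvg (sieveMod k S) (fun x =>
          (δ * sieveErr k S H x ^ (2 * r) + (1 + δ⁻¹ ^ (r - 1))) * (2 * (H / (p ^ k : ℕ)))) := by
          refine cyclicAvg_mono _ fun x => ?_
          rw [cyclicAvg_const_mul]
          have := (even_two_mul r).pow_nonneg (sieveErr k S H x)
          gcongr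
          exact hD2 x
      _ = _ := by
          simp only [mul_comm _ (2 * ((H : ℝ) / (p ^ k : ℕ)))]
          rw [cyclicAvg_const_mul, cyclicAvg_add, cyclicAvg_const_mul,
            cyclicAvg_const (sieveMod_pos k hS), sieveMoment]
  calc _ ≤ sieveMoment k S (2 * r) H + 2 ^ (2 * r) * (2 * (H / (p ^ k : ℕ)) *
        (δ * sieveMoment k S (2 * r) H + (1 + δ⁻¹ ^ (r - 1)))) := by gcongr
    _ = _ := by ring

/-! ### Iteration over the primes: the moment bound for the sieve. -/

lemma sieveMoment_empty (k : ℕ) {L : ℕ} (hL : L ≠ 0) (H : ℕ) : sieveMoment k ∅ L H = 0 := by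
  simp [sieveMoment, sieveErr, sieveInd, sieveDens, cyclicAvg, hL]

lemma sieveMoment_zero (k : ℕ) (S : Finset ℕ) {L : ℕ} (hL : L ≠ 0) : sieveMoment k S L 0 = 0 := by
  simp [sieveMoment, sieveErr, cyclicAvg, hL]

/-- A discrete Grönwall inequality, starting from the empty sieve, whose discrepancy is zero. -/
lemma sieveMoment_le_exp_sum (k : ℕ) {L : ℕ} (hL : L ≠ 0) (H : ℕ) (A : Set ℕ)
    {u v : ℕ → ℝ} (hu : ∀ p, 0 ≤ u p) (hv : ∀ p, 0 ≤ v p)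
    (h : ∀ (S : Finset ℕ) (p : ℕ), ↑S ⊆ A → p ∈ A → p ∉ S →
      sieveMoment k (insert p S) L H ≤ (1 + u p) * sieveMoment k S L H + v p)
    (S : Finset ℕ) (hS : ↑S ⊆ A) :
    sieveMoment k S L H ≤ Real.exp (∑ p ∈ S, u p) * ∑ p ∈ S, v p := by
  induction S using Finset.induction_on with
  | empty => simp [sieveMoment_empty k hL]
  | insert p S hp ih =>
    rw [coe_insert, Set.insert_subset_iff] at hS
    refine (h S p hS.2 hS.1 hp).trans ?_
    rw [sum_insert hp, sum_insert hp, Real.exp_add]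
    have h1 : 1 + u p ≤ Real.exp (u p) := by linarith [Real.add_one_le_exp (u p)]
    have h2 : 1 ≤ Real.exp (u p) := Real.one_le_exp (hu p)
    have h3 : 1 ≤ Real.exp (∑ p ∈ S, u p) := Real.one_le_exp (sum_nonneg fun p _ => hu p)
    have h4 : 1 ≤ Real.exp (u p) * Real.exp (∑ p ∈ S, u p) := one_le_mul_of_one_le_of_one_le h2 h3
    have h5 : 0 ≤ ∑ p ∈ S, v p := sum_nonneg fun p _ => hv p
    calc _ ≤ (1 + u p) * (Real.exp (∑ p ∈ S, u p) * ∑ p ∈ S, v p) + v p := by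
          have := hu p
          gcongr
          exact ih hS.2
      _ ≤ Real.exp (u p) * (Real.exp (∑ p ∈ S, u p) * ∑ p ∈ S, v p) +
          Real.exp (u p) * Real.exp (∑ p ∈ S, u p) * v p := by
          gcongr
          exact le_mul_of_one_le_left (hv p) h4
      _ = _ := by ring

lemma sum_inv_sq_le {y : ℝ} (hy : 0 < y) (S : Finset ℕ) (hS : ∀ n ∈ S, y < n) :
    ∑ n ∈ S, ((n : ℝ) ^ 2)⁻¹ ≤ 2 / y := by
  calc ∑ n ∈ S, ((n : ℝ) ^ 2)⁻¹ ≤ ∑ n ∈ Ioo ⌊y⌋₊ (S.sup id + 1), ((n : ℝ) ^ 2)⁻¹ := by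
        refine sum_le_sum_of_subset_of_nonneg (fun n hn => ?_) fun _ _ _ => by positivity
        rw [mem_Ioo]
        exact ⟨(Nat.floor_lt hy.le).2 (hS n hn), Nat.lt_succ_of_le (le_sup (f := id) hn)⟩
    _ ≤ 2 / (⌊y⌋₊ + 1) := sum_Ioo_inv_sq_le _ _
    _ ≤ 2 / y := by
        gcongr
        exact (Nat.lt_floor_add_one y).le

/-- Here δ = p ^ (-(1 + k ε / r)). It is summable over p, and (p ^ k) ^ (-(r / k + ε)) = δ ^ r, so
that δ ^ (-(r - 1)) times the inductive bound on length H / p ^ k is again of order δ. Both the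
multiplicative and the additive loss are then summable. -/
lemma sieveMoment_insert_le_of_small {k r : ℕ} (hk : 2 ≤ k) (hr : 1 ≤ r) {ε : ℝ} (hε : 0 < ε)
    {S : Finset ℕ} (hS : ∀ p ∈ S, p.Prime) {p : ℕ} (hp : p.Prime) (hpS : p ∉ S) {H : ℕ}
    (hH : p ^ k ≤ H) {M : ℝ} (hM : 1 ≤ M)
    (hSM : ∀ T : ℕ, 1 ≤ T → T < H →
      sieveMoment k S (2 * r) T ≤ M * (T : ℝ) ^ ((r : ℝ) / k + ε)) :
    sieveMoment k (insert p S) (2 * r) H ≤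
      (1 + 2 ^ (2 * r) * (p : ℝ) ^ (-(1 + k * ε / r))) * sieveMoment k S (2 * r) H +
      2 ^ (2 * r) * (2 * (2 ^ (4 * r + 1) * (2 * 2 ^ ((r : ℝ) / k + ε)))) * M *
        (H : ℝ) ^ ((r : ℝ) / k + ε) * (p : ℝ) ^ (-(1 + k * ε / r)) := by
  have hkr : (0 : ℝ) < k := by positivity
  have hrr : (0 : ℝ) < r := by positivity
  have hp1 : (1 : ℝ) ≤ p := by exact_mod_cast hp.one_lt.le
  have hp0 : (0 : ℝ) < p := by linarith
  set θ := (r : ℝ) / k + ε with hθ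
  have hθ0 : 0 < θ := by positivity
  set e := (p : ℝ) ^ (-(1 + k * ε / r)) with he
  have he0 : 0 < e := Real.rpow_pos_of_pos hp0 _
  have he1 : e ≤ 1 := Real.rpow_le_one_of_one_le_of_nonpos hp1 (by
    have : 0 ≤ k * ε / r := by positivity
    linarith)
  have hP : 0 < p ^ k := pow_pos hp.pos k
  have hPr : (0 : ℝ) < (p ^ k : ℕ) := by exact_mod_cast hP
  have hP4 : 4 ≤ p ^ k := calc
    4 = 2 ^ 2 := rfl
    _ ≤ p ^ 2 := Nat.pow_le_pow_left hp.two_le 2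
    _ ≤ p ^ k := Nat.pow_le_pow_right hp.pos hk
  have hHr : (4 : ℝ) ≤ H := by exact_mod_cast hP4.trans hH
  have hP4r : (4 : ℝ) ≤ (p ^ k : ℕ) := by exact_mod_cast hP4
  have hq1 : 1 ≤ (H : ℝ) / (p ^ k : ℕ) := by
    rw [one_le_div hPr]
    exact_mod_cast hH
  set w := ((H : ℝ) / (p ^ k : ℕ)) ^ θ with hw
  have hw1 : 1 ≤ w := Real.one_le_rpow hq1 hθ0.le
  have hwe : w = (H : ℝ) ^ θ * e ^ r := by
    rw [hw, Real.div_rpow (by positivity) hPr.le, div_eq_mul_inv]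
    congr 1
    rw [← Real.rpow_neg hPr.le, he, ← Real.rpow_natCast, ← Real.rpow_mul hp0.le, Nat.cast_pow,
      ← Real.rpow_natCast, ← Real.rpow_mul hp0.le]
    congr 1
    rw [hθ]
    field_simp
  have h2θ : 1 ≤ (2 : ℝ) ^ θ := Real.one_le_rpow one_le_two hθ0.le
  refine (sieveMoment_insert_le_of_dev k hS hp hpS hr H he0 (B := M * 2 ^ θ * w) ?_).trans ?_
  · intro T hT
    rcases Nat.eq_zero_or_pos T with rfl | hT0
    · rw [sieveMoment_zero k S (by omega)]
      positivity
    have h1 := (abs_le.1 hT).2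
    have h2 : (H : ℝ) / (p ^ k : ℕ) ≤ H / 4 := by gcongr
    -- The induction reaches strictly shorter intervals: p ^ k ≥ 4 because k ≥ 2, and H ≥ p ^ k.
    have h3 : T < H := by
      have : (T : ℝ) < H := by linarith
      exact_mod_cast this
    refine (hSM T hT0 h3).trans ?_
    rw [mul_assoc, hw, ← Real.mul_rpow zero_le_two (by positivity)]
    gcongr
    linarith
  · have hB : M * 2 ^ θ * w + 1 ≤ 2 * 2 ^ θ * M * w := by
      have : 1 ≤ M * 2 ^ θ * w :=
        one_le_mul_of_one_le_of_one_le (one_le_mul_of_one_le_of_one_le hM h2θ) hw1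
      linarith
    have hee : (1 + e⁻¹ ^ (r - 1)) * e ^ r ≤ 2 * e := by
      obtain ⟨i, rfl⟩ : ∃ i, r = i + 1 := ⟨r - 1, by omega⟩
      have h1 : e⁻¹ ^ i * e ^ (i + 1) = e := by
        rw [pow_succ, ← mul_assoc, ← mul_pow, inv_mul_cancel₀ he0.ne', one_pow, one_mul]
      have h2 : e ^ (i + 1) ≤ e := pow_le_of_le_one he0.le he1 (by omega)
      rw [add_tsub_cancel_right, add_mul, h1]
      linarith
    have hHθ : 0 ≤ (H : ℝ) ^ θ := by positivity
    calc _ ≤ (1 + 2 ^ (2 * r) * e) * sieveMoment k S (2 * r) H + 2 ^ (2 * r) *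
          ((1 + e⁻¹ ^ (r - 1)) * (2 ^ (4 * r + 1) * (2 * 2 ^ θ * M * w))) := by
          have : 0 ≤ e⁻¹ ^ (r - 1) := by positivity
          gcongr
      _ = (1 + 2 ^ (2 * r) * e) * sieveMoment k S (2 * r) H + 2 ^ (2 * r) *
          (2 ^ (4 * r + 1) * (2 * 2 ^ θ * M * (H : ℝ) ^ θ) *
            ((1 + e⁻¹ ^ (r - 1)) * e ^ r)) := by
          rw [hwe]
          ring
      _ ≤ (1 + 2 ^ (2 * r) * e) * sieveMoment k S (2 * r) H + 2 ^ (2 * r) *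
          (2 ^ (4 * r + 1) * (2 * 2 ^ θ * M * (H : ℝ) ^ θ) * (2 * e)) := by gcongr
      _ = _ := by ring

/-- Here δ = 1 / y. Since H / p ^ k ≤ (y / p) ^ 2, and the squares 1 / p ^ 2 over p > y sum to at
most 2 / y, the multiplicative losses total O(1) and the additive ones O(y ^ r). -/
lemma sieveMoment_insert_le_of_large {k r : ℕ} (hk : 2 ≤ k) (hr : 1 ≤ r)
    {S : Finset ℕ} (hS : ∀ p ∈ S, p.Prime) {p : ℕ} (hp : p.Prime) (hpS : p ∉ S) {H : ℕ}
    (hH : H < p ^ k) {y : ℝ} (hy : 1 ≤ y) (hyH : y ^ k = H) :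
    sieveMoment k (insert p S) (2 * r) H ≤
      (1 + 2 ^ (2 * r) * (2 * (y ^ 2 * ((p : ℝ) ^ 2)⁻¹) * y⁻¹)) * sieveMoment k S (2 * r) H +
      2 ^ (2 * r) * (4 * (y ^ 2 * ((p : ℝ) ^ 2)⁻¹) * y ^ (r - 1)) := by
  have hp0 : (0 : ℝ) < p := by exact_mod_cast hp.pos
  have hyp : y < p := by
    have : y ^ k < (p : ℝ) ^ k := by
      rw [hyH]
      exact_mod_cast hH
    exact lt_of_pow_lt_pow_left₀ k hp0.le this
  have hw : (H : ℝ) / (p ^ k : ℕ) ≤ y ^ 2 * ((p : ℝ) ^ 2)⁻¹ := by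
    rw [← hyH, Nat.cast_pow, ← div_pow, ← div_eq_mul_inv, ← div_pow]
    exact pow_le_pow_of_le_one (by positivity) ((div_le_one hp0).2 hyp.le) hk
  refine (sieveMoment_insert_le_of_lt k hS hp hpS hr hH (δ := y⁻¹) (by positivity)).trans ?_
  have hm := sieveMoment_nonneg k S (even_two_mul r) H
  have hy1 : 1 ≤ y ^ (r - 1) := one_le_pow₀ hy
  rw [inv_inv]
  calc _ ≤ (1 + 2 ^ (2 * r) * (2 * (y ^ 2 * ((p : ℝ) ^ 2)⁻¹)) * y⁻¹) *
        sieveMoment k S (2 * r) H +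
        2 ^ (2 * r) * (2 * (y ^ 2 * ((p : ℝ) ^ 2)⁻¹)) * (y ^ (r - 1) + y ^ (r - 1)) := by gcongr
    _ = _ := by ring

/-- The moment bound for sieves by primes outside a suitable finite set. -/
theorem exists_sieveMoment_le_of_disjoint {k r : ℕ} (hk : 2 ≤ k) (hr : 1 ≤ r) {ε : ℝ}
    (hε : 0 < ε) : ∃ (s : Finset ℕ) (M : ℝ), 1 ≤ M ∧ ∀ H : ℕ, 1 ≤ H → ∀ S : Finset ℕ,
      (∀ p ∈ S, p.Prime) → Disjoint S s →
        sieveMoment k S (2 * r) H ≤ M * (H : ℝ) ^ ((r : ℝ) / k + ε) := by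
  have hkr : (0 : ℝ) < k := by positivity
  have hrr : (0 : ℝ) < r := by positivity
  set θ := (r : ℝ) / k + ε with hθ
  have hθ0 : 0 < θ := by positivity
  set e : ℕ → ℝ := fun n => (n : ℝ) ^ (-(1 + k * ε / r)) with he
  have he0 : ∀ n, 0 ≤ e n := fun n => by positivity
  have hsum : Summable e := Real.summable_nat_rpow.2 (by
    have : 0 < k * ε / r := by positivity
    linarith)
  set Z := ∑' n, e n with hZ
  have hZ0 : 0 ≤ Z := tsum_nonneg he0
  set K : ℝ := 2 ^ (2 * r) with hK
  have hK0 : 0 < K := by positivity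
  set C₁ : ℝ := K * (2 * (2 ^ (4 * r + 1) * (2 * 2 ^ θ))) with hC₁
  have hC₁0 : 0 < C₁ := by positivity
  set E := Real.exp (K * Z + 4 * K) with hE
  have hE0 : 0 < E := Real.exp_pos _
  -- Outside s the sum of e is so small that the inductive constant returns multiplied by at most 1
  -- / 2.
  obtain ⟨s, hs⟩ := summable_iff_vanishing_norm.1 hsum (1 / (2 * E * C₁)) (by positivity)
  -- The large primes contribute 8 K E, which must fit into the remaining M / 2.
  set M := max 1 (16 * K * E) with hM
  have hM1 : 1 ≤ M := le_max_left _ _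
  have hM2 : 16 * K * E ≤ M := le_max_right _ _
  refine ⟨s, M, hM1, fun H => ?_⟩
  induction H using Nat.strong_induction_on with
  | _ H ih =>
    intro hH S hS hdisj
    have hHr : (1 : ℝ) ≤ H := by exact_mod_cast hH
    set y : ℝ := (H : ℝ) ^ ((1 : ℝ) / k) with hy
    have hy1 : 1 ≤ y := Real.one_le_rpow hHr (by positivity)
    have hyk : y ^ k = H := by
      rw [hy, ← Real.rpow_natCast, ← Real.rpow_mul (by positivity), one_div_mul_cancel hkr.ne',
        Real.rpow_one]
    have hyr : y ^ r ≤ (H : ℝ) ^ θ := by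
      rw [hy, ← Real.rpow_natCast, ← Real.rpow_mul (by positivity)]
      apply Real.rpow_le_rpow_of_exponent_le hHr
      rw [hθ, one_div_mul_eq_div]
      linarith
    have hHθ : 0 < (H : ℝ) ^ θ := by positivity
    set large : ℕ → ℝ := fun p => if H < p ^ k then y ^ 2 * ((p : ℝ) ^ 2)⁻¹ else 0 with hlarge
    have hlarge0 : ∀ p, 0 ≤ large p := fun p => by
      simp only [hlarge]
      split_ifs
      · positivity
      · rfl
    have hlsum : ∑ p ∈ S, large p ≤ 2 * y := by
      simp only [hlarge]
      rw [← sum_filter, ← mul_sum]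
      have : ∑ p ∈ S with H < p ^ k, ((p : ℝ) ^ 2)⁻¹ ≤ 2 / y := by
        refine sum_inv_sq_le (by positivity) _ fun p hp => ?_
        have h1 : y ^ k < (p : ℝ) ^ k := by
          rw [hyk]
          exact_mod_cast (mem_filter.1 hp).2
        exact lt_of_pow_lt_pow_left₀ k (by positivity) h1
      calc _ ≤ y ^ 2 * (2 / y) := by gcongr
        _ = 2 * y := by field_simp
    set u : ℕ → ℝ := fun p => K * e p + K * (2 * large p * y⁻¹) with hu
    set v : ℕ → ℝ := fun p => C₁ * M * (H : ℝ) ^ θ * e p + K * (4 * large p * y ^ (r - 1)) with hv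
    have hu0 : ∀ p, 0 ≤ u p := fun p => by
      have := he0 p
      have := hlarge0 p
      positivity
    have hv0 : ∀ p, 0 ≤ v p := fun p => by
      have := he0 p
      have := hlarge0 p
      positivity
    have hrec := sieveMoment_le_exp_sum k (L := 2 * r) (by omega) H
      {p | p.Prime ∧ p ∉ s} hu0 hv0 (fun S' p hS' hp hpS' => by
        have hS'1 : ∀ q ∈ S', q.Prime := fun q hq => (hS' hq).1
        have hS'2 : Disjoint S' s := disjoint_left.2 fun q hq => (hS' hq).2
        have hm := sieveMoment_nonneg k S' (even_two_mul r) H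
        by_cases hlt : H < p ^ k
        · refine (sieveMoment_insert_le_of_large hk hr hS'1 hp.1 hpS' hlt hy1 hyk).trans ?_
          have := he0 p
          simp only [hu, hv, hlarge, if_pos hlt]
          gcongr ?_ * _ + ?_
          · have : 0 ≤ K * e p := by positivity
            linarith
          · have : 0 ≤ C₁ * M * (H : ℝ) ^ θ * e p := by positivity
            linarith
        · refine (sieveMoment_insert_le_of_small hk hr hε hS'1 hp.1 hpS' (not_lt.1 hlt) hM1
            fun T hT1 hT2 => ih T hT2 hT1 S' hS'1 hS'2).trans ?_
          simp only [hu, hv, hlarge, if_neg hlt, mul_zero, zero_mul, add_zero]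
          exact le_rfl) S
      (fun p hp => ⟨hS p hp, fun h => disjoint_left.1 hdisj hp h⟩)
    have husum : ∑ p ∈ S, u p ≤ K * Z + 4 * K := by
      simp only [hu, sum_add_distrib, ← mul_sum, ← sum_mul]
      have h1 : ∑ p ∈ S, e p ≤ Z := hsum.sum_le_tsum S fun i _ => he0 i
      have h2 : 2 * (∑ p ∈ S, large p) * y⁻¹ ≤ 4 := by
        rw [← div_eq_mul_inv, div_le_iff₀ (by positivity)]
        linarith
      have h3 := mul_le_mul_of_nonneg_left h1 hK0.le
      have h4 := mul_le_mul_of_nonneg_left h2 hK0.le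
      linarith
    have hvsum : ∑ p ∈ S, v p ≤ (C₁ * M * (1 / (2 * E * C₁)) + 8 * K) * (H : ℝ) ^ θ := by
      simp only [hv, sum_add_distrib, ← mul_sum, ← sum_mul]
      have h1 : ∑ p ∈ S, e p ≤ 1 / (2 * E * C₁) :=
        (le_abs_self _).trans (hs S hdisj).le
      have h2 : 4 * (∑ p ∈ S, large p) * y ^ (r - 1) ≤ 8 * (H : ℝ) ^ θ := by
        calc _ ≤ 4 * (2 * y) * y ^ (r - 1) := by gcongr
          _ = 8 * y ^ (r - 1 + 1) := by ring
          _ = 8 * y ^ r := by rw [Nat.sub_add_cancel hr]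
          _ ≤ _ := by gcongr
      have h3 : C₁ * M * (H : ℝ) ^ θ * ∑ p ∈ S, e p ≤
          C₁ * M * (H : ℝ) ^ θ * (1 / (2 * E * C₁)) := by gcongr
      have h4 := mul_le_mul_of_nonneg_left h2 hK0.le
      linarith
    refine hrec.trans ?_
    calc _ ≤ E * ((C₁ * M * (1 / (2 * E * C₁)) + 8 * K) * (H : ℝ) ^ θ) := by
          have := sum_nonneg fun p (_ : p ∈ S) => hv0 p
          rw [hE]
          gcongr
      _ = (M / 2 + 8 * K * E) * (H : ℝ) ^ θ := by
          field_simp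
      _ ≤ M * (H : ℝ) ^ θ := by
          gcongr
          linarith

/-- The `2r`-th moment of the deviation of a sieve by `k`-th powers of primes over intervals of
length `H` is `O(H ^ (r / k + ε))`, uniformly in the set of primes. -/
theorem exists_sieveMoment_le {k r : ℕ} (hk : 2 ≤ k) (hr : 1 ≤ r) {ε : ℝ} (hε : 0 < ε) :
    ∃ M : ℝ, 1 ≤ M ∧ ∀ H : ℕ, 1 ≤ H → ∀ S : Finset ℕ, (∀ p ∈ S, p.Prime) →
      sieveMoment k S (2 * r) H ≤ M * (H : ℝ) ^ ((r : ℝ) / k + ε) := by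
  obtain ⟨s, M, hM, hmain⟩ := exists_sieveMoment_le_of_disjoint hk hr hε
  set θ := (r : ℝ) / k + ε with hθ
  have hθ0 : 0 < θ := by positivity
  set K : ℝ := 2 ^ (2 * r) with hK
  have hK1 : 1 ≤ K := one_le_pow₀ one_le_two
  -- This is `sieveMoment_insert_le` applied with B = N * 2 ^ θ * H ^ θ, the 1 there being absorbed
  -- by N * H ^ θ ≥ 1.
  set F : ℝ := K * (1 + K * (2 ^ θ + 1)) with hF
  have hF1 : 1 ≤ F := by
    have : 0 ≤ K * (2 ^ θ + 1) := by positivity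
    exact one_le_mul_of_one_le_of_one_le hK1 (by linarith)
  -- Induction on the set t of exceptional primes that S may contain; each one costs a factor F.
  suffices h : ∀ t : Finset ℕ, t ⊆ s → ∀ H : ℕ, 1 ≤ H → ∀ S : Finset ℕ, (∀ p ∈ S, p.Prime) →
      S ∩ s ⊆ t → sieveMoment k S (2 * r) H ≤ F ^ t.card * M * (H : ℝ) ^ θ by
    refine ⟨F ^ s.card * M, one_le_mul_of_one_le_of_one_le (one_le_pow₀ hF1) hM,
      fun H hH S hS => h s Subset.rfl H hH S hS inter_subset_right⟩
  intro t
  induction t using Finset.induction_on with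
  | empty =>
    intro _ H hH S hS hSt
    rw [card_empty, pow_zero, one_mul]
    exact hmain H hH S hS (disjoint_iff_inter_eq_empty.2 (subset_empty.1 hSt))
  | insert p t hpt ih =>
    intro hts H hH S hS hSt
    have hts' := (insert_subset_iff.1 hts).2
    have hHr : (1 : ℝ) ≤ H := by exact_mod_cast hH
    rw [card_insert_of_notMem hpt]
    set N := F ^ t.card * M with hN
    have hN1 : 1 ≤ N := one_le_mul_of_one_le_of_one_le (one_le_pow₀ hF1) hM
    have hHθ : 1 ≤ (H : ℝ) ^ θ := Real.one_le_rpow hHr hθ0.le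
    have heq : F ^ (t.card + 1) * M = F * N := by rw [hN]; ring
    rw [heq]
    by_cases hpS : p ∈ S
    · set S' := S.erase p with hS'
      have hS'p : ∀ q ∈ S', q.Prime := fun q hq => hS q (mem_of_mem_erase hq)
      have hS't : S' ∩ s ⊆ t := by
        intro q hq
        rw [mem_inter, hS', mem_erase] at hq
        have := hSt (mem_inter.2 ⟨hq.1.2, hq.2⟩)
        exact (mem_insert.1 this).resolve_left hq.1.1
      have hpp := hS p hpS
      have hp1 : (1 : ℝ) ≤ (p ^ k : ℕ) := by exact_mod_cast Nat.one_le_pow _ _ hpp.pos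
      rw [← insert_erase hpS]
      refine (sieveMoment_insert_le k hS'p hpp (notMem_erase p S) (even_two_mul r) H
        (B := N * (2 ^ θ * (H : ℝ) ^ θ)) ?_).trans ?_
      · intro T hT
        rcases Nat.eq_zero_or_pos T with rfl | hT0
        · rw [sieveMoment_zero k _ (by omega)]
          positivity
        refine (ih hts' T hT0 S' hS'p hS't).trans ?_
        rw [← Real.mul_rpow zero_le_two (by positivity)]
        have h1 := (abs_le.1 hT).2
        have h2 : (H : ℝ) / (p ^ k : ℕ) ≤ H := div_le_self (by positivity) hp1
        gcongr
        linarith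
      · have h1 := ih hts' H hH S' hS'p hS't
        have h2 : 1 ≤ N * (H : ℝ) ^ θ := one_le_mul_of_one_le_of_one_le hN1 hHθ
        calc _ ≤ K * (N * (H : ℝ) ^ θ + K * (N * (2 ^ θ * (H : ℝ) ^ θ) + N * (H : ℝ) ^ θ)) := by
              gcongr
          _ = _ := by rw [hF]; ring
    · have hSt' : S ∩ s ⊆ t := by
        intro q hq
        refine (mem_insert.1 (hSt hq)).resolve_left ?_
        rintro rfl
        exact hpS (mem_inter.1 hq).1
      refine (ih hts' H hH S hS hSt').trans ?_
      gcongr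
      exact le_mul_of_one_le_left (by linarith) hF1

/-! ### Divisor bounds and integers coprime to q. -/

/-- A prime p ≥ B ^ (1 / ε) satisfies B ≤ p ^ ε and is paid for by n ^ ε; the boundedly many smaller
primes are paid for by the constant. -/
lemma exists_pow_card_primeFactors_le (B : ℕ) (hB : 1 ≤ B) {ε : ℝ} (hε : 0 < ε) :
    ∃ C : ℝ, 1 ≤ C ∧ ∀ n : ℕ, n ≠ 0 →
      (B : ℝ) ^ n.primeFactors.card ≤ C * (n : ℝ) ^ ε := by
  have hBr : (1 : ℝ) ≤ B := by exact_mod_cast hB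
  set N := ⌈(B : ℝ) ^ (1 / ε)⌉₊ with hN
  refine ⟨(B : ℝ) ^ N, one_le_pow₀ hBr, fun n hn => ?_⟩
  have hlarge : ∀ p : ℕ, N ≤ p → (B : ℝ) ≤ (p : ℝ) ^ ε := fun p hp => by
    have h1 : (B : ℝ) ^ (1 / ε) ≤ p := (Nat.le_ceil _).trans (by exact_mod_cast hp)
    calc (B : ℝ) = ((B : ℝ) ^ (1 / ε)) ^ ε := by
          rw [← Real.rpow_mul (by positivity), one_div_mul_cancel hε.ne', Real.rpow_one]
      _ ≤ _ := by gcongr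
  have h1 : (B : ℝ) ^ (n.primeFactors.filter (· < N)).card ≤ (B : ℝ) ^ N := by
    refine pow_le_pow_right₀ hBr ?_
    calc _ ≤ (range N).card := card_le_card fun p hp => mem_range.2 (mem_filter.1 hp).2
      _ = N := card_range N
  have h2 : (B : ℝ) ^ (n.primeFactors.filter (¬ · < N)).card ≤ (n : ℝ) ^ ε := by
    rw [← prod_const]
    calc _ ≤ ∏ p ∈ n.primeFactors.filter (¬ · < N), (p : ℝ) ^ ε :=
          prod_le_prod (fun _ _ => by positivity)
            fun p hp => hlarge p (not_lt.1 (mem_filter.1 hp).2)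
      _ ≤ ∏ p ∈ n.primeFactors, (p : ℝ) ^ ε := by
          refine prod_le_prod_of_subset_of_one_le (filter_subset _ _)
            (fun _ _ => by positivity) fun p hp _ => ?_
          have : (1 : ℝ) ≤ p := by exact_mod_cast (Nat.prime_of_mem_primeFactors hp).one_lt.le
          exact Real.one_le_rpow this hε.le
      _ = ((∏ p ∈ n.primeFactors, p : ℕ) : ℝ) ^ ε := by
          rw [Real.finsetProd_rpow _ _ fun _ _ => by positivity]
          push_cast
          rfl
      _ ≤ (n : ℝ) ^ ε := by
          gcongr
          exact Nat.le_of_dvd (Nat.pos_of_ne_zero hn) (Nat.prod_primeFactors_dvd n)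
  rw [← card_filter_add_card_filter_not (s := n.primeFactors) (· < N), pow_add]
  gcongr

lemma sum_divisors_moebius_dvd {N : ℕ} (hN : N ≠ 0) (m : ℕ) :
    ∑ d ∈ N.divisors, (μ d : ℝ) * (if d ∣ m then 1 else 0) = if m.Coprime N then 1 else 0 := by
  simp only [mul_ite, mul_one, mul_zero]
  rw [← sum_filter]
  have h1 : N.divisors.filter (· ∣ m) = (m.gcd N).divisors := by
    ext d
    rw [mem_filter, Nat.mem_divisors, Nat.mem_divisors, Nat.dvd_gcd_iff]
    have := Nat.gcd_ne_zero_right (m := m) hN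
    tauto
  have h2 := congrArg (fun f : ArithmeticFunction ℤ => f (m.gcd N))
    ArithmeticFunction.coe_zeta_mul_moebius
  simp only [ArithmeticFunction.coe_zeta_mul_apply, ArithmeticFunction.one_apply] at h2
  rw [h1, ← Int.cast_sum, h2]
  push_cast
  rfl

lemma abs_moebius_cast_le_one (d : ℕ) : |(μ d : ℝ)| ≤ 1 := by
  have := ArithmeticFunction.abs_moebius_le_one (n := d)
  exact_mod_cast this

lemma card_divisors_of_squarefree {n : ℕ} (hn : Squarefree n) :
    n.divisors.card = 2 ^ n.primeFactors.card := by
  rw [Nat.card_divisors hn.ne_zero, ← prod_const]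
  refine prod_congr rfl fun p hp => ?_
  have := hn.natFactorization_le_one p
  have := (Nat.prime_of_mem_primeFactors hp).factorization_pos_of_dvd hn.ne_zero
    (Nat.dvd_of_mem_primeFactors hp)
  omega

lemma squarefree_prod_primes {S : Finset ℕ} (hS : ∀ p ∈ S, p.Prime) :
    Squarefree (∏ p ∈ S, p) := by
  refine Finset.squarefree_prod_of_pairwise_isCoprime ?_ fun p hp => (hS p hp).prime.squarefree
  intro p hp q hq hpq
  exact Nat.coprime_iff_isRelPrime.1 ((Nat.coprime_primes (hS p hp) (hS q hq)).2 hpq)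

/-- Detecting coprimality through the radical leaves a Möbius sum with only 2 ^ ω(q) terms. -/
lemma int_gcd_eq_one_iff_radical {n : ℤ} {q : ℕ} (hq : q ≠ 0) :
    n.natAbs.Coprime (∏ p ∈ q.primeFactors, p) ↔ Int.gcd n q = 1 := by
  rw [Nat.coprime_prod_right_iff, Int.gcd, Int.natAbs_natCast, ← Nat.coprime_iff_gcd_eq_one]
  constructor
  · intro h
    refine Nat.Coprime.symm (Nat.coprime_of_dvd fun p hp hpq hpn => ?_)
    have := h p (Nat.mem_primeFactors.2 ⟨hp, hpq, hq⟩)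
    rw [Nat.coprime_comm, hp.coprime_iff_not_dvd] at this
    exact this hpn
  · intro h p hp
    exact h.coprime_dvd_right (Nat.dvd_of_mem_primeFactors hp)

/-- The number of integers coprime to `q` in an interval and a residue class. -/
lemma abs_card_coprime_class_sub_le {q : ℕ} (hq : q ≠ 0) {P : ℕ} (hP : 0 < P)
    (hPq : P.Coprime q) (a y : ℤ) (H : ℕ) :
    |(∑ t ∈ range H, if Int.gcd (a + t) q = 1 then (if (P : ℤ) ∣ y + t then (1 : ℝ) else 0) else 0) -
      H / P * ∑ e ∈ (∏ p ∈ q.primeFactors, p).divisors, (μ e : ℝ) / e| ≤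
        2 ^ q.primeFactors.card := by
  set R := ∏ p ∈ q.primeFactors, p with hR
  have hRsq : Squarefree R := squarefree_prod_primes fun p hp => Nat.prime_of_mem_primeFactors hp
  have hRq : R ∣ q := Nat.prod_primeFactors_dvd q
  have hcard : R.divisors.card = 2 ^ q.primeFactors.card := by
    rw [card_divisors_of_squarefree hRsq, hR, Nat.primeFactors_prod fun p hp =>
      Nat.prime_of_mem_primeFactors hp]
  have hcount : ∀ e ∈ R.divisors, |(∑ t ∈ range H, if (P : ℤ) ∣ y + t then
      (if e ∣ (a + t).natAbs then (1 : ℝ) else 0) else 0) - H / P / e| ≤ 1 := by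
    intro e he
    have he' := Nat.dvd_of_mem_divisors he
    have he0 : 0 < e := Nat.pos_of_mem_divisors he
    have hPe : P.Coprime e := hPq.coprime_dvd_right (he'.trans hRq)
    obtain ⟨u, v, huv⟩ := Nat.isCoprime_iff_coprime.2 hPe
    -- Since u P + v e = 1, z is y modulo P and a modulo e: the two divisibility conditions merge
    -- into one class modulo P e.
    set z := a * (u * P) + y * (v * e) with hz
    have hiff : ∀ t : ℕ, ((P * e : ℕ) : ℤ) ∣ z + t ↔ (P : ℤ) ∣ y + t ∧ e ∣ (a + t).natAbs := by
      intro t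
      have h1 : z + t = (y + t) + P * (u * (a - y)) := by
        have : y * (v * e) = y - y * (u * P) := by rw [← mul_one_sub]; congr 1; linarith
        rw [hz, this]
        ring
      have h2 : z + t = (a + t) + e * (v * (y - a)) := by
        have : a * (u * P) = a - a * (v * e) := by rw [← mul_one_sub]; congr 1; linarith
        rw [hz, this]
        ring
      rw [← Int.natCast_dvd, Nat.cast_mul]
      constructor
      · intro h
        constructor
        · have := (dvd_mul_right (P : ℤ) e).trans h
          rwa [h1, dvd_add_left (dvd_mul_right _ _)] at this
        · have := (dvd_mul_left (e : ℤ) P).trans h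
          rwa [h2, dvd_add_left (dvd_mul_right _ _)] at this
      · rintro ⟨h3, h4⟩
        refine (Nat.isCoprime_iff_coprime.2 hPe).mul_dvd ?_ ?_
        · rwa [h1, dvd_add_left (dvd_mul_right _ _)]
        · rwa [h2, dvd_add_left (dvd_mul_right _ _)]
    obtain ⟨h₀, T, hT, hsum⟩ := exists_progression (Nat.mul_pos hP he0) z H
    have h3 : (∑ t ∈ range H, if (P : ℤ) ∣ y + t then
        (if e ∣ (a + t).natAbs then (1 : ℝ) else 0) else 0) = T := by
      have := hsum fun _ => 1
      rw [sum_const, card_range, nsmul_one] at this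
      rw [← this]
      refine sum_congr rfl fun t _ => ?_
      rw [← ite_and]
      simp only [hiff]
    rw [h3, div_div]
    exact_mod_cast hT
  have hexp : (∑ t ∈ range H, if Int.gcd (a + t) q = 1 then
      (if (P : ℤ) ∣ y + t then (1 : ℝ) else 0) else 0) = ∑ e ∈ R.divisors, (μ e : ℝ) *
        ∑ t ∈ range H, if (P : ℤ) ∣ y + t then
          (if e ∣ (a + t).natAbs then (1 : ℝ) else 0) else 0 := by
    simp only [mul_sum]
    rw [sum_comm]
    refine sum_congr rfl fun t _ => ?_
    have := sum_divisors_moebius_dvd hRsq.ne_zero (a + t).natAbs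
    simp only [hR, int_gcd_eq_one_iff_radical hq] at this
    by_cases h : (P : ℤ) ∣ y + t
    · simp only [h, if_true]
      rw [hR, this]
    · simp [h]
  rw [hexp, mul_sum, ← sum_sub_distrib]
  refine (abs_sum_le_sum_abs _ _).trans ?_
  calc _ ≤ ∑ e ∈ R.divisors, (1 : ℝ) := by
        refine sum_le_sum fun e he => ?_
        rw [show (μ e : ℝ) * (∑ t ∈ range H, if (P : ℤ) ∣ y + t then
          (if e ∣ (a + t).natAbs then (1 : ℝ) else 0) else 0) - H / P * ((μ e : ℝ) / e) =
          (μ e : ℝ) * ((∑ t ∈ range H, if (P : ℤ) ∣ y + t then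
          (if e ∣ (a + t).natAbs then (1 : ℝ) else 0) else 0) - H / P / e) by ring, abs_mul]
        exact mul_le_one₀ (abs_moebius_cast_le_one e) (abs_nonneg _) (hcount e he)
    _ = _ := by
        rw [sum_const, hcard, nsmul_one]
        push_cast
        rfl

/-! ### Correlations of the sieve along several shifts. -/

open scoped Classical in
/-- The product of the `p ∈ S` whose `k`-th power divides one of the shifts `n + s i`. -/
noncomputable def sieveDiv {ι : Type*} (k : ℕ) (S : Finset ℕ) (s : ι → ℤ) (n : ℤ) : ℕ :=
  ∏ p ∈ S.filter (fun p : ℕ => ∃ i : ι, (p : ℤ) ^ k ∣ n + s i), p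

/-- The number of residues `r` modulo `d ^ k` with `d ∣ sieveDiv k S s r`. -/
noncomputable def rootCount {ι : Type*} (k : ℕ) (S : Finset ℕ) (s : ι → ℤ) (d : ℕ) : ℕ :=
  ((range (d ^ k)).filter fun r : ℕ => d ∣ sieveDiv k S s r).card

section Correlation

variable {ι : Type*} {k : ℕ} {S : Finset ℕ} {s : ι → ℤ}

lemma sieveDiv_dvd (n : ℤ) : sieveDiv k S s n ∣ ∏ p ∈ S, p := by
  classical exact prod_dvd_prod_of_subset _ _ _ (filter_subset _ _)

lemma prime_dvd_sieveDiv (hS : ∀ p ∈ S, p.Prime) {p : ℕ} (hp : p.Prime) {n : ℤ} :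
    p ∣ sieveDiv k S s n ↔ p ∈ S ∧ ∃ i, (p : ℤ) ^ k ∣ n + s i := by
  classical
  rw [sieveDiv, hp.prime.dvd_finsetProd_iff]
  constructor
  · rintro ⟨a, ha, hpa⟩
    rw [mem_filter] at ha
    rw [Nat.prime_dvd_prime_iff_eq hp (hS a ha.1)] at hpa
    subst hpa
    exact ha
  · intro h
    exact ⟨p, mem_filter.2 h, dvd_rfl⟩

lemma squarefree_of_dvd_prod_primes (hS : ∀ p ∈ S, p.Prime) {d : ℕ} (hd : d ∣ ∏ p ∈ S, p) :
    Squarefree d :=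
  (squarefree_prod_primes hS).squarefree_of_dvd hd

lemma squarefree_sieveDiv (hS : ∀ p ∈ S, p.Prime) (n : ℤ) : Squarefree (sieveDiv k S s n) :=
  squarefree_of_dvd_prod_primes hS (sieveDiv_dvd n)

lemma dvd_sieveDiv_iff (hS : ∀ p ∈ S, p.Prime) {d : ℕ} (hd : d ∣ ∏ p ∈ S, p) {n : ℤ} :
    d ∣ sieveDiv k S s n ↔ ∀ p ∈ d.primeFactors, ∃ i, (p : ℤ) ^ k ∣ n + s i := by
  have hdsq := squarefree_of_dvd_prod_primes hS hd
  constructor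
  · intro h p hp
    exact ((prime_dvd_sieveDiv hS (Nat.prime_of_mem_primeFactors hp)).1
      ((Nat.dvd_of_mem_primeFactors hp).trans h)).2
  · intro h
    rw [← Nat.prod_primeFactors_of_squarefree hdsq]
    refine prod_primes_dvd _ (fun p hp => (Nat.prime_of_mem_primeFactors hp).prime) fun p hp => ?_
    have hpp := Nat.prime_of_mem_primeFactors hp
    refine (prime_dvd_sieveDiv hS hpp).2 ⟨?_, h p hp⟩
    obtain ⟨a, ha, hpa⟩ := (hpp.prime.dvd_finsetProd_iff _).1
      ((Nat.dvd_of_mem_primeFactors hp).trans hd)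
    rw [Nat.prime_dvd_prime_iff_eq hpp (hS a ha)] at hpa
    exact hpa ▸ ha

lemma dvd_sieveDiv_congr (hS : ∀ p ∈ S, p.Prime) {d : ℕ} (hd : d ∣ ∏ p ∈ S, p) {m n : ℤ}
    (hmn : ((d ^ k : ℕ) : ℤ) ∣ m - n) : d ∣ sieveDiv k S s m ↔ d ∣ sieveDiv k S s n := by
  rw [dvd_sieveDiv_iff hS hd, dvd_sieveDiv_iff hS hd]
  refine forall₂_congr fun p hp => exists_congr fun i => ?_
  have h1 : (p : ℤ) ^ k ∣ m - n := by
    refine dvd_trans ?_ hmn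
    have := pow_dvd_pow_of_dvd (Nat.dvd_of_mem_primeFactors hp) k
    exact_mod_cast this
  rw [show m + s i = (n + s i) + (m - n) by ring, dvd_add_left h1]

lemma prod_sieveInd [Fintype ι] (n : ℤ) :
    ∏ i, sieveInd k S (n + s i) = if ∃ p ∈ S, ∃ i, (p : ℤ) ^ k ∣ n + s i then 0 else 1 := by
  unfold sieveInd
  split_ifs with h
  · obtain ⟨p, hp, i, hi⟩ := h
    refine prod_eq_zero (mem_univ i) (prod_eq_zero hp ?_)
    simp [hi]
  · push Not at h
    refine prod_eq_one fun i _ => prod_eq_one fun p hp => ?_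
    simp [h p hp i]

/-- The product is 1 exactly when no p ^ k hits any shift, that is, when `sieveDiv` is 1. One Möbius
sum over its divisors treats all the shifts together. -/
lemma prod_sieveInd_eq_sum [Fintype ι] (hS : ∀ p ∈ S, p.Prime) (n : ℤ) :
    ∏ i, sieveInd k S (n + s i) = ∑ d ∈ (∏ p ∈ S, p).divisors,
      (μ d : ℝ) * (if d ∣ sieveDiv k S s n then 1 else 0) := by
  have h0 : (∏ p ∈ S, p) ≠ 0 := (squarefree_prod_primes hS).ne_zero
  rw [sum_divisors_moebius_dvd h0, prod_sieveInd]
  have : (sieveDiv k S s n).Coprime (∏ p ∈ S, p) ↔ ¬ ∃ p ∈ S, ∃ i, (p : ℤ) ^ k ∣ n + s i := by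
    rw [Nat.coprime_iff_gcd_eq_one, Nat.gcd_eq_left (sieveDiv_dvd n)]
    constructor
    · rintro h ⟨p, hp, hi⟩
      have := (prime_dvd_sieveDiv (k := k) (s := s) (n := n) hS (hS p hp)).2 ⟨hp, hi⟩
      rw [h, Nat.dvd_one] at this
      exact (hS p hp).ne_one this
    · intro h
      by_contra h1
      obtain ⟨p, hp, hpd⟩ := Nat.exists_prime_and_dvd h1
      have := (prime_dvd_sieveDiv hS hp).1 hpd
      exact h ⟨p, this.1, this.2⟩
  by_cases h : ∃ p ∈ S, ∃ i, (p : ℤ) ^ k ∣ n + s i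
  · simp only [this, h, not_true, if_true, if_false]
  · simp only [this, h, not_false_eq_true, if_true, if_false]

/-- Each root determines, for every p dividing d, an index i with p ^ k dividing r + s i; by the
Chinese remainder theorem these indices determine r modulo d ^ k. The bound does not depend on the
shifts. -/
lemma rootCount_le [Fintype ι] [Nonempty ι] (hS : ∀ p ∈ S, p.Prime) {d : ℕ}
    (hd : d ∣ ∏ p ∈ S, p) : rootCount k S s d ≤ Fintype.card ι ^ d.primeFactors.card := by
  classical
  have hdsq := squarefree_of_dvd_prod_primes hS hd
  let f : ℕ → (d.primeFactors → ι) := fun r p =>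
    Classical.epsilon fun i => ((p : ℕ) : ℤ) ^ k ∣ (r : ℤ) + s i
  have hf : ∀ r : ℕ, d ∣ sieveDiv k S s r → ∀ p : d.primeFactors,
      ((p : ℕ) : ℤ) ^ k ∣ (r : ℤ) + s (f r p) := fun r hr p =>
    Classical.epsilon_spec ((dvd_sieveDiv_iff hS hd).1 hr p p.2)
  have hinj : Set.InjOn f
      (((range (d ^ k)).filter fun r : ℕ => d ∣ sieveDiv k S s r : Finset ℕ) : Set ℕ) := by
    intro r hr r' hr' hrr'
    rw [mem_coe, mem_filter, mem_range] at hr hr'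
    have h1 : ∀ p ∈ d.primeFactors, ((p ^ k : ℕ) : ℤ) ∣ (r' : ℤ) - r := fun p hp => by
      have e1 := hf r hr.2 ⟨p, hp⟩
      have e2 := hf r' hr'.2 ⟨p, hp⟩
      rw [hrr'] at e1
      have := dvd_sub e2 e1
      push_cast
      rwa [add_sub_add_right_eq_sub] at this
    have h2 : ((∏ p ∈ d.primeFactors, p ^ k : ℕ) : ℤ) ∣ (r' : ℤ) - r := by
      rw [Nat.cast_prod]
      refine prod_dvd_of_coprime (fun p hp q hq hpq => ?_) h1
      exact Nat.isCoprime_iff_coprime.2 (Nat.Coprime.pow _ _ ((Nat.coprime_primes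
        (Nat.prime_of_mem_primeFactors hp) (Nat.prime_of_mem_primeFactors hq)).2 hpq))
    rw [prod_pow, Nat.prod_primeFactors_of_squarefree hdsq] at h2
    have h3 : r ≡ r' [MOD d ^ k] := (Nat.modEq_iff_dvd).2 h2
    exact h3.eq_of_lt_of_lt hr.1 hr'.1
  calc _ ≤ (univ : Finset (d.primeFactors → ι)).card :=
        card_le_card_of_injOn f (fun _ _ => mem_coe.2 (mem_univ _)) hinj
    _ = _ := by simp

lemma cyclicAvg_dvd_sieveDiv (hS : ∀ p ∈ S, p.Prime) {d : ℕ} (hd : d ∣ ∏ p ∈ S, p) :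
    cyclicAvg (sieveMod k S) (fun x => if d ∣ sieveDiv k S s x then 1 else 0) =
      rootCount k S s d / (d : ℝ) ^ k := by
  have hper : Function.Periodic (fun x : ℤ => if d ∣ sieveDiv k S s x then (1 : ℝ) else 0)
      ((d ^ k : ℕ) : ℤ) := by
    intro x
    have := dvd_sieveDiv_congr (k := k) (s := s) hS hd (m := x + ((d ^ k : ℕ) : ℤ)) (n := x)
      (by simp)
    simp only [this]
  obtain ⟨R, hR⟩ := pow_dvd_pow_of_dvd hd k
  rw [← prod_pow] at hR
  have hpos := sieveMod_pos k hS
  rw [sieveMod, hR] at hpos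
  rw [sieveMod, hR, cyclicAvg_mul_period (Nat.pos_of_mul_pos_left hpos) hper, cyclicAvg, rootCount]
  push_cast [card_filter]
  rfl

lemma sum_class_indicator {P : ℕ} (hP : 0 < P) (n : ℤ) (f : ℕ → ℝ) :
    ∑ r ∈ range P, (if (P : ℤ) ∣ n - r then f r else 0) = f (n % P).toNat := by
  have hP' : (0 : ℤ) < P := by exact_mod_cast hP
  have h0 := Int.emod_nonneg n hP'.ne'
  have h1 := Int.emod_lt_of_pos n hP'
  rw [sum_eq_single_of_mem (n % P).toNat (mem_range.2 (by omega))]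
  · rw [if_pos]
    rw [Int.toNat_of_nonneg h0]
    exact Int.dvd_self_sub_emod
  · intro r hr hne
    rw [if_neg]
    intro h
    apply hne
    have h2 : n % P = (r : ℤ) % P := (Int.modEq_iff_dvd.2 h).symm
    have h3 : (r : ℤ) % P = r :=
      Int.emod_eq_of_lt (by positivity) (by exact_mod_cast mem_range.1 hr)
    omega

lemma sum_dvd_sieveDiv_eq (hS : ∀ p ∈ S, p.Prime) {d : ℕ} (hd : d ∣ ∏ p ∈ S, p)
    (a : ℤ) (H : ℕ) (w : ℤ → ℝ) :
    (∑ t ∈ range H, if d ∣ sieveDiv k S s (a + t) then w (a + t) else 0) =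
      ∑ r ∈ (range (d ^ k)).filter (fun r : ℕ => d ∣ sieveDiv k S s r),
        ∑ t ∈ range H, if ((d ^ k : ℕ) : ℤ) ∣ (a - r) + t then w (a + t) else 0 := by
  have hd0 : 0 < d ^ k := pow_pos (Nat.pos_of_ne_zero
    (squarefree_of_dvd_prod_primes hS hd).ne_zero) k
  rw [sum_comm]
  refine sum_congr rfl fun t _ => ?_
  rw [sum_filter]
  have h1 := sum_class_indicator hd0 (a + t)
    fun r => if d ∣ sieveDiv k S s (a + t) then w (a + t) else 0
  rw [← h1]
  refine sum_congr rfl fun r _ => ?_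
  rw [show a - (r : ℤ) + t = a + t - r by ring]
  by_cases h : ((d ^ k : ℕ) : ℤ) ∣ a + t - r
  · simp only [h, if_true]
    simp only [dvd_sieveDiv_congr (k := k) (s := s) hS hd h]
  · simp only [if_neg h, ite_self]

lemma abs_coprime_dvd_sieveDiv_sub_le (hS : ∀ p ∈ S, p.Prime) {q : ℕ} (hq : q ≠ 0)
    (hSq : ∀ p ∈ S, ¬ p ∣ q) {d : ℕ} (hd : d ∣ ∏ p ∈ S, p) (a : ℤ) (H : ℕ) :
    |(∑ t ∈ range H, if d ∣ sieveDiv k S s (a + t) then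
        (if Int.gcd (a + t) q = 1 then (1 : ℝ) else 0) else 0) -
      rootCount k S s d / (d : ℝ) ^ k *
        ∑ t ∈ range H, if Int.gcd (a + t) q = 1 then (1 : ℝ) else 0| ≤
      2 * rootCount k S s d * 2 ^ q.primeFactors.card := by
  have hd0 : 0 < d ^ k := pow_pos (Nat.pos_of_ne_zero
    (squarefree_of_dvd_prod_primes hS hd).ne_zero) k
  have hdq : (d ^ k).Coprime q := by
    refine Nat.Coprime.pow_left _ (Nat.Coprime.coprime_dvd_left hd ?_)
    exact Nat.Coprime.prod_left fun p hp => ((hS p hp).coprime_iff_not_dvd).2 (hSq p hp)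
  rw [sum_dvd_sieveDiv_eq hS hd a H fun n => if Int.gcd n q = 1 then (1 : ℝ) else 0]
  -- Both counts are compared with the same multiple of U, which therefore never has to be
  -- evaluated; the two comparisons give the factor 2.
  set U := ∑ e ∈ (∏ p ∈ q.primeFactors, p).divisors, (μ e : ℝ) / e with hU
  set N := ∑ t ∈ range H, if Int.gcd (a + t) q = 1 then (1 : ℝ) else 0 with hN
  have h1 : ∀ r : ℕ, |(∑ t ∈ range H, if ((d ^ k : ℕ) : ℤ) ∣ (a - r) + t then
      (if Int.gcd (a + t) q = 1 then (1 : ℝ) else 0) else 0) - H / (d ^ k : ℕ) * U| ≤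
        2 ^ q.primeFactors.card := fun r => by
    have := abs_card_coprime_class_sub_le hq hd0 hdq a (a - r) H
    have e : ∀ t : ℕ, (if ((d ^ k : ℕ) : ℤ) ∣ (a - r) + t then
        (if Int.gcd (a + t) q = 1 then (1 : ℝ) else 0) else 0) = if Int.gcd (a + t) q = 1 then
        (if ((d ^ k : ℕ) : ℤ) ∣ (a - r) + t then (1 : ℝ) else 0) else 0 := fun t => by
      split_ifs <;> rfl
    simp only [e]
    exact this
  have h2 : |N - H * U| ≤ 2 ^ q.primeFactors.card := by
    have := abs_card_coprime_class_sub_le hq one_pos (Nat.coprime_one_left q) a a H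
    simp only [Nat.cast_one, one_dvd, if_true, div_one] at this
    exact this
  have h3 : |N / (d ^ k : ℕ) - H / (d ^ k : ℕ) * U| ≤ 2 ^ q.primeFactors.card := by
    rw [div_mul_eq_mul_div, ← sub_div, abs_div, Nat.abs_cast]
    have : (1 : ℝ) ≤ (d ^ k : ℕ) := by exact_mod_cast hd0
    exact (div_le_self (abs_nonneg _) this).trans h2
  have h4 : (rootCount k S s d : ℝ) / (d : ℝ) ^ k * N =
      ∑ r ∈ (range (d ^ k)).filter (fun r : ℕ => d ∣ sieveDiv k S s r), N / (d ^ k : ℕ) := by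
    rw [sum_const, nsmul_eq_mul, rootCount]
    push_cast
    ring
  rw [h4, ← sum_sub_distrib]
  refine (abs_sum_le_sum_abs _ _).trans ?_
  calc _ ≤ ∑ r ∈ (range (d ^ k)).filter (fun r : ℕ => d ∣ sieveDiv k S s r),
        ((2 : ℝ) ^ q.primeFactors.card + 2 ^ q.primeFactors.card) := by
        refine sum_le_sum fun r _ => ?_
        refine (abs_sub_le _ (H / (d ^ k : ℕ) * U) _).trans (add_le_add (h1 r) ?_)
        rw [abs_sub_comm]
        exact h3
    _ = _ := by
        rw [sum_const, nsmul_eq_mul, rootCount]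
        ring

lemma sum_dvd_sieveDiv_le (hS : ∀ p ∈ S, p.Prime) {d : ℕ} (hd : d ∣ ∏ p ∈ S, p) (a : ℤ) (H : ℕ) :
    (∑ t ∈ range H, if d ∣ sieveDiv k S s (a + t) then (1 : ℝ) else 0) ≤
      rootCount k S s d * (H / (d : ℝ) ^ k + 1) := by
  have hd0 : 0 < d ^ k := pow_pos (Nat.pos_of_ne_zero
    (squarefree_of_dvd_prod_primes hS hd).ne_zero) k
  rw [sum_dvd_sieveDiv_eq hS hd a H fun _ => 1, rootCount, ← nsmul_eq_mul]
  refine sum_le_card_nsmul _ _ _ fun r _ => ?_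
  obtain ⟨h₀, T, hT, hsum⟩ := exists_progression hd0 (a - r) H
  rw [hsum fun _ => 1, sum_const, card_range, nsmul_one]
  have := (abs_le.1 hT).2
  push_cast at this
  linarith

/-- Positivity of the integers removes the usual + 1. This matters because it is summed over all
sieving primes above y, whose number is not controlled. -/
lemma sum_dvd_le_div {P : ℕ} (hP : 0 < P) {b : ℤ} {H : ℕ} {X : ℝ} (hX : 0 ≤ X)
    (hb : ∀ t ∈ range H, 1 ≤ b + t ∧ ((b + t : ℤ) : ℝ) ≤ X) :
    (∑ t ∈ range H, if (P : ℤ) ∣ b + t then (1 : ℝ) else 0) ≤ X / P := by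
  have hP' : (0 : ℤ) < P := by exact_mod_cast hP
  have hPr : (0 : ℝ) < P := by exact_mod_cast hP
  rw [← sum_filter, sum_const, nsmul_one]
  have : ((range H).filter fun t : ℕ => (P : ℤ) ∣ b + t).card ≤ (Icc 1 ⌊X / P⌋₊).card := by
    refine card_le_card_of_injOn (fun t => ((b + t) / P).toNat) ?_ ?_
    · intro t ht
      rw [mem_coe, mem_filter] at ht
      obtain ⟨ht, c, hc⟩ := ht
      have h1 := hb t ht
      simp only [hc, Int.mul_ediv_cancel_left _ hP'.ne', coe_Icc, Set.mem_Icc]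
      have hc1 : 1 ≤ c := by
        by_contra hneg
        have : (P : ℤ) * c ≤ 0 := mul_nonpos_of_nonneg_of_nonpos hP'.le (by omega)
        omega
      refine ⟨by omega, Nat.le_floor ?_⟩
      rw [le_div_iff₀ hPr]
      have h2 := h1.2
      rw [hc] at h2
      have h3 : ((c.toNat : ℕ) : ℝ) = (c : ℝ) := by
        have : ((c.toNat : ℕ) : ℤ) = c := Int.toNat_of_nonneg (by omega)
        exact_mod_cast this
      rw [h3]
      push_cast at h2
      linarith
    · intro t ht t' ht' htt
      rw [mem_coe, mem_filter] at ht ht'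
      obtain ⟨ht, c, hc⟩ := ht
      obtain ⟨ht', c', hc'⟩ := ht'
      have h1 := hb t ht
      have h1' := hb t' ht'
      simp only [hc, hc', Int.mul_ediv_cancel_left _ hP'.ne'] at htt
      have hc1 : 1 ≤ c := by
        by_contra hneg
        have : (P : ℤ) * c ≤ 0 := mul_nonpos_of_nonneg_of_nonpos hP'.le (by omega)
        omega
      have hc1' : 1 ≤ c' := by
        by_contra hneg
        have : (P : ℤ) * c' ≤ 0 := mul_nonpos_of_nonneg_of_nonpos hP'.le (by omega)
        omega
      have : c = c' := by omega
      subst this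
      omega
  rw [Nat.card_Icc, add_tsub_cancel_right] at this
  calc _ ≤ ((⌊X / P⌋₊ : ℕ) : ℝ) := by exact_mod_cast this
    _ ≤ _ := Nat.floor_le (by positivity)

lemma pow_div_le (hk : 2 ≤ k) {y x : ℝ} (hy : 1 ≤ y) (hx : y < x) :
    y ^ (k + 1) / x ^ k ≤ y ^ 3 * (x ^ 2)⁻¹ := by
  have hx0 : 0 < x := by linarith
  have h1 : (y / x) ^ k ≤ (y / x) ^ 2 :=
    pow_le_pow_of_le_one (by positivity) ((div_le_one hx0).2 hx.le) hk
  calc y ^ (k + 1) / x ^ k = y * (y / x) ^ k := by rw [div_pow]; ring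
    _ ≤ y * (y / x) ^ 2 := by gcongr
    _ = _ := by rw [div_pow]; ring

lemma sum_pow_div_le (hk : 2 ≤ k) {y : ℝ} (hy : 1 ≤ y) (T : Finset ℕ)
    (hT : ∀ n ∈ T, y < n) : ∑ n ∈ T, y ^ (k + 1) / (n : ℝ) ^ k ≤ 2 * y ^ 2 := by
  calc _ ≤ ∑ n ∈ T, y ^ 3 * ((n : ℝ) ^ 2)⁻¹ := by
        refine sum_le_sum fun n hn => pow_div_le hk hy (hT n hn)
    _ ≤ y ^ 3 * (2 / y) := by
        rw [← mul_sum]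
        gcongr
        exact sum_inv_sq_le (by positivity) T hT
    _ = _ := by field_simp

/-- Take the least divisor D > y. If D > y ^ 2, write D = p m with p prime; minimality forces m ≤ y,
hence p > y. -/
lemma sieveDiv_dichotomy (hS : ∀ p ∈ S, p.Prime) {y : ℝ} (hy : 1 ≤ y) {n : ℤ}
    (h : y ^ 2 < sieveDiv k S s n) :
    (∃ D ∈ (∏ p ∈ S, p).divisors.filter (fun D : ℕ => y < D ∧ (D : ℝ) ≤ y ^ 2),
      D ∣ sieveDiv k S s n) ∨
    ∃ p ∈ S.filter (fun p : ℕ => y < p), ∃ i, (p : ℤ) ^ k ∣ n + s i := by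
  have hex : ∃ D : ℕ, D ∣ sieveDiv k S s n ∧ y < D := ⟨_, dvd_rfl, by nlinarith⟩
  classical
  obtain ⟨hD, hyD⟩ := Nat.find_spec hex
  have hmin := fun m => Nat.find_min hex (m := m)
  set D := Nat.find hex with hDdef
  have h0 : (∏ p ∈ S, p) ≠ 0 := (squarefree_prod_primes hS).ne_zero
  by_cases hDy : (D : ℝ) ≤ y ^ 2
  · left
    exact ⟨D, mem_filter.2 ⟨Nat.mem_divisors.2 ⟨hD.trans (sieveDiv_dvd n), h0⟩, hyD, hDy⟩, hD⟩
  · right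
    have hD1 : D ≠ 1 := by
      intro h1
      rw [h1, Nat.cast_one] at hyD
      linarith
    obtain ⟨p, hp, m, hm⟩ := Nat.exists_prime_and_dvd hD1
    have hDpos : 0 < D := by
      have : (0 : ℝ) < D := by linarith
      exact_mod_cast this
    have hm0 : 0 < m := by
      rcases Nat.eq_zero_or_pos m with rfl | h
      · omega
      · exact h
    have hmD : m < D := by
      rw [hm]
      exact lt_mul_of_one_lt_left hm0 hp.one_lt
    have hmy : (m : ℝ) ≤ y := by
      by_contra hlt
      exact hmin m hmD ⟨(Dvd.intro_left p hm.symm).trans hD, not_le.1 hlt⟩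
    have hpy : y < p := by
      by_contra hle
      apply hDy
      rw [hm, Nat.cast_mul, sq]
      exact mul_le_mul (not_lt.1 hle) hmy (by positivity) (by positivity)
    have hpS := (prime_dvd_sieveDiv hS hp).1 ((Dvd.intro m hm.symm).trans hD)
    exact ⟨p, mem_filter.2 ⟨hpS.1, hpy⟩, hpS.2⟩

lemma length_le_of_shift_le {b : ℤ} {H : ℕ} {X : ℝ} (hX : 0 ≤ X)
    (hb : ∀ t ∈ range H, 1 ≤ b + t ∧ ((b + t : ℤ) : ℝ) ≤ X) : (H : ℝ) ≤ X := by
  rcases Nat.eq_zero_or_pos H with rfl | hH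
  · simpa using hX
  have h0 := (hb 0 (mem_range.2 hH)).1
  have h1 := (hb (H - 1) (mem_range.2 (by omega))).2
  have h2 : (H : ℤ) ≤ b + (H - 1 : ℕ) := by
    push_cast at h0
    omega
  have h3 : ((H : ℤ) : ℝ) ≤ ((b + (H - 1 : ℕ) : ℤ) : ℝ) := by exact_mod_cast h2
  rw [Int.cast_natCast] at h3
  exact h3.trans h1

/-- The product divides that of the shifted values, so it is polynomially bounded and has only O(X ^
ε) divisors. -/
lemma sieveDiv_le [Fintype ι] [Nonempty ι] (hk : k ≠ 0) (hS : ∀ p ∈ S, p.Prime) {n : ℤ} {X : ℝ}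
    (hn : ∀ i, 1 ≤ n + s i ∧ ((n + s i : ℤ) : ℝ) ≤ X) :
    (sieveDiv k S s n : ℝ) ≤ X ^ Fintype.card ι := by
  have hdvd : sieveDiv k S s n ∣ ∏ i, (n + s i).natAbs := by
    rw [← Nat.prod_primeFactors_of_squarefree (squarefree_sieveDiv hS n)]
    refine prod_primes_dvd _ (fun p hp => (Nat.prime_of_mem_primeFactors hp).prime) fun p hp => ?_
    obtain ⟨i, hi⟩ := ((prime_dvd_sieveDiv hS (Nat.prime_of_mem_primeFactors hp)).1
      (Nat.dvd_of_mem_primeFactors hp)).2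
    refine dvd_trans ?_ (dvd_prod_of_mem _ (mem_univ i))
    rw [← Int.natCast_dvd]
    exact (dvd_pow_self _ hk).trans hi
  have hpos : 0 < ∏ i, (n + s i).natAbs := prod_pos fun i _ => by
    have := (hn i).1
    omega
  calc (sieveDiv k S s n : ℝ) ≤ ((∏ i, (n + s i).natAbs : ℕ) : ℝ) := by
        exact_mod_cast Nat.le_of_dvd hpos hdvd
    _ = ∏ i, (((n + s i).natAbs : ℕ) : ℝ) := by push_cast; rfl
    _ ≤ ∏ i : ι, X := by
        refine prod_le_prod (fun _ _ => by positivity) fun i _ => ?_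
        have h1 := hn i
        have h2 : (((n + s i).natAbs : ℕ) : ℤ) = n + s i := Int.natAbs_of_nonneg (by omega)
        have h3 : (((n + s i).natAbs : ℕ) : ℝ) = ((n + s i : ℤ) : ℝ) :=
          (Int.cast_natCast _).symm.trans (congrArg Int.cast h2)
        rw [h3]
        exact h1.2
    _ = _ := by simp

lemma card_le_of_forall_le {T : Finset ℕ} {z : ℝ} (hz : 0 ≤ z)
    (hT : ∀ d ∈ T, 0 < d ∧ (d : ℝ) ≤ z) : (T.card : ℝ) ≤ z := by
  calc (T.card : ℝ) ≤ ((Icc 1 ⌊z⌋₊).card : ℝ) := by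
        have : T ⊆ Icc 1 ⌊z⌋₊ := fun d hd => by
          have := hT d hd
          exact mem_Icc.2 ⟨this.1, Nat.le_floor this.2⟩
        exact_mod_cast card_le_card this
    _ = (⌊z⌋₊ : ℝ) := by simp
    _ ≤ z := Nat.floor_le hz

/-- The number of integers in an interval with a large `sieveDiv`. -/
lemma sum_large_sieveDiv_le [Fintype ι] [Nonempty ι] (hk : 2 ≤ k) (hS : ∀ p ∈ S, p.Prime)
    {y : ℝ} (hy : 1 ≤ y) {a : ℤ} {H : ℕ} {N : ℝ} (hN : 0 ≤ N)
    (hroot : ∀ d ∈ (∏ p ∈ S, p).divisors, (d : ℝ) ≤ y ^ 2 → (rootCount k S s d : ℝ) ≤ N)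
    (ha : ∀ t ∈ range H, ∀ i, 1 ≤ a + t + s i ∧ ((a + t + s i : ℤ) : ℝ) ≤ y ^ (k + 1)) :
    (∑ t ∈ range H, if y ^ 2 < sieveDiv k S s (a + t) then (1 : ℝ) else 0) ≤
      (3 * N + 2 * Fintype.card ι) * y ^ 2 := by
  have hX : 0 ≤ y ^ (k + 1) := by positivity
  obtain ⟨i₀⟩ := ‹Nonempty ι›
  have ha' : ∀ i, ∀ t ∈ range H, 1 ≤ (a + s i) + t ∧ (((a + s i) + t : ℤ) : ℝ) ≤ y ^ (k + 1) :=
    fun i t ht => by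
      rw [add_right_comm]
      exact ha t ht i
  have hHX := length_le_of_shift_le hX (ha' i₀)
  set A := (∏ p ∈ S, p).divisors.filter (fun D : ℕ => y < D ∧ (D : ℝ) ≤ y ^ 2) with hA
  set B := S.filter (fun p : ℕ => y < p) with hB
  have hpoint : ∀ n : ℤ, (if y ^ 2 < sieveDiv k S s n then (1 : ℝ) else 0) ≤
      (∑ D ∈ A, if D ∣ sieveDiv k S s n then (1 : ℝ) else 0) +
      ∑ p ∈ B, ∑ i, if ((p ^ k : ℕ) : ℤ) ∣ n + s i then (1 : ℝ) else 0 := by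
    intro n
    have e1 : 0 ≤ ∑ D ∈ A, if D ∣ sieveDiv k S s n then (1 : ℝ) else 0 :=
      sum_nonneg fun _ _ => by split_ifs <;> norm_num
    have e2 : 0 ≤ ∑ p ∈ B, ∑ i, if ((p ^ k : ℕ) : ℤ) ∣ n + s i then (1 : ℝ) else 0 :=
      sum_nonneg fun _ _ => sum_nonneg fun _ _ => by split_ifs <;> norm_num
    split_ifs with h
    · rcases sieveDiv_dichotomy hS hy h with ⟨D, hD, hDn⟩ | ⟨p, hp, i, hi⟩
      · have := single_le_sum (f := fun D : ℕ => if D ∣ sieveDiv k S s n then (1 : ℝ) else 0)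
          (fun _ _ => by positivity) hD
        simp only [if_pos hDn] at this
        linarith
      · have hi' : ((p ^ k : ℕ) : ℤ) ∣ n + s i := by exact_mod_cast hi
        have h1 := single_le_sum (s := univ)
          (f := fun i => if ((p ^ k : ℕ) : ℤ) ∣ n + s i then (1 : ℝ) else 0)
          (fun _ _ => by positivity) (mem_univ i)
        have h2 := single_le_sum (f := fun p : ℕ => ∑ i, if ((p ^ k : ℕ) : ℤ) ∣ n + s i then
          (1 : ℝ) else 0) (fun _ _ => by positivity) hp
        simp only [if_pos hi'] at h1
        linarith
    · linarith
  -- At most y ^ 2 values of D occur, so the terms + 1 cost y ^ 2; the rest is of order y ^ (k + 1)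
  -- y ^ (1 - k) = y ^ 2.
  have hfirst : ∑ D ∈ A, ∑ t ∈ range H, (if D ∣ sieveDiv k S s (a + t) then (1 : ℝ) else 0) ≤
      3 * N * y ^ 2 := by
    have hcardA : (A.card : ℝ) ≤ y ^ 2 := card_le_of_forall_le (by positivity) fun d hd => by
      rw [hA, mem_filter] at hd
      exact ⟨Nat.pos_of_mem_divisors hd.1, hd.2.2⟩
    have hsumA := sum_pow_div_le hk hy A fun n hn => ((mem_filter.1 hn).2).1
    calc _ ≤ ∑ D ∈ A, N * (y ^ (k + 1) / (D : ℝ) ^ k + 1) := by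
          refine sum_le_sum fun D hD => ?_
          rw [hA, mem_filter] at hD
          refine (sum_dvd_sieveDiv_le hS (Nat.dvd_of_mem_divisors hD.1) a H).trans ?_
          have := hroot D hD.1 hD.2.2
          gcongr
      _ = N * (∑ D ∈ A, y ^ (k + 1) / (D : ℝ) ^ k + A.card) := by
          rw [← mul_sum, sum_add_distrib, sum_const, nsmul_one]
      _ ≤ N * (2 * y ^ 2 + y ^ 2) := by gcongr
      _ = _ := by ring
  have hsecond : ∑ p ∈ B, ∑ i, ∑ t ∈ range H,
      (if ((p ^ k : ℕ) : ℤ) ∣ a + t + s i then (1 : ℝ) else 0) ≤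
        2 * Fintype.card ι * y ^ 2 := by
    have hsumB := sum_pow_div_le hk hy B fun n hn => (mem_filter.1 hn).2
    calc _ ≤ ∑ p ∈ B, ∑ i : ι, y ^ (k + 1) / (p : ℝ) ^ k := by
          refine sum_le_sum fun p hp => sum_le_sum fun i _ => ?_
          have hpp := hS p (mem_filter.1 hp).1
          have := sum_dvd_le_div (pow_pos hpp.pos k) hX (ha' i)
          simp only [add_right_comm a (s i), Nat.cast_pow] at this ⊢
          exact this
      _ = Fintype.card ι * ∑ p ∈ B, y ^ (k + 1) / (p : ℝ) ^ k := by
          simp only [sum_const, card_univ, nsmul_eq_mul]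
          rw [mul_sum]
      _ ≤ Fintype.card ι * (2 * y ^ 2) := by gcongr
      _ = _ := by ring
  calc _ ≤ ∑ t ∈ range H, ((∑ D ∈ A, if D ∣ sieveDiv k S s (a + t) then (1 : ℝ) else 0) +
        ∑ p ∈ B, ∑ i, if ((p ^ k : ℕ) : ℤ) ∣ a + t + s i then (1 : ℝ) else 0) :=
        sum_le_sum fun t _ => hpoint _
    _ = ∑ D ∈ A, ∑ t ∈ range H, (if D ∣ sieveDiv k S s (a + t) then (1 : ℝ) else 0) +
        ∑ p ∈ B, ∑ i, ∑ t ∈ range H,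
          (if ((p ^ k : ℕ) : ℤ) ∣ a + t + s i then (1 : ℝ) else 0) := by
        rw [sum_add_distrib, sum_comm]
        congr 1
        rw [sum_comm]
        exact sum_congr rfl fun p _ => sum_comm
    _ ≤ _ := by linarith

/-- The mean value of a product of shifts of the sieve over the integers coprime to `q` in an
interval, with an error term uniform in the shifts, the sieve and `q`. -/
theorem exists_correlation_le (ι : Type*) [Fintype ι] [Nonempty ι] {k : ℕ} (hk : 2 ≤ k) {ε : ℝ}
    (hε : 0 < ε) : ∃ C : ℝ, 0 ≤ C ∧ ∀ (y : ℝ) (q : ℕ) (S : Finset ℕ) (s : ι → ℤ) (a : ℤ) (H : ℕ),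
      1 ≤ y → q ≠ 0 → (q : ℝ) ≤ y ^ (k + 1) → (∀ p ∈ S, p.Prime) → (∀ p ∈ S, ¬ p ∣ q) →
      (∀ t ∈ range H, ∀ i, 1 ≤ a + t + s i ∧ ((a + t + s i : ℤ) : ℝ) ≤ y ^ (k + 1)) →
      |∑ t ∈ range H, (if Int.gcd (a + t) q = 1 then ∏ i, sieveInd k S (a + t + s i) -
        cyclicAvg (sieveMod k S) (fun x => ∏ i, sieveInd k S (x + s i)) else 0)| ≤
          C * y ^ 2 * (y ^ (k + 1)) ^ ε := by
  set j := Fintype.card ι with hj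
  have hj1 : 1 ≤ j := Fintype.card_pos
  -- The largest power of W = X ^ ε' that occurs is W ^ (j + 1); the bounds use up at most W ^ (j +
  -- 2) = X ^ ε.
  set ε' := ε / (j + 2) with hε'
  have hε'0 : 0 < ε' := by positivity
  obtain ⟨C₁, hC₁, h₁⟩ := exists_pow_card_primeFactors_le 2 (by norm_num) hε'0
  obtain ⟨C₂, hC₂, h₂⟩ := exists_pow_card_primeFactors_le j hj1 hε'0
  obtain ⟨C₃, hC₃, h₃⟩ := exists_pow_card_primeFactors_le j hj1 (ε := 1 / 4) (by norm_num)
  have hsum : Summable fun n : ℕ => (n : ℝ) ^ (-(5 / 4) : ℝ) :=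
    Real.summable_nat_rpow.2 (by norm_num)
  set Z := ∑' n : ℕ, (n : ℝ) ^ (-(5 / 4) : ℝ) with hZ
  have hZ0 : 0 ≤ Z := tsum_nonneg fun n => by positivity
  refine ⟨2 * C₁ * C₂ + C₁ * (3 * C₂ + 2 * j) + C₃ * Z, by positivity, ?_⟩
  intro y q S s a H hy hq hqX hS hSq ha
  set X := y ^ (k + 1) with hX
  have hX1 : 1 ≤ X := one_le_pow₀ hy
  have hyX : y ^ 2 ≤ X := pow_le_pow_right₀ hy (by omega)
  set W := X ^ ε' with hW
  have hW1 : 1 ≤ W := Real.one_le_rpow hX1 hε'0.le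
  have hWε : W ^ (j + 2) = X ^ ε := by
    rw [hW, ← Real.rpow_natCast, ← Real.rpow_mul (by positivity), hε']
    congr 1
    push_cast
    field_simp
  have hHX : (H : ℝ) ≤ X := by
    obtain ⟨i₀⟩ := ‹Nonempty ι›
    refine length_le_of_shift_le (b := a + s i₀) (by positivity) fun t ht => ?_
    rw [add_right_comm]
    exact ha t ht i₀
  set Pr := ∏ p ∈ S, p with hPr
  have hPr0 : Pr ≠ 0 := (squarefree_prod_primes hS).ne_zero
  set ν : ℕ → ℝ := fun d => rootCount k S s d with hν
  have hν0 : ∀ d, 0 ≤ ν d := fun d => Nat.cast_nonneg _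
  have hνj : ∀ d ∈ Pr.divisors, ν d ≤ (j : ℝ) ^ d.primeFactors.card := fun d hd => by
    have := rootCount_le (k := k) (s := s) hS (Nat.dvd_of_mem_divisors hd)
    simp only [hν]
    exact_mod_cast this
  have hνW : ∀ d ∈ Pr.divisors, (d : ℝ) ≤ y ^ 2 → ν d ≤ C₂ * W := fun d hd hdy => by
    refine (hνj d hd).trans ((h₂ d (Nat.pos_of_mem_divisors hd).ne').trans ?_)
    rw [hW]
    gcongr
    exact hdy.trans hyX
  set Nq := ∑ t ∈ range H, if Int.gcd (a + t) q = 1 then (1 : ℝ) else 0 with hNq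
  have hNq0 : 0 ≤ Nq := sum_nonneg fun _ _ => by split_ifs <;> norm_num
  have hNqX : Nq ≤ X := by
    refine le_trans ?_ hHX
    calc Nq ≤ ∑ t ∈ range H, (1 : ℝ) := sum_le_sum fun _ _ => by split_ifs <;> norm_num
      _ = H := by simp
  set Bd : ℕ → ℝ := fun d => ∑ t ∈ range H, if d ∣ sieveDiv k S s (a + t) then
    (if Int.gcd (a + t) q = 1 then (1 : ℝ) else 0) else 0 with hBd
  have hBd0 : ∀ d, 0 ≤ Bd d := fun d => sum_nonneg fun _ _ => by split_ifs <;> norm_num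
  have hexp : ∑ t ∈ range H, (if Int.gcd (a + t) q = 1 then ∏ i, sieveInd k S (a + t + s i) -
        cyclicAvg (sieveMod k S) (fun x => ∏ i, sieveInd k S (x + s i)) else 0) =
      ∑ d ∈ Pr.divisors, (μ d : ℝ) * (Bd d - ν d / (d : ℝ) ^ k * Nq) := by
    have havg : cyclicAvg (sieveMod k S) (fun x => ∏ i, sieveInd k S (x + s i)) =
        ∑ d ∈ Pr.divisors, (μ d : ℝ) * (ν d / (d : ℝ) ^ k) := by
      simp only [prod_sieveInd_eq_sum hS]
      rw [cyclicAvg_sum]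
      refine sum_congr rfl fun d hd => ?_
      rw [cyclicAvg_const_mul, cyclicAvg_dvd_sieveDiv hS (Nat.dvd_of_mem_divisors hd)]
    rw [havg]
    simp only [prod_sieveInd_eq_sum hS, ← sum_sub_distrib, hBd, hNq, mul_sum]
    rw [sum_comm]
    refine sum_congr rfl fun t _ => ?_
    by_cases hg : Int.gcd (a + t) q = 1
    · simp only [if_pos hg, mul_one, hPr]
      rw [← sum_sub_distrib]
      exact sum_congr rfl fun d _ => (mul_sub _ _ _).symm
    · simp only [if_neg hg, mul_zero, ite_self, sub_self, sum_const_zero]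
  set lo := Pr.divisors.filter (fun d : ℕ => (d : ℝ) ≤ y ^ 2) with hlo
  set hi := Pr.divisors.filter (fun d : ℕ => ¬ (d : ℝ) ≤ y ^ 2) with hhi
  have hsmall : ∑ d ∈ lo, |Bd d - ν d / (d : ℝ) ^ k * Nq| ≤
      2 * C₁ * C₂ * y ^ 2 * W ^ 2 := by
    have hcard : (lo.card : ℝ) ≤ y ^ 2 :=
      card_le_of_forall_le (by positivity) fun d hd =>
        ⟨Nat.pos_of_mem_divisors (mem_filter.1 hd).1, (mem_filter.1 hd).2⟩
    have hqW : (2 : ℝ) ^ q.primeFactors.card ≤ C₁ * W := by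
      refine le_trans (by exact_mod_cast h₁ q hq) ?_
      rw [hW]
      gcongr
    calc _ ≤ ∑ d ∈ lo, 2 * (C₂ * W) * (C₁ * W) := by
          refine sum_le_sum fun d hd => ?_
          rw [mem_filter] at hd
          refine (abs_coprime_dvd_sieveDiv_sub_le hS hq hSq
            (Nat.dvd_of_mem_divisors hd.1) a H).trans ?_
          have := hνW d hd.1 hd.2
          gcongr
      _ ≤ y ^ 2 * (2 * (C₂ * W) * (C₁ * W)) := by
          rw [sum_const, nsmul_eq_mul]
          gcongr
      _ = _ := by ring
  -- A divisor d > y ^ 2 forces `sieveDiv` above y ^ 2. Such integers are few, and each carries O(W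
  -- ^ j) divisors.
  have hBlarge : ∑ d ∈ hi, Bd d ≤
      C₁ * (3 * C₂ + 2 * j) * y ^ 2 * W ^ (j + 1) := by
    have hpoint : ∀ t ∈ range H, ∑ d ∈ hi,
        (if d ∣ sieveDiv k S s (a + t) then
          (if Int.gcd (a + t) q = 1 then (1 : ℝ) else 0) else 0) ≤
        C₁ * W ^ j * if y ^ 2 < sieveDiv k S s (a + t) then (1 : ℝ) else 0 := by
      intro t ht
      set m := sieveDiv k S s (a + t) with hm
      have hm0 : m ≠ 0 := (squarefree_sieveDiv hS _).ne_zero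
      by_cases hlt : y ^ 2 < (m : ℝ)
      · rw [if_pos hlt]
        calc _ ≤ ∑ d ∈ hi, (if d ∣ m then (1 : ℝ) else 0) :=
              sum_le_sum fun d _ => by split_ifs <;> norm_num
          _ ≤ ((m.divisors).card : ℝ) := by
              rw [← sum_filter, sum_const, nsmul_one]
              have : hi.filter (· ∣ m) ⊆
                  m.divisors := fun d hd => Nat.mem_divisors.2 ⟨(mem_filter.1 hd).2, hm0⟩
              exact_mod_cast card_le_card this
          _ = (2 : ℝ) ^ m.primeFactors.card := by
              rw [card_divisors_of_squarefree (squarefree_sieveDiv hS _)]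
              push_cast
              rfl
          _ ≤ C₁ * (m : ℝ) ^ ε' := by exact_mod_cast h₁ m hm0
          _ ≤ C₁ * (X ^ j) ^ ε' := by
              gcongr
              exact sieveDiv_le (by omega) hS (ha t ht)
          _ = C₁ * W ^ j * 1 := by
              rw [mul_one, hW, ← Real.rpow_natCast, ← Real.rpow_mul (by positivity),
                ← Real.rpow_natCast, ← Real.rpow_mul (by positivity), mul_comm ε']
      · rw [if_neg hlt, mul_zero]
        refine sum_nonpos fun d hd => ?_
        rw [if_neg]
        intro hdm
        apply (mem_filter.1 hd).2
        have h1 : (d : ℝ) ≤ m := by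
          exact_mod_cast Nat.le_of_dvd (Nat.pos_of_ne_zero hm0) hdm
        exact h1.trans (not_lt.1 hlt)
    have hlarge := sum_large_sieveDiv_le (s := s) hk hS hy (N := C₂ * W) (by positivity) hνW ha
    simp only [hBd]
    rw [sum_comm]
    refine (sum_le_sum hpoint).trans ?_
    rw [← mul_sum]
    calc _ ≤ C₁ * W ^ j * ((3 * (C₂ * W) + 2 * j) * y ^ 2) := by gcongr
      _ ≤ C₁ * W ^ j * ((3 * (C₂ * W) + 2 * (j * W)) * y ^ 2) := by
          have : (j : ℝ) ≤ j * W := le_mul_of_one_le_right (by positivity) hW1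
          gcongr
      _ = _ := by ring
  -- Combine ν d ≪ d ^ (1 / 4), X / d ^ k ≤ y ^ 3 / d ^ 2 and y ≤ d ^ (1 / 2): each term is O(y ^ 2
  -- d ^ (-5 / 4)), which is summable.
  have hνlarge : ∑ d ∈ hi, ν d / (d : ℝ) ^ k * Nq ≤
      C₃ * Z * y ^ 2 := by
    calc _ ≤ ∑ d ∈ hi,
          C₃ * y ^ 2 * (d : ℝ) ^ (-(5 / 4) : ℝ) := by
          refine sum_le_sum fun d hd => ?_
          rw [mem_filter, not_le] at hd
          have hy0 : 0 < y := by linarith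
          have hd0 : 0 < (d : ℝ) := by nlinarith
          have hyd : y < d := by nlinarith
          have e1 : ν d ≤ C₃ * (d : ℝ) ^ (1 / 4 : ℝ) :=
            (hνj d hd.1).trans (h₃ d (Nat.pos_of_mem_divisors hd.1).ne')
          have e2 : X / (d : ℝ) ^ k ≤ y ^ 3 * ((d : ℝ) ^ 2)⁻¹ := pow_div_le hk hy hyd
          have e3 : y ≤ (d : ℝ) ^ (1 / 2 : ℝ) := by
            rw [← Real.sqrt_eq_rpow]
            exact Real.le_sqrt_of_sq_le hd.2.le
          have e4 : (d : ℝ) ^ (1 / 4 : ℝ) * (d : ℝ) ^ (1 / 2 : ℝ) * ((d : ℝ) ^ 2)⁻¹ =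
              (d : ℝ) ^ (-(5 / 4) : ℝ) := by
            rw [← Real.rpow_natCast, ← Real.rpow_neg hd0.le, ← Real.rpow_add hd0,
              ← Real.rpow_add hd0]
            norm_num
          calc ν d / (d : ℝ) ^ k * Nq ≤ ν d / (d : ℝ) ^ k * X := by
                have := hν0 d
                gcongr
            _ = ν d * (X / (d : ℝ) ^ k) := by ring
            _ ≤ (C₃ * (d : ℝ) ^ (1 / 4 : ℝ)) * (y ^ 3 * ((d : ℝ) ^ 2)⁻¹) := by gcongr
            _ = C₃ * y ^ 2 * ((d : ℝ) ^ (1 / 4 : ℝ) * y * ((d : ℝ) ^ 2)⁻¹) := by ring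
            _ ≤ C₃ * y ^ 2 * ((d : ℝ) ^ (1 / 4 : ℝ) * (d : ℝ) ^ (1 / 2 : ℝ) *
                ((d : ℝ) ^ 2)⁻¹) := by gcongr
            _ = _ := by rw [e4]
      _ ≤ C₃ * y ^ 2 * Z := by
          rw [← mul_sum]
          gcongr
          exact hsum.sum_le_tsum _ fun _ _ => by positivity
      _ = _ := by ring
  rw [hexp]
  refine (abs_sum_le_sum_abs _ _).trans ?_
  have habs : ∀ d, |(μ d : ℝ) * (Bd d - ν d / (d : ℝ) ^ k * Nq)| ≤
      |Bd d - ν d / (d : ℝ) ^ k * Nq| := fun d => by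
    rw [abs_mul]
    exact mul_le_of_le_one_left (abs_nonneg _) (abs_moebius_cast_le_one d)
  refine (sum_le_sum fun d _ => habs d).trans ?_
  rw [← sum_filter_add_sum_filter_not _ (fun d : ℕ => (d : ℝ) ≤ y ^ 2)]
  have hlarge : ∑ d ∈ hi, |Bd d - ν d / (d : ℝ) ^ k * Nq| ≤
      ∑ d ∈ hi, Bd d +
      ∑ d ∈ hi, ν d / (d : ℝ) ^ k * Nq := by
    rw [← sum_add_distrib]
    refine sum_le_sum fun d _ => ?_
    have e1 := hBd0 d
    have e2 : 0 ≤ ν d / (d : ℝ) ^ k * Nq := by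
      have := hν0 d
      positivity
    rw [abs_le]
    constructor <;> linarith
  have hWa : W ^ 2 ≤ W ^ (j + 2) := pow_le_pow_right₀ hW1 (by omega)
  have hWb : W ^ (j + 1) ≤ W ^ (j + 2) := pow_le_pow_right₀ hW1 (by omega)
  have hWc : 1 ≤ W ^ (j + 2) := one_le_pow₀ hW1
  rw [← hWε]
  calc _ ≤ 2 * C₁ * C₂ * y ^ 2 * W ^ 2 + (C₁ * (3 * C₂ + 2 * j) * y ^ 2 * W ^ (j + 1) +
        C₃ * Z * y ^ 2 * 1) := by
        rw [mul_one]
        exact add_le_add hsmall (hlarge.trans (add_le_add hBlarge hνlarge))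
    _ ≤ 2 * C₁ * C₂ * y ^ 2 * W ^ (j + 2) + (C₁ * (3 * C₂ + 2 * j) * y ^ 2 * W ^ (j + 2) +
        C₃ * Z * y ^ 2 * W ^ (j + 2)) := by gcongr
    _ = _ := by ring

end Correlation

/-! ### Reduction of the error term to a finite sieve. -/

/-- The product of `1 - p ^ (-k)` over the primes not dividing `q`. -/
noncomputable def coprimeDens (k q : ℕ) : ℝ :=
  ∏' p : {p : ℕ // p.Prime ∧ ¬ p ∣ q}, (1 - 1 / ((p : ℕ) : ℝ) ^ k)

/-- The primes up to `Y` not dividing `q`. -/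
def coprimePrimes (q Y : ℕ) : Finset ℕ :=
  (range (Y + 1)).filter fun p => p.Prime ∧ ¬ p ∣ q

lemma mem_coprimePrimes {q Y p : ℕ} :
    p ∈ coprimePrimes q Y ↔ p ≤ Y ∧ p.Prime ∧ ¬ p ∣ q := by
  rw [coprimePrimes, mem_filter, mem_range, Nat.lt_succ_iff]

lemma one_sub_sum_le_prod {α : Type*} (s : Finset α) (f : α → ℝ)
    (h : ∀ i ∈ s, 0 ≤ f i ∧ f i ≤ 1) : 1 - ∑ i ∈ s, f i ≤ ∏ i ∈ s, (1 - f i) := by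
  classical
  induction s using Finset.induction_on with
  | empty => simp
  | insert a s ha ih =>
    rw [sum_insert ha, prod_insert ha]
    have h1 := ih fun i hi => h i (mem_insert_of_mem hi)
    have h2 := h a (mem_insert_self a s)
    have h3 : 0 ≤ ∑ i ∈ s, f i := sum_nonneg fun i hi => (h i (mem_insert_of_mem hi)).1
    nlinarith [mul_le_mul_of_nonneg_left h1 (sub_nonneg.2 h2.2), mul_nonneg h2.1 h3]

lemma tendsto_sieveDens {k : ℕ} (hk : 2 ≤ k) (q : ℕ) :
    Filter.Tendsto (fun s : Finset {p : ℕ // p.Prime ∧ ¬ p ∣ q} =>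
      sieveDens k (s.map (Function.Embedding.subtype _))) Filter.atTop
        (nhds (coprimeDens k q)) := by
  have hsum : Summable fun p : {p : ℕ // p.Prime ∧ ¬ p ∣ q} => -(1 / ((p : ℕ) : ℝ) ^ k) :=
    ((Real.summable_one_div_nat_pow.2 (by omega)).comp_injective
      Subtype.val_injective).neg
  have := (Real.multipliable_one_add_of_summable hsum).hasProd
  unfold HasProd at this
  simp only [SummationFilter.unconditional_filter] at this
  simpa only [sieveDens, prod_map, coprimeDens, ← sub_eq_add_neg,
    Function.Embedding.subtype_apply] using this

/-- The primes above X change the product by a factor between 1 - ∑ p ^ (-k) and 1. An error 2 / X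
is small enough, since it will be multiplied by X / q. -/
lemma coprimeDens_mem {k : ℕ} (hk : 2 ≤ k) {X : ℝ} (hX : 1 ≤ X) (q : ℕ) :
    0 ≤ coprimeDens k q ∧ coprimeDens k q ≤ 1 ∧
      |sieveDens k (coprimePrimes q ⌊X⌋₊) - coprimeDens k q| ≤ 2 / X := by
  classical
  have ht := tendsto_sieveDens hk q
  set S := coprimePrimes q ⌊X⌋₊ with hS
  have hSp : ∀ p ∈ S, p.Prime := fun p hp => (mem_coprimePrimes.1 hp).2.1
  have hpr : ∀ s : Finset {p : ℕ // p.Prime ∧ ¬ p ∣ q},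
      ∀ p ∈ s.map (Function.Embedding.subtype _), p.Prime ∧ ¬ p ∣ q := fun s p hp => by
    obtain ⟨x, _, rfl⟩ := mem_map.1 hp
    exact x.2
  refine ⟨ge_of_tendsto' ht fun s => sieveDens_nonneg k fun p hp => (hpr s p hp).1,
    le_of_tendsto' ht fun s => sieveDens_le_one k fun p hp => (hpr s p hp).1, ?_⟩
  have hA0 := sieveDens_nonneg k hSp
  have hA1 := sieveDens_le_one k hSp
  have hev : ∀ᶠ s : Finset {p : ℕ // p.Prime ∧ ¬ p ∣ q} in Filter.atTop,
      sieveDens k S - 2 / X ≤ sieveDens k (s.map (Function.Embedding.subtype _)) ∧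
        sieveDens k (s.map (Function.Embedding.subtype _)) ≤ sieveDens k S := by
    filter_upwards [Filter.eventually_ge_atTop (S.subtype fun p => p.Prime ∧ ¬ p ∣ q)] with s hs
    set U := s.map (Function.Embedding.subtype fun p : ℕ => p.Prime ∧ ¬ p ∣ q) with hU
    have hSU : S ⊆ U := by
      intro p hp
      have hp' := (mem_coprimePrimes.1 hp).2
      exact mem_map.2 ⟨⟨p, hp'⟩, hs (mem_subtype.2 hp), rfl⟩
    have hUp : ∀ p ∈ U \ S, p.Prime := fun p hp => (hpr s p (mem_sdiff.1 hp).1).1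
    have hsplit : sieveDens k U = sieveDens k (U \ S) * sieveDens k S := by
      rw [sieveDens, ← prod_sdiff hSU]
      rfl
    have hlow : 1 - 2 / X ≤ sieveDens k (U \ S) := by
      have h1 : ∑ p ∈ U \ S, 1 / (p : ℝ) ^ k ≤ 2 / X := by
        calc _ ≤ ∑ p ∈ U \ S, ((p : ℝ) ^ 2)⁻¹ := by
              refine sum_le_sum fun p hp => ?_
              have hp1 : (1 : ℝ) ≤ p := by exact_mod_cast (hUp p hp).one_lt.le
              rw [one_div]
              have : (p : ℝ) ^ 2 ≤ (p : ℝ) ^ k := pow_le_pow_right₀ hp1 hk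
              gcongr
          _ ≤ 2 / X := by
              refine sum_inv_sq_le (by linarith) _ fun p hp => ?_
              rw [mem_sdiff, mem_coprimePrimes] at hp
              have h2 : ¬ p ≤ ⌊X⌋₊ := fun h => hp.2 ⟨h, hpr s p hp.1⟩
              exact (Nat.floor_lt (by linarith)).1 (not_le.1 h2)
      refine le_trans (by linarith) (one_sub_sum_le_prod _ _ fun p hp => ?_)
      have := one_sub_inv_pow_mem (hUp p hp) k
      constructor <;> linarith
    have hup := sieveDens_le_one k hUp
    rw [hsplit]
    have hX2 : 0 ≤ 2 / X := by positivity
    constructor <;> nlinarith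
  have h1 := ge_of_tendsto ht (hev.mono fun s hs => hs.1)
  have h2 := le_of_tendsto ht (hev.mono fun s hs => hs.2)
  rw [abs_of_nonneg (by linarith)]
  linarith

/-- If p ^ k divides n then p ≤ n ≤ Y, and p does not divide q because n is coprime to q; so the
finite sieve is exact. -/
lemma muK_eq_sieveInd {k q Y n : ℕ} (hn : n ∈ Icc 1 Y) (hnq : n.Coprime q) (hk : k ≠ 0) :
    muK k n = sieveInd k (coprimePrimes q Y) n := by
  rw [mem_Icc] at hn
  have hiff : KFree k n ↔ ∀ p ∈ coprimePrimes q Y, ¬ ((p : ℤ) ^ k ∣ n) := by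
    constructor
    · intro h p hp hd
      exact h p (mem_coprimePrimes.1 hp).2.1.one_lt (by exact_mod_cast hd)
    · intro h d hd hdn
      obtain ⟨p, hp, hpd⟩ := Nat.exists_prime_and_dvd hd.ne'
      have hpn : p ^ k ∣ n := (pow_dvd_pow_of_dvd hpd k).trans hdn
      have hpn' : p ∣ n := (dvd_pow_self p hk).trans hpn
      refine h p (mem_coprimePrimes.2 ⟨(Nat.le_of_dvd hn.1 hpn').trans hn.2, hp, fun hpq => ?_⟩)
        (by exact_mod_cast hpn)
      exact hp.one_lt.ne' (Nat.dvd_one.1 (hnq ▸ Nat.dvd_gcd hpn' hpq))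
  unfold muK sieveInd
  split_ifs with h
  · rw [hiff] at h
    exact (prod_eq_one fun p hp => by rw [if_neg (h p hp), sub_zero]).symm
  · rw [hiff] at h
    push Not at h
    obtain ⟨p, hp, hd⟩ := h
    exact (prod_eq_zero hp (by rw [if_pos hd, sub_self])).symm

/-- The positive integers up to `Y` congruent to `a` modulo `q`. -/
def classSet (q Y : ℕ) (a : ℤ) : Finset ℕ :=
  (Icc 1 Y).filter fun n : ℕ => (n : ℤ) ≡ a [ZMOD (q : ℤ)]

lemma coprime_iff_of_mem_classSet {q Y n a : ℕ} (hn : n ∈ classSet q Y a) :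
    n.Coprime q ↔ a.Coprime q := by
  have h : n ≡ a [MOD q] := (Int.natCast_modEq_iff).1 (mem_filter.1 hn).2
  rw [Nat.coprime_iff_gcd_eq_one, Nat.coprime_iff_gcd_eq_one, h.gcd_eq]

lemma errE_eq {k q a : ℕ} (hk : k ≠ 0) (hq : q ≠ 0) (ha : a.Coprime q) (X : ℝ) :
    errE k X q a = ∑ n ∈ classSet q ⌊X⌋₊ a, sieveInd k (coprimePrimes q ⌊X⌋₊) n -
      coprimeDens k q * (X / q) := by
  have hφ : (Nat.totient q : ℝ) ≠ 0 := by
    exact_mod_cast (Nat.totient_pos.2 (Nat.pos_of_ne_zero hq)).ne'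
  have hq' : (q : ℝ) ≠ 0 := by exact_mod_cast hq
  have h1 : densityA k q / (Nat.totient q : ℝ) * X = coprimeDens k q * (X / q) := by
    rw [densityA, ← coprimeDens]
    field_simp
  rw [errE, h1]
  congr 1
  refine sum_congr rfl fun n hn => ?_
  exact muK_eq_sieveInd (mem_filter.1 hn).1 ((coprime_iff_of_mem_classSet hn).2 ha) hk

/-! ### The randomly shifted model. -/

/-- Reduces an l-th absolute moment, l of either parity, to the even moment of order 2 l. -/
lemma abs_pow_le_add_sq_div {l : ℕ} {c : ℝ} (hc : 0 < c) (b : ℝ) :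
    |b| ^ l ≤ c ^ l + (c ^ l)⁻¹ * b ^ (2 * l) := by
  have hcl : 0 < c ^ l := by positivity
  have e : b ^ (2 * l) = (|b| ^ l) ^ 2 := by
    rw [← (even_two_mul l).pow_abs, mul_comm, pow_mul]
  rw [e]
  set z := |b| ^ l
  have : z ≤ c ^ l + z ^ 2 / c ^ l := by
    rw [← sub_nonneg]
    have : c ^ l + z ^ 2 / c ^ l - z = ((c ^ l - z / 2) ^ 2 + 3 / 4 * z ^ 2) / c ^ l := by
      field_simp
      ring
    rw [this]
    positivity
  rwa [div_eq_inv_mul] at this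

/-- The analogue of the `l`-th power of `errE` for a random shift of the sieve. -/
lemma exists_abs_model_le {k : ℕ} (hk : 2 ≤ k) {l : ℕ} (hl : 1 ≤ l) {ε : ℝ} (hε : 0 < ε) :
    ∃ C : ℝ, 0 ≤ C ∧ ∀ (X : ℝ) (q : ℕ) (a : ℤ), 1 ≤ X → q ≠ 0 → (q : ℝ) ≤ X →
      |cyclicAvg (sieveMod k (coprimePrimes q ⌊X⌋₊)) (fun x =>
        (∑ n ∈ classSet q ⌊X⌋₊ a, sieveInd k (coprimePrimes q ⌊X⌋₊) (x + n) -
          coprimeDens k q * (X / q)) ^ l)| ≤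
        C * (X / q) ^ ((l : ℝ) / (2 * k) + ε) := by
  obtain ⟨M, hM, hmom⟩ := exists_sieveMoment_le hk hl hε
  set θ := (l : ℝ) / k + ε with hθ
  have hkr : (0 : ℝ) < k := by positivity
  have hθ0 : 0 < θ := by positivity
  refine ⟨2 ^ l * (1 + M * 3 ^ θ + 4 ^ l), by positivity, ?_⟩
  intro X q a hX hq hqX
  have hq0 : (0 : ℝ) < q := by positivity
  have hq1 : (1 : ℝ) ≤ q := by exact_mod_cast Nat.pos_of_ne_zero hq
  set S := coprimePrimes q ⌊X⌋₊ with hS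
  have hSp : ∀ p ∈ S, p.Prime := fun p hp => (mem_coprimePrimes.1 hp).2.1
  have hSq : ∀ p ∈ S, IsCoprime (q : ℤ) (p : ℤ) := fun p hp => by
    have := mem_coprimePrimes.1 hp
    exact Nat.isCoprime_iff_coprime.2 ((this.2.1.coprime_iff_not_dvd).2 this.2.2).symm
  set h := X / q with hh
  have hh1 : 1 ≤ h := (one_le_div hq0).2 hqX
  obtain ⟨hα0, hα1, hα⟩ := coprimeDens_mem hk hX q
  rw [← hS] at hα
  set α := coprimeDens k q
  set A := sieveDens k S with hA
  have hA0 := sieveDens_nonneg k hSp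
  have hA1 := sieveDens_le_one k hSp
  obtain ⟨h₀, T, hT, hsum⟩ := exists_progression (Nat.pos_of_ne_zero hq) (1 - a) ⌊X⌋₊
  have hclass : ∀ g : ℤ → ℝ, ∑ n ∈ classSet q ⌊X⌋₊ a, g n =
      ∑ s ∈ range T, g (1 + h₀ + q * (s : ℤ)) := fun g => by
    have e1 := hsum fun t => g (1 + (t : ℤ))
    have e2 : ∑ n ∈ classSet q ⌊X⌋₊ a, g n = ∑ t ∈ range ⌊X⌋₊,
        if (q : ℤ) ∣ 1 - a + t then g (1 + (t : ℤ)) else 0 := by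
      rw [classSet, sum_filter, ← Ico_add_one_right_eq_Icc, sum_Ico_eq_sum_range,
        add_tsub_cancel_right]
      refine sum_congr rfl fun t _ => ?_
      have : ((1 + t : ℕ) : ℤ) ≡ a [ZMOD (q : ℤ)] ↔ (q : ℤ) ∣ 1 - a + t := by
        rw [Int.modEq_comm, Int.modEq_iff_dvd]
        push_cast
        rw [show (1 : ℤ) + t - a = 1 - a + t by ring]
      simp only [this]
      push_cast
      rfl
    rw [e2, e1]
    refine sum_congr rfl fun s _ => ?_
    push_cast
    rw [add_assoc]
  have hmodel : cyclicAvg (sieveMod k S) (fun x =>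
        (∑ n ∈ classSet q ⌊X⌋₊ a, sieveInd k S (x + n) - α * h) ^ l) =
      cyclicAvg (sieveMod k S) (fun x => (sieveErr k S T x + (A * T - α * h)) ^ l) := by
    have e1 := cyclicAvg_progression k hSq (1 + h₀)
      fun g => (∑ s ∈ range T, g (s : ℤ) - α * h) ^ l
    have e2 : ∀ x : ℤ, ∑ n ∈ classSet q ⌊X⌋₊ a, sieveInd k S (x + n) =
        ∑ s ∈ range T, sieveInd k S (x + (1 + h₀ + q * (s : ℤ))) :=
      fun x => hclass fun n => sieveInd k S (x + n)
    simp only [e2]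
    rw [e1]
    congr 1
    ext x
    rw [sieveErr]
    congr 1
    ring
  have hTh : |(T : ℝ) - h| ≤ 2 := by
    have h1 : |(⌊X⌋₊ : ℝ) / q - h| ≤ 1 := by
      rw [hh, ← sub_div, abs_div, abs_of_pos hq0, div_le_one hq0, abs_sub_comm,
        abs_of_nonneg (sub_nonneg.2 (Nat.floor_le (by linarith)))]
      have := (Nat.lt_floor_add_one X).le
      linarith
    calc _ ≤ |(T : ℝ) - (⌊X⌋₊ : ℝ) / q| + |(⌊X⌋₊ : ℝ) / q - h| := abs_sub_le _ _ _
      _ ≤ 2 := by linarith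
  -- Rounding the length and truncating the density each displace the centre by at most 2.
  have hγ : |A * T - α * h| ≤ 4 := by
    have h1 : |A * (T - h)| ≤ 2 := by
      rw [abs_mul, abs_of_nonneg hA0]
      calc A * |(T : ℝ) - h| ≤ 1 * 2 := by gcongr
        _ = 2 := one_mul 2
    have h2 : |(A - α) * h| ≤ 2 := by
      rw [abs_mul, abs_of_pos (by linarith : 0 < h)]
      calc |A - α| * h ≤ 2 / X * (X / 1) := by
            rw [hh]
            gcongr
        _ = 2 := by field_simp
    rw [show A * T - α * h = A * (T - h) + (A - α) * h by ring]
    exact (abs_add_le _ _).trans (by linarith)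
  -- This c balances the two terms: c ^ (-l) h ^ (l / k + ε) = c ^ l h ^ ε.
  set c := h ^ ((1 : ℝ) / (2 * k)) with hc
  have hc0 : 0 < c := by positivity
  have hcl : c ^ l = h ^ ((l : ℝ) / (2 * k)) := by
    rw [hc, ← Real.rpow_natCast, ← Real.rpow_mul (by positivity)]
    congr 1
    ring
  have hTmom : sieveMoment k S (2 * l) T ≤ M * 3 ^ θ * h ^ θ := by
    rcases Nat.eq_zero_or_pos T with rfl | hT0
    · rw [sieveMoment_zero k S (by omega)]
      positivity
    · refine (hmom T hT0 S hSp).trans ?_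
      rw [mul_assoc, ← Real.mul_rpow (by norm_num) (by positivity)]
      gcongr
      linarith [(abs_le.1 hTh).2]
  have hpt : ∀ x, |(sieveErr k S T x + (A * T - α * h)) ^ l| ≤
      2 ^ l * (c ^ l + (c ^ l)⁻¹ * sieveErr k S T x ^ (2 * l) + 4 ^ l) := fun x => by
    rw [abs_pow]
    calc _ ≤ (|sieveErr k S T x| + 4) ^ l := by
          gcongr
          exact (abs_add_le _ _).trans (by linarith)
      _ ≤ 2 ^ (l - 1) * (|sieveErr k S T x| ^ l + 4 ^ l) :=
          add_pow_le (abs_nonneg _) (by norm_num) l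
      _ ≤ 2 ^ l * (|sieveErr k S T x| ^ l + 4 ^ l) := by
          gcongr
          · norm_num
          · omega
      _ ≤ _ := by
          gcongr
          exact abs_pow_le_add_sq_div hc0 _
  rw [hmodel]
  have hE1 : 1 ≤ h ^ ((l : ℝ) / (2 * k) + ε) := Real.one_le_rpow hh1 (by positivity)
  calc _ ≤ cyclicAvg (sieveMod k S) (fun x =>
        2 ^ l * (c ^ l + (c ^ l)⁻¹ * sieveErr k S T x ^ (2 * l) + 4 ^ l)) :=
        (abs_cyclicAvg_le _ _).trans (cyclicAvg_mono _ hpt)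
    _ = 2 ^ l * (c ^ l + (c ^ l)⁻¹ * sieveMoment k S (2 * l) T + 4 ^ l) := by
        rw [cyclicAvg_const_mul, cyclicAvg_add, cyclicAvg_add, cyclicAvg_const_mul,
          cyclicAvg_const (sieveMod_pos k hSp), cyclicAvg_const (sieveMod_pos k hSp), sieveMoment]
    _ ≤ 2 ^ l * (c ^ l + (c ^ l)⁻¹ * (M * 3 ^ θ * h ^ θ) + 4 ^ l) := by gcongr
    _ = 2 ^ l * (c ^ l + M * 3 ^ θ * h ^ ((l : ℝ) / (2 * k) + ε) + 4 ^ l) := by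
        have : (c ^ l)⁻¹ * h ^ θ = h ^ ((l : ℝ) / (2 * k) + ε) := by
          rw [hcl, ← Real.rpow_neg (by positivity), ← Real.rpow_add (by positivity), hθ]
          congr 1
          field_simp
          ring
        rw [← this]
        ring
    _ ≤ 2 ^ l * (1 * h ^ ((l : ℝ) / (2 * k) + ε) + M * 3 ^ θ * h ^ ((l : ℝ) / (2 * k) + ε) +
        4 ^ l * h ^ ((l : ℝ) / (2 * k) + ε)) := by
        have h1 : c ^ l ≤ 1 * h ^ ((l : ℝ) / (2 * k) + ε) := by
          rw [hcl, one_mul]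
          exact Real.rpow_le_rpow_of_exponent_le hh1 (by linarith)
        have h2 : (4 : ℝ) ^ l ≤ 4 ^ l * h ^ ((l : ℝ) / (2 * k) + ε) :=
          le_mul_of_one_le_right (by positivity) hE1
        gcongr
    _ = _ := by ring

/-! ### Moments over residue classes as sums of correlations. -/

/-- The class is described relative to one of its members, with a range for g that does not depend
on that member, so the sums can be interchanged. -/
lemma classSet_sum_eq {q Y : ℕ} (hq : q ≠ 0) (F : ℤ → ℝ) {a : ℤ} {n : ℕ}
    (hn : n ∈ classSet q Y a) :
    ∑ m ∈ classSet q Y a, F m = ∑ g ∈ Icc (-((Y / q : ℕ) : ℤ)) ((Y / q : ℕ) : ℤ),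
      if 1 ≤ (n : ℤ) + q * g ∧ (n : ℤ) + q * g ≤ Y then F (n + q * g) else 0 := by
  have hq' : (0 : ℤ) < q := by exact_mod_cast Nat.pos_of_ne_zero hq
  rw [classSet, mem_filter, mem_Icc] at hn
  rw [← sum_filter]
  refine sum_nbij' (fun m : ℕ => ((m : ℤ) - n) / q) (fun g : ℤ => ((n : ℤ) + q * g).toNat)
    ?_ ?_ ?_ ?_ ?_
  · intro m hm
    rw [classSet, mem_filter, mem_Icc] at hm
    obtain ⟨c, hc⟩ := (hn.2.trans hm.2.symm).dvd
    simp only [hc, Int.mul_ediv_cancel_left _ hq'.ne']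
    rw [mem_filter, mem_Icc]
    have h1 : c ≤ ((Y / q : ℕ) : ℤ) := by
      push_cast
      rw [Int.le_ediv_iff_mul_le hq']
      nlinarith
    have h2 : -c ≤ ((Y / q : ℕ) : ℤ) := by
      push_cast
      rw [Int.le_ediv_iff_mul_le hq']
      nlinarith
    refine ⟨⟨by omega, h1⟩, ?_⟩
    omega
  · intro g hg
    rw [mem_filter] at hg
    have h0 : (((n : ℤ) + q * g).toNat : ℤ) = n + q * g := Int.toNat_of_nonneg (by omega)
    rw [classSet, mem_filter, mem_Icc, h0]
    refine ⟨by omega, ?_⟩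
    refine Int.ModEq.trans ?_ hn.2
    exact (Int.modEq_iff_dvd.2 ⟨-g, by ring⟩)
  · intro m hm
    rw [classSet, mem_filter, mem_Icc] at hm
    obtain ⟨c, hc⟩ := (hn.2.trans hm.2.symm).dvd
    simp only [hc, Int.mul_ediv_cancel_left _ hq'.ne']
    omega
  · intro g hg
    rw [mem_filter] at hg
    have h0 : (((n : ℤ) + q * g).toNat : ℤ) = n + q * g := Int.toNat_of_nonneg (by omega)
    simp only [h0, add_sub_cancel_left, Int.mul_ediv_cancel_left _ hq'.ne']
  · intro m hm
    rw [classSet, mem_filter, mem_Icc] at hm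
    obtain ⟨c, hc⟩ := (hn.2.trans hm.2.symm).dvd
    simp only [hc, Int.mul_ediv_cancel_left _ hq'.ne']
    rw [← hc]
    congr 1
    ring

lemma sum_classSet_eq {q : ℕ} (hq : q ≠ 0) (Y : ℕ) (f : ℕ → ℝ) :
    ∑ a ∈ (range q).filter (fun a : ℕ => a.Coprime q), ∑ n ∈ classSet q Y a, f n =
      ∑ n ∈ Icc 1 Y, if n.Coprime q then f n else 0 := by
  simp only [classSet, sum_filter (s := Icc 1 Y)]
  rw [sum_comm]
  refine sum_congr rfl fun n _ => ?_
  have hmod : n % q < q := Nat.mod_lt _ (Nat.pos_of_ne_zero hq)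
  have hgcd : (n % q).Coprime q ↔ n.Coprime q := by
    rw [Nat.coprime_iff_gcd_eq_one, Nat.coprime_iff_gcd_eq_one, (Nat.mod_modEq n q).gcd_eq]
  have hiff : ∀ a ∈ range q, (n : ℤ) ≡ a [ZMOD q] ↔ a = n % q := fun a ha => by
    rw [Int.natCast_modEq_iff]
    constructor
    · intro h
      exact ((Nat.mod_modEq n q).trans h).symm.eq_of_lt_of_lt (mem_range.1 ha) hmod
    · rintro rfl
      exact (Nat.mod_modEq n q).symm
  rw [sum_filter]
  calc _ = ∑ a ∈ range q, if a = n % q then (if n.Coprime q then f n else 0) else 0 := by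
        refine sum_congr rfl fun a ha => ?_
        simp only [hiff a ha]
        by_cases h : a = n % q
        · subst h
          simp only [if_true, hgcd]
        · simp only [if_neg h, ite_self]
    _ = _ := by rw [sum_ite_eq' (range q), if_pos (mem_range.2 hmod)]

/-- Moments over the residue classes in terms of the correlations of `F`. -/
lemma sum_classSet_pow {q : ℕ} (hq : q ≠ 0) (Y i : ℕ) (F : ℤ → ℝ) :
    ∑ a ∈ (range q).filter (fun a : ℕ => a.Coprime q), (∑ n ∈ classSet q Y a, F n) ^ (i + 1) =
      ∑ g ∈ Fintype.piFinset fun _ : Fin i => Icc (-((Y / q : ℕ) : ℤ)) ((Y / q : ℕ) : ℤ),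
        ∑ n ∈ Icc 1 Y, if ∀ t, 1 ≤ (n : ℤ) + q * g t ∧ (n : ℤ) + q * g t ≤ Y then
          (if n.Coprime q then
            ∏ j : Fin (i + 1), F (n + (Fin.cons 0 (fun t => q * g t) : Fin (i + 1) → ℤ) j)
            else 0) else 0 := by
  set G := Icc (-((Y / q : ℕ) : ℤ)) ((Y / q : ℕ) : ℤ) with hG
  set R : ℕ → ℝ := fun n => ∑ g ∈ G,
    if 1 ≤ (n : ℤ) + q * g ∧ (n : ℤ) + q * g ≤ Y then F (n + q * g) else 0 with hR
  -- One factor keeps n, and the other i are rewritten around it; hence the shift 0 in front of the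
  -- vector and only i free parameters.
  have h1 : ∀ a : ℕ, (∑ n ∈ classSet q Y a, F n) ^ (i + 1) =
      ∑ n ∈ classSet q Y a, F n * R n ^ i := fun a => by
    rw [pow_succ', sum_mul]
    refine sum_congr rfl fun n hn => ?_
    rw [classSet_sum_eq hq F hn]
  simp only [h1]
  rw [sum_classSet_eq hq Y fun n => F n * R n ^ i, sum_comm]
  refine sum_congr rfl fun n _ => ?_
  by_cases hn : n.Coprime q
  · simp only [if_pos hn, hR, sum_pow', Fintype.prod_ite_zero, mul_sum]
    refine sum_congr rfl fun g _ => ?_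
    rw [Fin.prod_univ_succ, mul_ite, mul_zero]
    simp only [Fin.cons_zero, Fin.cons_succ, add_zero]
    split_ifs <;> rfl
  · simp only [if_neg hn, ite_self, sum_const_zero]

/-- An order-convex condition selects an interval; the size constraints on the shifted variables are
of this kind. -/
lemma exists_sum_interval (Y : ℕ) (P : ℕ → Prop) [DecidablePred P]
    (hP : ∀ a b c, a ≤ b → b ≤ c → P a → P c → P b) :
    ∃ a H : ℕ, (∀ t ∈ range H, a + t ∈ Icc 1 Y ∧ P (a + t)) ∧ ∀ w : ℕ → ℝ,
      (∑ n ∈ Icc 1 Y, if P n then w n else 0) = ∑ t ∈ range H, w (a + t) := by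
  set J := (Icc 1 Y).filter P with hJ
  rcases J.eq_empty_or_nonempty with h | h
  · refine ⟨0, 0, by simp, fun w => ?_⟩
    rw [← sum_filter, ← hJ, h]
    simp
  · have hJI : J = Ico (J.min' h) (J.max' h + 1) := by
      ext n
      rw [mem_Ico, Nat.lt_succ_iff]
      constructor
      · exact fun hn => ⟨min'_le _ _ hn, le_max' _ _ hn⟩
      · rintro ⟨h1, h2⟩
        have hmin := mem_filter.1 (min'_mem J h)
        have hmax := mem_filter.1 (max'_mem J h)
        rw [mem_Icc] at hmin hmax
        exact mem_filter.2 ⟨mem_Icc.2 ⟨hmin.1.1.trans h1, h2.trans hmax.1.2⟩,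
          hP _ _ _ h1 h2 hmin.2 hmax.2⟩
    refine ⟨J.min' h, J.max' h + 1 - J.min' h, fun t ht => ?_, fun w => ?_⟩
    · rw [mem_range] at ht
      have : J.min' h + t ∈ J :=
        (Finset.ext_iff.1 hJI _).2 (mem_Ico.2 ⟨by omega, by omega⟩)
      exact mem_filter.1 this
    · rw [← sum_filter, ← hJ, ← sum_Ico_eq_sum_range]
      exact congrArg (fun T => ∑ n ∈ T, w n) hJI

/-- The power moments of the sieve over residue classes are close to those of a random shift. -/
lemma exists_abs_moment_sub_model_le {k : ℕ} (hk : 2 ≤ k) {ε : ℝ} (hε : 0 < ε) (i : ℕ) :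
    ∃ C : ℝ, 0 ≤ C ∧ ∀ (X : ℝ) (q : ℕ), 1 ≤ X → q ≠ 0 → (q : ℝ) ≤ X →
      |∑ a ∈ (range q).filter (fun a : ℕ => a.Coprime q),
        ((∑ n ∈ classSet q ⌊X⌋₊ a, sieveInd k (coprimePrimes q ⌊X⌋₊) n) ^ i -
          cyclicAvg (sieveMod k (coprimePrimes q ⌊X⌋₊)) fun x =>
            (∑ n ∈ classSet q ⌊X⌋₊ a, sieveInd k (coprimePrimes q ⌊X⌋₊) (x + n)) ^ i)| ≤
        C * (X ^ ((2 : ℝ) / (k + 1)) * X ^ ε) * (X / q) ^ (i - 1) := by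
  rcases Nat.eq_zero_or_pos i with rfl | hi
  · refine ⟨0, le_rfl, fun X q hX hq hqX => ?_⟩
    have hSp : ∀ p ∈ coprimePrimes q ⌊X⌋₊, p.Prime := fun p hp => (mem_coprimePrimes.1 hp).2.1
    simp [cyclicAvg_const (sieveMod_pos k hSp)]
  obtain ⟨i, rfl⟩ : ∃ i', i = i' + 1 := ⟨i - 1, by omega⟩
  obtain ⟨C, hC, hcorr⟩ := exists_correlation_le (Fin (i + 1)) hk hε
  refine ⟨C * 3 ^ i, by positivity, fun X q hX hq hqX => ?_⟩
  have hq0 : (0 : ℝ) < q := by positivity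
  set Y := ⌊X⌋₊ with hY
  have hYX : (Y : ℝ) ≤ X := Nat.floor_le (by linarith)
  set S := coprimePrimes q Y with hS
  have hSp : ∀ p ∈ S, p.Prime := fun p hp => (mem_coprimePrimes.1 hp).2.1
  have hSq : ∀ p ∈ S, ¬ p ∣ q := fun p hp => (mem_coprimePrimes.1 hp).2.2
  have hh1 : 1 ≤ X / q := (one_le_div hq0).2 hqX
  -- Then y ^ (k + 1) = X, and the correlation error y ^ 2 is X ^ (2 / (k + 1)).
  set y := X ^ ((1 : ℝ) / (k + 1)) with hy
  have hy1 : 1 ≤ y := Real.one_le_rpow hX (by positivity)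
  have hyX : y ^ (k + 1) = X := by
    rw [hy, ← Real.rpow_natCast, ← Real.rpow_mul (by linarith)]
    push_cast
    rw [one_div_mul_cancel (by positivity), Real.rpow_one]
  have hy2 : y ^ 2 = X ^ ((2 : ℝ) / (k + 1)) := by
    rw [hy, ← Real.rpow_natCast, ← Real.rpow_mul (by linarith)]
    congr 1
    push_cast
    ring
  rw [add_tsub_cancel_right, ← hy2]
  set G := Icc (-((Y / q : ℕ) : ℤ)) ((Y / q : ℕ) : ℤ) with hG
  have hGcard : (G.card : ℝ) ≤ 3 * (X / q) := by
    rw [hG, Int.card_Icc]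
    have h1 : ((((Y / q : ℕ) : ℤ) + 1 - -((Y / q : ℕ) : ℤ)).toNat : ℕ) = 2 * (Y / q) + 1 := by
      omega
    rw [h1]
    have h2 : ((Y / q : ℕ) : ℝ) ≤ X / q := Nat.cast_div_le.trans (by gcongr)
    push_cast
    linarith
  let sh : (Fin i → ℤ) → Fin (i + 1) → ℤ := fun g => Fin.cons 0 fun t => q * g t
  -- The same expansion holds for the shifted sieve, and by periodicity the mean of each product no
  -- longer depends on n.
  have hmodel : ∑ a ∈ (range q).filter (fun a : ℕ => a.Coprime q), cyclicAvg (sieveMod k S)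
      (fun x => (∑ n ∈ classSet q Y a, sieveInd k S (x + n)) ^ (i + 1)) =
      ∑ g ∈ Fintype.piFinset fun _ : Fin i => G, ∑ n ∈ Icc 1 Y,
        if ∀ t, 1 ≤ (n : ℤ) + q * g t ∧ (n : ℤ) + q * g t ≤ Y then
          (if n.Coprime q then
            cyclicAvg (sieveMod k S) (fun x => ∏ j, sieveInd k S (x + sh g j)) else 0) else 0 := by
    rw [← cyclicAvg_sum]
    have h1 : ∀ x : ℤ, ∑ a ∈ (range q).filter (fun a : ℕ => a.Coprime q),
        (∑ n ∈ classSet q Y a, sieveInd k S (x + n)) ^ (i + 1) = _ := fun x =>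
      sum_classSet_pow hq Y i fun n => sieveInd k S (x + n)
    simp only [h1]
    rw [cyclicAvg_sum]
    refine sum_congr rfl fun g _ => ?_
    rw [cyclicAvg_sum]
    refine sum_congr rfl fun n _ => ?_
    split_ifs with hc hn
    · have hper : Function.Periodic (fun x => ∏ j, sieveInd k S (x + sh g j))
          (sieveMod k S : ℤ) := fun x => by
        refine prod_congr rfl fun j _ => ?_
        rw [add_right_comm, sieveInd_periodic]
      rw [← cyclicAvg_shift (n : ℤ) hper]
      simp only [add_assoc]
      rfl
    · exact cyclicAvg_const (sieveMod_pos k hSp) 0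
    · exact cyclicAvg_const (sieveMod_pos k hSp) 0
  rw [sum_sub_distrib, sum_classSet_pow hq Y i (sieveInd k S), hmodel, ← sum_sub_distrib]
  have hg : ∀ g ∈ Fintype.piFinset fun _ : Fin i => G,
      |(∑ n ∈ Icc 1 Y, if ∀ t, 1 ≤ (n : ℤ) + q * g t ∧ (n : ℤ) + q * g t ≤ Y then
          (if n.Coprime q then ∏ j : Fin (i + 1), sieveInd k S (n + sh g j) else 0) else 0) -
        ∑ n ∈ Icc 1 Y, (if ∀ t, 1 ≤ (n : ℤ) + q * g t ∧ (n : ℤ) + q * g t ≤ Y then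
          (if n.Coprime q then
            cyclicAvg (sieveMod k S) (fun x => ∏ j, sieveInd k S (x + sh g j)) else 0) else 0)| ≤
        C * y ^ 2 * X ^ ε := by
    intro g _
    obtain ⟨a, H, hmem, hsum⟩ := exists_sum_interval Y
      (fun n : ℕ => ∀ t, 1 ≤ (n : ℤ) + q * g t ∧ (n : ℤ) + q * g t ≤ Y)
      (fun a b c hab hbc ha hc t => by
        have h1 := ha t
        have h2 := hc t
        have h3 : (a : ℤ) ≤ b := by exact_mod_cast hab
        have h4 : (b : ℤ) ≤ c := by exact_mod_cast hbc
        constructor <;> linarith)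
    rw [hsum fun n => if n.Coprime q then ∏ j : Fin (i + 1), sieveInd k S (n + sh g j) else 0,
      hsum fun n => if n.Coprime q then
        cyclicAvg (sieveMod k S) (fun x => ∏ j, sieveInd k S (x + sh g j)) else 0,
      ← sum_sub_distrib]
    have := hcorr y q S (sh g) a H hy1 hq (by rw [hyX]; exact hqX) hSp hSq (by
      intro t ht j
      obtain ⟨h1, h2⟩ := hmem t ht
      rw [mem_Icc] at h1
      rw [hyX]
      have h3 : 1 ≤ (a : ℤ) + t + sh g j ∧ (a : ℤ) + t + sh g j ≤ Y := by
        refine Fin.cases ?_ (fun j => ?_) j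
        · simp only [sh, Fin.cons_zero, add_zero]
          omega
        · have := h2 j
          push_cast at this
          simpa only [sh, Fin.cons_succ] using this
      refine ⟨h3.1, le_trans ?_ hYX⟩
      exact_mod_cast h3.2)
    rw [hyX] at this
    refine le_trans (le_of_eq ?_) this
    congr 1
    refine sum_congr rfl fun t _ => ?_
    have hgcd : Int.gcd ((a : ℤ) + t) q = 1 ↔ (a + t).Coprime q := by
      rw [← Nat.cast_add, Int.gcd_natCast_natCast]
    by_cases h : (a + t).Coprime q
    · rw [if_pos h, if_pos h, if_pos (hgcd.2 h)]
      push_cast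
      rfl
    · rw [if_neg h, if_neg h, if_neg (mt hgcd.1 h), sub_zero]
  refine (abs_sum_le_sum_abs _ _).trans ((sum_le_sum hg).trans ?_)
  rw [sum_const, Fintype.card_piFinset, prod_const, card_univ, Fintype.card_fin, nsmul_eq_mul,
    Nat.cast_pow]
  calc _ ≤ (3 * (X / q)) ^ i * (C * y ^ 2 * X ^ ε) := by gcongr
    _ = _ := by ring

/-! ### Assembly, and comparison of the two terms. -/

/-- The fundamental bound for the moments, with both terms in their sharp form. -/
theorem exists_abs_momentM_le {k : ℕ} (hk : 2 ≤ k) {l : ℕ} (hl : 1 ≤ l) {ε : ℝ} (hε : 0 < ε) :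
    ∃ C : ℝ, 0 < C ∧ ∀ (X : ℝ) (q : ℕ), 1 ≤ X → 1 ≤ q → (q : ℝ) ≤ X →
      |momentM k X q l| ≤ C * ((Nat.totient q : ℝ) * (X / q) ^ ((l : ℝ) / (2 * k) + ε) +
        X ^ ε * (X ^ ((2 : ℝ) / (k + 1)) * (X / q) ^ ((l : ℝ) - 1))) := by
  obtain ⟨C₁, hC₁, hmodel⟩ := exists_abs_model_le hk hl hε
  choose C₂ hC₂ hdiff using fun i => exists_abs_moment_sub_model_le hk hε i
  set C₃ := ∑ i ∈ range (l + 1), C₂ i * (l.choose i : ℝ) with hC₃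
  have hC₃0 : 0 ≤ C₃ := sum_nonneg fun i _ => mul_nonneg (hC₂ i) (Nat.cast_nonneg _)
  refine ⟨C₁ + C₃ + 1, by positivity, fun X q hX hq1 hqX => ?_⟩
  have hq : q ≠ 0 := by omega
  have hq0 : (0 : ℝ) < q := by positivity
  set S := coprimePrimes q ⌊X⌋₊ with hS
  set h := X / q with hh
  have hh1 : 1 ≤ h := (one_le_div hq0).2 hqX
  obtain ⟨hα0, hα1, -⟩ := coprimeDens_mem hk hX q
  set β := coprimeDens k q * h with hβ
  have hβ0 : 0 ≤ β := by positivity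
  have hβh : β ≤ h := mul_le_of_le_one_left (by linarith) hα1
  set A := (range q).filter (fun a : ℕ => a.Coprime q) with hA
  set U : ℕ → ℤ → ℝ := fun a x => ∑ n ∈ classSet q ⌊X⌋₊ a, sieveInd k S (x + n) with hU
  have hAcard : (A.card : ℝ) = Nat.totient q := by
    rw [Nat.totient_eq_card_coprime, hA]
    congr 2
    ext a
    rw [mem_filter, mem_filter, Nat.coprime_comm]
  have hM : momentM k X q l = ∑ a ∈ A, (U a 0 - β) ^ l := by
    rw [momentM]
    refine sum_congr rfl fun a ha => ?_
    rw [errE_eq (by omega) hq (mem_filter.1 ha).2]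
    simp only [hU, zero_add, hβ, hh, hS]
  have hexp : ∀ u : ℝ, (u - β) ^ l =
      ∑ i ∈ range (l + 1), (-β) ^ (l - i) * (l.choose i : ℝ) * u ^ i := fun u => by
    rw [sub_eq_add_neg, add_pow]
    exact sum_congr rfl fun i _ => by ring
  -- The model moment is kept whole, so its cancellation is not lost; only the differences of powers
  -- are expanded.
  have hsplit : momentM k X q l =
      ∑ a ∈ A, cyclicAvg (sieveMod k S) (fun x => (U a x - β) ^ l) +
      ∑ i ∈ range (l + 1), (-β) ^ (l - i) * (l.choose i : ℝ) *
        ∑ a ∈ A, (U a 0 ^ i - cyclicAvg (sieveMod k S) fun x => U a x ^ i) := by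
    rw [hM]
    simp only [hexp, mul_sum]
    rw [sum_comm (s := range (l + 1)), ← sum_add_distrib]
    refine sum_congr rfl fun a _ => ?_
    rw [cyclicAvg_sum, ← sum_add_distrib]
    refine sum_congr rfl fun i _ => ?_
    rw [cyclicAvg_const_mul]
    ring
  have hfirst : |∑ a ∈ A, cyclicAvg (sieveMod k S) (fun x => (U a x - β) ^ l)| ≤
      C₁ * ((Nat.totient q : ℝ) * h ^ ((l : ℝ) / (2 * k) + ε)) := by
    refine (abs_sum_le_sum_abs _ _).trans ?_
    calc _ ≤ ∑ a ∈ A, C₁ * h ^ ((l : ℝ) / (2 * k) + ε) :=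
          sum_le_sum fun a _ => hmodel X q a hX hq hqX
      _ = _ := by
          rw [sum_const, nsmul_eq_mul, hAcard]
          ring
  set D := X ^ ((2 : ℝ) / (k + 1)) * X ^ ε with hD
  have hD0 : 0 ≤ D := by positivity
  have hsecond : |∑ i ∈ range (l + 1), (-β) ^ (l - i) * (l.choose i : ℝ) *
        ∑ a ∈ A, (U a 0 ^ i - cyclicAvg (sieveMod k S) fun x => U a x ^ i)| ≤
      C₃ * (D * h ^ (l - 1)) := by
    refine (abs_sum_le_sum_abs _ _).trans ?_
    rw [hC₃, sum_mul]
    refine sum_le_sum fun i hi => ?_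
    rw [mem_range] at hi
    have h1 := hdiff i X q hX hq hqX
    have h2 : ∑ a ∈ A, (U a 0 ^ i - cyclicAvg (sieveMod k S) fun x => U a x ^ i) =
        ∑ a ∈ A, ((∑ n ∈ classSet q ⌊X⌋₊ a, sieveInd k S n) ^ i -
          cyclicAvg (sieveMod k S) fun x =>
            (∑ n ∈ classSet q ⌊X⌋₊ a, sieveInd k S (x + n)) ^ i) := by
      simp only [hU, zero_add]
    rw [h2, abs_mul, abs_mul, abs_pow, abs_neg, abs_of_nonneg hβ0, Nat.abs_cast]
    -- For i = 0 the difference is exactly zero. The truncated exponent i - 1 would otherwise give h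
    -- ^ l in place of h ^ (l - 1).
    rcases Nat.eq_zero_or_pos i with rfl | hi0
    · have hSp : ∀ p ∈ S, p.Prime := fun p hp => (mem_coprimePrimes.1 hp).2.1
      have h3 := hC₂ 0
      simp only [pow_zero, cyclicAvg_const (sieveMod_pos k hSp), sub_self, sum_const_zero, abs_zero,
        mul_zero]
      positivity
    calc _ ≤ h ^ (l - i) * (l.choose i : ℝ) * (C₂ i * D * h ^ (i - 1)) := by gcongr
      _ = C₂ i * (l.choose i : ℝ) * (D * (h ^ (l - i) * h ^ (i - 1))) := by ring
      _ = _ := by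
          rw [← pow_add]
          congr 4
          omega
  have hpow : h ^ ((l : ℝ) - 1) = h ^ (l - 1) := by
    rw [← Real.rpow_natCast, Nat.cast_sub hl, Nat.cast_one]
  rw [hsplit, hpow]
  refine (abs_add_le _ _).trans ((add_le_add hfirst hsecond).trans ?_)
  have hP0 : 0 ≤ (Nat.totient q : ℝ) * h ^ ((l : ℝ) / (2 * k) + ε) := by positivity
  have hQ0 : 0 ≤ D * h ^ (l - 1) := by positivity
  rw [show X ^ ε * (X ^ ((2 : ℝ) / (k + 1)) * h ^ (l - 1)) = D * h ^ (l - 1) by rw [hD]; ring]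
  nlinarith [mul_nonneg hC₁ hQ0, mul_nonneg hC₃0 hP0]

/-- Each factor 1 - 1 / p is at least 1 / 2; with the bound on 2 ^ ω(q) this makes q / φ(q) smaller
than any power of X. -/
lemma le_two_pow_mul_totient (q : ℕ) :
    (q : ℝ) ≤ 2 ^ q.primeFactors.card * Nat.totient q := by
  have h1 : (Nat.totient q : ℝ) = q * ∏ p ∈ q.primeFactors, (1 - (p : ℝ)⁻¹) := by
    have := congrArg (fun x : ℚ => (x : ℝ)) (Nat.totient_eq_mul_prod_factors q)
    push_cast at this
    exact this
  have h2 : ∏ p ∈ q.primeFactors, (1 / 2 : ℝ) ≤ ∏ p ∈ q.primeFactors, (1 - (p : ℝ)⁻¹) := by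
    refine prod_le_prod (fun _ _ => by norm_num) fun p hp => ?_
    have hp2 : (2 : ℝ) ≤ p := by exact_mod_cast (Nat.prime_of_mem_primeFactors hp).two_le
    have : (p : ℝ)⁻¹ ≤ 2⁻¹ := by gcongr
    linarith
  rw [prod_const] at h2
  rw [h1]
  calc (q : ℝ) = 2 ^ q.primeFactors.card * (q * (1 / 2) ^ q.primeFactors.card) := by
        rw [mul_left_comm, ← mul_pow]
        norm_num
    _ ≤ _ := by gcongr

lemma cConst_pos {k : ℕ} (hk : 2 ≤ k) : 0 < cConst k := by
  have : (2 : ℝ) ≤ k := by exact_mod_cast hk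
  unfold cConst
  have h1 : 0 < (k : ℝ) - 1 := by linarith
  have h2 : 0 < 2 * (k : ℝ) - 1 := by linarith
  positivity

/-- In the range `X ^ (1 - c_k / l) ≤ q` the error term from the correlations is dominated by
the diagonal term. -/
lemma error_le_of_le {k : ℕ} (hk : 2 ≤ k) {l : ℕ} (hl : 1 ≤ l) {X q ε δ : ℝ} (hX : 1 ≤ X)
    (hq : 0 < q) (hqX : q ≤ X) (hlow : X ^ (1 - cConst k / l) ≤ q)
    (hδ : δ ≤ ε) (hδl : δ ≤ l * ((2 * k - 1) / (2 * k))) :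
    X ^ ((2 : ℝ) / (k + 1)) * (X / q) ^ ((l : ℝ) - 1) ≤
      q * (X / q) ^ ((l : ℝ) / (2 * k) + ε) * X ^ (-(cConst k * δ / l)) := by
  have hX0 : 0 < X := by linarith
  have hk2 : (2 : ℝ) ≤ k := by exact_mod_cast hk
  have hl0 : (0 : ℝ) < l := by positivity
  set c := cConst k with hc
  set b : ℝ := (2 * k - 1) / (2 * k) with hb
  set h := X / q with hh
  have hh1 : 1 ≤ h := (one_le_div hq).2 hqX
  have hh0 : 0 < h := by linarith
  have hcb : c * b = (k - 1) / (k + 1) := by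
    have : (2 * (k : ℝ) - 1) ≠ 0 := by linarith
    rw [hc, cConst, hb]
    field_simp
  -- The ratio of the error term to q h ^ (l / (2k)) is u ^ b, and the lower bound on q says
  -- precisely that u ≤ 1.
  set u := h ^ (l : ℝ) * X ^ (-c) with hu
  have hu0 : 0 < u := by positivity
  have hu1 : u ≤ 1 := by
    have h1 : h ≤ X ^ (c / l) := by
      rw [hh, div_le_iff₀ hq]
      calc X = X ^ (c / l) * X ^ (1 - c / l) := by
            rw [← Real.rpow_add hX0, add_sub_cancel, Real.rpow_one]
        _ ≤ _ := by gcongr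
    have h2 : h ^ (l : ℝ) ≤ X ^ c := by
      calc h ^ (l : ℝ) ≤ (X ^ (c / l)) ^ (l : ℝ) := by gcongr
        _ = X ^ c := by rw [← Real.rpow_mul hX0.le, div_mul_cancel₀ _ hl0.ne']
    rw [hu, Real.rpow_neg hX0.le, ← div_eq_mul_inv]
    exact (div_le_one (by positivity)).2 h2
  -- Lowering the exponent from b to δ / l costs only h ^ δ and exposes a genuine saving in X.
  have hub : u ^ b ≤ h ^ δ * X ^ (-(c * δ / l)) := by
    calc u ^ b ≤ u ^ (δ / l) := by
          refine Real.rpow_le_rpow_of_exponent_ge hu0 hu1 ?_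
          rw [div_le_iff₀ hl0]
          linarith
      _ = _ := by
          rw [hu, Real.mul_rpow (by positivity) (by positivity), ← Real.rpow_mul hh0.le,
            ← Real.rpow_mul hX0.le, mul_div_cancel₀ _ hl0.ne']
          congr 2
          ring
  have hmain : X ^ ((2 : ℝ) / (k + 1)) * h ^ ((l : ℝ) - 1) =
      q * h ^ ((l : ℝ) / (2 * k)) * u ^ b := by
    have hqe : q = X * h ^ (-1 : ℝ) := by
      rw [Real.rpow_neg_one, hh]
      field_simp
    rw [hu, Real.mul_rpow (by positivity) (by positivity), ← Real.rpow_mul hh0.le,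
      ← Real.rpow_mul hX0.le, neg_mul, hcb]
    calc _ = X ^ (1 + -(((k : ℝ) - 1) / (k + 1))) *
          h ^ ((-1 : ℝ) + (l : ℝ) / (2 * k) + l * b) := by
          congr 2
          · field_simp
            ring
          · rw [hb]
            field_simp
            ring
      _ = X * h ^ (-1 : ℝ) * h ^ ((l : ℝ) / (2 * k)) *
          (h ^ (l * b) * X ^ (-(((k : ℝ) - 1) / (k + 1)))) := by
          rw [Real.rpow_add hX0, Real.rpow_add hh0, Real.rpow_add hh0, Real.rpow_one]
          ring
      _ = _ := by rw [← hqe]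
  rw [hmain]
  calc _ ≤ q * h ^ ((l : ℝ) / (2 * k)) * (h ^ ε * X ^ (-(c * δ / l))) := by
        gcongr
        refine hub.trans ?_
        gcongr
    _ = _ := by
        rw [Real.rpow_add hh0]
        ring

end KFreeMoments

open KFreeMoments in
theorem theorem2 (ε : ℝ) (hε : 0 < ε) (k : ℕ) (hk : 2 ≤ k) (l : ℕ) (hl : 3 ≤ l) :
    (∃ C : ℝ, 0 < C ∧ ∀ (X : ℝ) (q : ℕ), 1 ≤ X → 1 ≤ q → (q : ℝ) ≤ X →
      |momentM k X q l| ≤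
        C * (X ^ ε * ((q : ℝ) * (X / (q : ℝ)) ^ ((l : ℝ) / (2 * (k : ℝ)))
          + X ^ ((2 : ℝ) / ((k : ℝ) + 1)) * (X / (q : ℝ)) ^ ((l : ℝ) - 1)))) ∧
    (∃ C : ℝ, 0 < C ∧ ∀ (X : ℝ) (q : ℕ), 1 ≤ X → 1 ≤ q →
      X ^ (1 - cConst k / (l : ℝ)) ≤ (q : ℝ) → (q : ℝ) ≤ X →
      |momentM k X q l| ≤
        C * ((Nat.totient q : ℝ) * (X / (q : ℝ)) ^ ((l : ℝ) / (2 * (k : ℝ)) + ε))) := by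
  have hl1 : 1 ≤ l := by omega
  constructor
  · obtain ⟨C, hC, hM⟩ := exists_abs_momentM_le hk hl1 hε
    refine ⟨C, hC, fun X q hX hq hqX => (hM X q hX hq hqX).trans ?_⟩
    have hq1 : (1 : ℝ) ≤ q := by exact_mod_cast hq
    have hh1 : 1 ≤ X / q := (one_le_div (by linarith)).2 hqX
    have hφ : (Nat.totient q : ℝ) ≤ q := by exact_mod_cast Nat.totient_le q
    have h1 : (Nat.totient q : ℝ) * (X / q) ^ ((l : ℝ) / (2 * k) + ε) ≤
        X ^ ε * ((q : ℝ) * (X / q) ^ ((l : ℝ) / (2 * k))) := by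
      rw [Real.rpow_add (by linarith)]
      have h2 : (X / q) ^ ε ≤ X ^ ε := by
        gcongr
        exact div_le_self (by linarith) hq1
      calc _ ≤ (q : ℝ) * ((X / q) ^ ((l : ℝ) / (2 * k)) * X ^ ε) := by gcongr
        _ = _ := by ring
    rw [mul_add (X ^ ε)]
    gcongr
  · have hc := cConst_pos hk
    have hk2 : (2 : ℝ) ≤ k := by exact_mod_cast hk
    have hl0 : (0 : ℝ) < l := by positivity
    have hb : 0 < (l : ℝ) * ((2 * k - 1) / (2 * k)) := by
      have : 0 < 2 * (k : ℝ) - 1 := by linarith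
      positivity
    set δ := min ε ((l : ℝ) * ((2 * k - 1) / (2 * k))) with hδ
    have hδ0 : 0 < δ := lt_min hε hb
    -- The saving X ^ (-(c_k δ / l)) has to cover two factors X ^ η: one from the general bound, one
    -- from q / φ(q).
    set η := min ε (cConst k * δ / (2 * l)) with hη
    have hη0 : 0 < η := lt_min hε (by positivity)
    obtain ⟨C, hC, hM⟩ := exists_abs_momentM_le hk hl1 hη0
    obtain ⟨C₂, hC₂, hω⟩ := exists_pow_card_primeFactors_le 2 (by norm_num) hη0
    refine ⟨C * (1 + C₂), by positivity, fun X q hX hq hlow hqX =>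
      (hM X q hX hq hqX).trans ?_⟩
    have hX0 : 0 < X := by linarith
    have hq1 : (1 : ℝ) ≤ q := by exact_mod_cast hq
    have hq0 : (0 : ℝ) < q := by linarith
    have hh1 : 1 ≤ X / q := (one_le_div hq0).2 hqX
    have hφ : (q : ℝ) ≤ C₂ * X ^ η * Nat.totient q := by
      refine (le_two_pow_mul_totient q).trans ?_
      gcongr
      have := hω q (by omega)
      refine le_trans (by exact_mod_cast this) ?_
      gcongr
    have h1 : (Nat.totient q : ℝ) * (X / q) ^ ((l : ℝ) / (2 * k) + η) ≤
        (Nat.totient q : ℝ) * (X / q) ^ ((l : ℝ) / (2 * k) + ε) := by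
      gcongr
      exact min_le_left _ _
    have h2 : X ^ η * (X ^ ((2 : ℝ) / (k + 1)) * (X / q) ^ ((l : ℝ) - 1)) ≤
        C₂ * ((Nat.totient q : ℝ) * (X / q) ^ ((l : ℝ) / (2 * k) + ε)) := by
      have h3 := error_le_of_le hk hl1 hX hq0 hqX hlow (min_le_left ε _) (min_le_right _ _)
      have h4 : X ^ η * X ^ η * X ^ (-(cConst k * δ / l)) ≤ 1 := by
        rw [← Real.rpow_add hX0, ← Real.rpow_add hX0]
        apply Real.rpow_le_one_of_one_le_of_nonpos hX
        have h5 : η ≤ cConst k * δ / (2 * l) := min_le_right _ _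
        have h6 : cConst k * δ / (2 * l) = cConst k * δ / l / 2 := by
          rw [mul_comm 2, div_div]
        linarith
      calc _ ≤ X ^ η * (q * (X / q) ^ ((l : ℝ) / (2 * k) + ε) * X ^ (-(cConst k * δ / l))) := by
            gcongr
        _ ≤ X ^ η * (C₂ * X ^ η * Nat.totient q * (X / q) ^ ((l : ℝ) / (2 * k) + ε) *
            X ^ (-(cConst k * δ / l))) := by gcongr
        _ = C₂ * ((Nat.totient q : ℝ) * (X / q) ^ ((l : ℝ) / (2 * k) + ε)) *
            (X ^ η * X ^ η * X ^ (-(cConst k * δ / l))) := by ring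
        _ ≤ C₂ * ((Nat.totient q : ℝ) * (X / q) ^ ((l : ℝ) / (2 * k) + ε)) * 1 := by gcongr
        _ = _ := mul_one _
    calc _ ≤ C * ((Nat.totient q : ℝ) * (X / q) ^ ((l : ℝ) / (2 * k) + ε) +
          C₂ * ((Nat.totient q : ℝ) * (X / q) ^ ((l : ℝ) / (2 * k) + ε))) := by gcongr
      _ = _ := by ring
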